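/- All undirected graphs are finite and simple. **DAG treedepth.** Let $D$ be a finite directed acyclic graph (DAG). A *source* is a vertex without in-neighbours. A *DAG elimination forest* of $D$ is built recursively: if $D$ is empty, the forest is empty; if the underlying undirected graph of $D$ is connected, the forest is a tree whose root is some source $s$ of $D$ and whose subtrees below the root are the trees of a DAG elimination forest of the DAG obtained from $D$ by deleting $s$ and all vertices reachable from $s$; if the underlying undirected graph of $D$ is disconnected, the forest is the union of DAG elimination forests of its connected components. The *DAG treedepth* $\mathrm{dtd}(D)$ is the minimum depth (number of nodes on a longest root-to-leaf path) of a DAG elimination forest of $D$. **Counting.** $\mathrm{hom}(H,G)$ is the number of maps $V(H)\to V(G)$ that send edges of $H$ to edges of $G$; $\mathrm{sub}(H,G)$ is the number of subgraphs of $G$ that are isomorphic to $H$. A graph is $d$-degenerate if each of its nonempty subgraphs has a vertex of degree at most $d$ in that subgraph. **Machine model.** A unit-cost RAM program is a finite list of instructions using a fixed finite number of registers that hold natural numbers (initially $0$) and form its whole working memory: load a constant, copy, $+$, truncated $-$, $\times$, integer division, jump if one register is less than another, and read-only queries to the host graph $G$ on $\{0,\dots,n-1\}$, which is given by adjacency lists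 (in arbitrary order) together with its adjacency matrix: the number $n$, the degree of a vertex, the $i$-th entry of the adjacency list of a vertex, whether two vertices are adjacent. Each instruction takes one step. **Theorem.** 1. Every finite DAG $D$ with $\ell$ edges (so every acyclic orientation of an $\ell$-edge pattern graph) satisfies $\mathrm{dtd}(D)\le\lfloor \ell/5\rfloor+3$. 2. For fixed $H$ and $d$, both $\mathrm{hom}(H,G)$ and $\mathrm{sub}(H,G)$ can be computed in time $O(n^{\lfloor \ell/5\rfloor+3})$ and constant space on $n$-vertex $d$-degenerate hosts $G$, where $\ell=|E(H)|$. Precisely, there is a function $f:\mathbb N^2\to\mathbb N$ such that for every $d$ and every $k$-vertex, $\ell$-edge graph $H$ there are two programs, each with at most $f(k,d)$ registers, such that on every $d$-degenerate graph $G$ with $n\ge 1$ vertices (and every presentation of $G$ as above) the first stops with output $\mathrm{hom}(H,G)$ and the second with output $\mathrm{sub}(H,G)$, each after at most $f(k,d)\cdot n^{\lfloor \ell/5\rfloor+3}$ steps, and during the runs no register ever holds a number larger than $(n+2)^{f(k,d)}$ (that is, registers are words of $O(\log n)$ bits). -/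

import Mathlib

namespace Digraph

variable {V : Type*}

/-- A directed graph is acyclic if no vertex lies on a directed cycle (in particular, there are no
loops and no pairs of antiparallel edges). -/
def IsAcyclic (D : Digraph V) : Prop :=
  ∀ v, ¬ Relation.TransGen D.Adj v v

/-- The number of (directed) edges. -/
noncomputable def numEdges (D : Digraph V) : ℕ :=
  Set.ncard {p : V × V | D.Adj p.1 p.2}

/-- `s` is a source of the sub-digraph of `D` induced by `U`: it has no in-neighbour in `U`. -/
def IsSourceIn (D : Digraph V) (U : Set V) (s : V) : Prop :=
  s ∈ U ∧ ∀ v ∈ U, ¬ D.Adj v s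

/-- The set consisting of `s` and of all vertices that can be reached from `s` along a directed path
of the sub-digraph of `D` induced by `U`. -/
def reachIn (D : Digraph V) (U : Set V) (s : V) : Set V :=
  {v | Relation.ReflTransGen (fun a b => a ∈ U ∧ b ∈ U ∧ D.Adj a b) s v}

/-- The underlying undirected graph of the sub-digraph of `D` induced by `U`. -/
def underlyingOn (D : Digraph V) (U : Set V) : SimpleGraph U :=
  D.toSimpleGraphInclusive.induce U

/-- DAG elimination forests of the sub-digraph of `D` induced by `U`.

* `empty`: the forest of the empty digraph is empty.
* `root`: if the underlying undirected graph is connected, the forest is a tree; its root is a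
  source `s`, and the trees below the root are those of a forest of what remains after deleting `s`
  and all vertices reachable from `s`. (If `s` is the only source, nothing remains and the tree is a
  single node.)
* `union`: if the underlying undirected graph is disconnected, the forest is the union of forests
  for its connected components. -/
inductive ElimForest (D : Digraph V) : Set V → Type _
  | empty : ElimForest D ∅
  | root (U : Set V) (hU : (D.underlyingOn U).Connected) (s : V) (hs : D.IsSourceIn U s)
      (below : ElimForest D (U \ D.reachIn U s)) : ElimForest D U
  | union (U : Set V) (hne : U.Nonempty) (hU : ¬ (D.underlyingOn U).Connected)
      (parts : ∀ C : (D.underlyingOn U).ConnectedComponent,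
        ElimForest D (Subtype.val '' C.supp)) : ElimForest D U

/-- The depth of a DAG elimination forest: the number of nodes on a longest root-to-leaf path. -/
noncomputable def ElimForest.depth {D : Digraph V} : {U : Set V} → ElimForest D U → ℕ∞
  | _, .empty => 0
  | _, .root _ _ _ _ below => below.depth + 1
  | _, .union _ _ _ parts => ⨆ C, (parts C).depth

/-- The DAG treedepth: the minimum depth of a DAG elimination forest (`⊤` if there is none, which
does not happen for finite acyclic digraphs). -/
noncomputable def dagTreedepth (D : Digraph V) : ℕ∞ :=
  ⨅ F : ElimForest D Set.univ, F.depth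

end Digraph

namespace SimpleGraph

/-- A graph is `d`-degenerate if every nonempty subgraph contains a vertex whose degree in that
subgraph is at most `d`. -/
def IsDegenerate {V : Type*} (G : SimpleGraph V) (d : ℕ) : Prop :=
  ∀ S : G.Subgraph, S.verts.Nonempty → ∃ v ∈ S.verts, (S.neighborSet v).ncard ≤ d

/-- An adjacency-list presentation of a graph on `{0, …, n - 1}`: for every vertex, a list of its
neighbours, without repetitions and in an arbitrary order. -/
structure AdjLists {n : ℕ} (G : SimpleGraph (Fin n)) where
  nbrs : Fin n → List (Fin n)
  nodup : ∀ v, (nbrs v).Nodup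
  mem_iff : ∀ v w, w ∈ nbrs v ↔ G.Adj v w

namespace AdjLists

variable {n : ℕ} {G : SimpleGraph (Fin n)}

/-- The length of the adjacency list of `v` (`0` if `v` is not a vertex). -/
def degree (L : G.AdjLists) (v : ℕ) : ℕ :=
  if h : v < n then (L.nbrs ⟨v, h⟩).length else 0

/-- The `i`-th entry of the adjacency list of `v`, counting from `0` (`0` if there is none). -/
def neighbor (L : G.AdjLists) (v i : ℕ) : ℕ :=
  if h : v < n then (((L.nbrs ⟨v, h⟩)[i]?).map Fin.val).getD 0 else 0

/-- The entry `(u, v)` of the adjacency matrix (`0` if `u` or `v` is not a vertex). -/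
def matrixEntry (L : G.AdjLists) (u v : ℕ) : ℕ :=
  if h : u < n ∧ v < n then (if ⟨v, h.2⟩ ∈ L.nbrs ⟨u, h.1⟩ then 1 else 0) else 0

end AdjLists

end SimpleGraph

namespace RAM

/-- Instructions of a random access machine with `s` registers, each of which holds a natural
number, and with read-only random access to a host graph. The first argument of an instruction, if
it is a register, is the one that receives the result. -/
inductive Instr (s : ℕ) : Type
  | const (r : Fin s) (c : ℕ)
  | copy (r a : Fin s)
  | add (r a b : Fin s)
  | sub (r a b : Fin s)
  | mul (r a b : Fin s)
  | div (r a b : Fin s)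
  /-- jump to the instruction with number `target` if the content of `a` is less than that of `b` -/
  | jumpLt (a b : Fin s) (target : ℕ)
  /-- the number of vertices of the host graph -/
  | order (r : Fin s)
  /-- the degree of the vertex in register `a` -/
  | degree (r a : Fin s)
  /-- the entry of the adjacency list of the vertex in `a` at the position in `b` -/
  | neighbor (r a b : Fin s)
  /-- `1` if the vertices in `a` and `b` are adjacent, and `0` otherwise -/
  | adjacent (r a b : Fin s)

/-- A program: a number of registers, a finite list of instructions, an output register. The
registers are the whole working memory. -/
structure Program where
  numRegs : ℕ
  code : List (Instr numRegs)
  out : Fin numRegs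

/-- A configuration: the number of the next instruction and the contents of the registers. -/
structure Config (s : ℕ) where
  pc : ℕ
  reg : Fin s → ℕ

/-- Store `x` in register `r` and go on to the next instruction. -/
def Config.store {s : ℕ} (c : Config s) (r : Fin s) (x : ℕ) : Config s :=
  ⟨c.pc + 1, Function.update c.reg r x⟩

variable {n : ℕ} {G : SimpleGraph (Fin n)}

/-- The effect of one instruction. -/
def exec {s : ℕ} (L : G.AdjLists) (c : Config s) : Instr s → Config s
  | .const r x => c.store r x
  | .copy r a => c.store r (c.reg a)
  | .add r a b => c.store r (c.reg a + c.reg b)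
  | .sub r a b => c.store r (c.reg a - c.reg b)
  | .mul r a b => c.store r (c.reg a * c.reg b)
  | .div r a b => c.store r (c.reg a / c.reg b)
  | .jumpLt a b target => ⟨if c.reg a < c.reg b then target else c.pc + 1, c.reg⟩
  | .order r => c.store r n
  | .degree r a => c.store r (L.degree (c.reg a))
  | .neighbor r a b => c.store r (L.neighbor (c.reg a) (c.reg b))
  | .adjacent r a b => c.store r (L.matrixEntry (c.reg a) (c.reg b))

/-- One step of a program. The program stops when there is no instruction with number `pc`. -/
def Program.step (P : Program) (L : G.AdjLists) (c : Config P.numRegs) : Config P.numRegs :=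
  match P.code[c.pc]? with
  | some i => exec L c i
  | none => c

/-- The configuration after `t` steps; at the start, all registers are `0`. -/
def Program.run (P : Program) (L : G.AdjLists) (t : ℕ) : Config P.numRegs :=
  (P.step L)^[t] ⟨0, fun _ => 0⟩

/-- On the host graph presented by `L`, the program stops after at most `time` steps with `value` in
its output register, and at no moment does a register hold a number greater than `maxWord`. -/
def Program.Computes (P : Program) (L : G.AdjLists) (value time maxWord : ℕ) : Prop :=
  ∃ t ≤ time, P.code.length ≤ (P.run L t).pc ∧ (P.run L t).reg P.out = value ∧
    ∀ i ≤ t, ∀ r, (P.run L i).reg r ≤ maxWord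

end RAM

/-! Both statements rest on the same economy: a level of elimination that destroys five edges pays
for itself, and what remains when no such level exists is so restricted that repeated halving
finishes it within the additive constant.

Treedepth (`Digraph.HasForest.of_isAcyclic`). If some source has at least five edges whose heads it
reaches, it becomes the root. Otherwise every vertex is assigned to a source that reaches it, and
two sources are adjacent in the root graph if an edge joins their classes. If a source has three
neighbours there, the bound of four edges per source forces all edges to share one head, and depth 2
suffices (`of_three_neighbors`). Otherwise the root graph is a path or a cycle. One source opens it,
and choosing middle sources repeatedly takes logarithmic depth (`of_labelling`). A connected digraph
of this kind with at least five sources has fewer sources than edges (`card_sources_lt`), and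
`five_mul_add_le_two_pow` compares the logarithm with `ℓ / 5`.

Counting. The programs do not use DAG elimination forests. They follow a plan on the undirected
pattern, `EdgeElim`, whose steps eliminate one vertex or both ends of an edge. A `d`-degenerate host
has at most `d * n` edges, so trying all images of a vertex or of an edge costs `O(n)`, and separate
parts of the pattern contribute factors. Thus depth `k` gives time `O(n ^ k)`, with registers only
for the current partial map and the partial sums (`exists_countsExtensions`).

A plan of depth `ℓ / 5 + 3` exists by `exists_plan`. Vertices of degree at least five and edges with
degree sum at least six are eliminated as long as there are any. Apart from stars, what remains has
maximum degree three, and neighbours of its vertices of degree three have degree at most two. There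
the edges are counted only in the core, that is, without the leaves (`of_sparse`). In the last case
small pendant parts hang on paths and cycles; they cost one step beyond the halving (`of_core`,
`of_pendant`).

Subgraphs are counted through injective homomorphisms: inclusion–exclusion over the identified
pairs, where identification never increases the number of edges, followed by division by the number
of automorphisms. -/

set_option linter.unusedSectionVars false

/-! ### Degrees and connectivity inside finite vertex sets. -/

namespace SimpleGraph

variable {V : Type*} [DecidableEq V] (G : SimpleGraph V) [DecidableRel G.Adj]

/-- The number of neighbours of `v` in the finite set `U`. -/
def degIn (U : Finset V) (v : V) : ℕ := (U.filter fun w => G.Adj v w).card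

/-- The sum of the degrees of the subgraph induced by `U`, that is, twice its number of edges. -/
def volIn (U : Finset V) : ℕ := ∑ v ∈ U, G.degIn U v

/-- The subgraph induced by `U` has no proper nonempty part without edges to the rest of `U`. -/
def PreconnectedIn (U : Finset V) : Prop :=
  ∀ S ⊆ U, S.Nonempty → (∀ a ∈ S, ∀ b ∈ U, G.Adj a b → b ∈ S) → S = U

variable {G}

lemma degIn_mono {S U : Finset V} (h : S ⊆ U) (v : V) : G.degIn S v ≤ G.degIn U v :=
  Finset.card_le_card (Finset.filter_subset_filter _ h)

lemma volIn_mono {S U : Finset V} (h : S ⊆ U) : G.volIn S ≤ G.volIn U :=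
  (Finset.sum_le_sum fun v _ => degIn_mono h v).trans (Finset.sum_le_sum_of_subset h)

lemma degIn_erase_add (U : Finset V) {u : V} (hu : u ∈ U) (v : V) :
    G.degIn (U.erase u) v + (if G.Adj v u then 1 else 0) = G.degIn U v := by
  unfold degIn
  rw [Finset.filter_erase]
  split_ifs with h
  · exact Finset.card_erase_add_one (by simp [hu, h])
  · rw [Finset.erase_eq_of_notMem (by simp [h])]; rfl

lemma degIn_erase_self (U : Finset V) (u : V) : G.degIn (U.erase u) u = G.degIn U u := by
  unfold degIn
  rw [Finset.filter_erase, Finset.erase_eq_of_notMem (by simp)]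

lemma degIn_erase_of_adj {U : Finset V} {u v : V} (hu : u ∈ U) (h : G.Adj v u) :
    G.degIn (U.erase u) v + 1 = G.degIn U v := by
  simpa [h] using degIn_erase_add (G := G) U hu v

lemma degIn_erase_of_not_adj {U : Finset V} {u v : V} (h : ¬ G.Adj v u) :
    G.degIn (U.erase u) v = G.degIn U v := by
  by_cases hu : u ∈ U
  · simpa [h] using degIn_erase_add (G := G) U hu v
  · rw [Finset.erase_eq_of_notMem hu]

lemma volIn_erase_add {U : Finset V} {u : V} (hu : u ∈ U) :
    G.volIn (U.erase u) + 2 * G.degIn U u = G.volIn U := by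
  have h1 : G.volIn U = ∑ v ∈ U.erase u, G.degIn U v + G.degIn U u :=
    (Finset.sum_erase_add U _ hu).symm
  have h2 : ∑ v ∈ U.erase u, G.degIn U v = G.volIn (U.erase u) + G.degIn U u := by
    unfold volIn
    rw [← Finset.sum_congr rfl fun v _ => degIn_erase_add U hu v, Finset.sum_add_distrib,
      ← degIn_erase_self U u]
    congr 1
    unfold degIn
    rw [Finset.card_filter]
    exact Finset.sum_congr rfl fun v _ => by simp only [G.adj_comm]
  omega

lemma volIn_erase_erase_add {U : Finset V} {u v : V} (hu : u ∈ U) (hv : v ∈ U) (h : G.Adj u v) :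
    G.volIn ((U.erase u).erase v) + 2 * (G.degIn U u + G.degIn U v) = G.volIn U + 2 := by
  have h1 := volIn_erase_add (G := G) hu
  have h2 := volIn_erase_add (G := G) (U := U.erase u) (u := v) (by simp [hv, h.ne'])
  have h3 := degIn_erase_of_adj hu h.symm
  omega

lemma degIn_pos_iff {U : Finset V} {v : V} : 0 < G.degIn U v ↔ ∃ w ∈ U, G.Adj v w := by
  simp [degIn, Finset.card_pos, Finset.filter_nonempty_iff]

lemma degIn_eq_zero_iff {U : Finset V} {v : V} : G.degIn U v = 0 ↔ ∀ w ∈ U, ¬ G.Adj v w := by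
  simp [degIn, Finset.filter_eq_empty_iff]

lemma degIn_le_one_iff {U : Finset V} {v : V} :
    G.degIn U v ≤ 1 ↔ ∀ a ∈ U, ∀ b ∈ U, G.Adj v a → G.Adj v b → a = b := by
  unfold degIn
  rw [Finset.card_le_one]
  simp only [Finset.mem_filter]
  exact ⟨fun h a ha b hb h1 h2 => h a ⟨ha, h1⟩ b ⟨hb, h2⟩,
    fun h a ha b hb => h a ha.1 b hb.1 ha.2 hb.2⟩

/-- Deleting a vertex of degree at most one keeps a set connected. -/
lemma PreconnectedIn.erase {U : Finset V} (hU : G.PreconnectedIn U) {u : V} (hu : u ∈ U)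
    (hd : G.degIn U u ≤ 1) : G.PreconnectedIn (U.erase u) := by
  intro S hS hne hc
  have hSU : S ⊆ U := hS.trans (Finset.erase_subset _ _)
  have huS : u ∉ S := fun h => by simpa using hS h
  by_cases h : ∃ w ∈ S, G.Adj w u
  · obtain ⟨w, hw, hwu⟩ := h
    have : insert u S = U := by
      refine hU _ (Finset.insert_subset hu hSU) (Finset.insert_nonempty _ _) ?_
      intro a ha b hb hab
      rcases Finset.mem_insert.1 ha with rfl | ha
      · rw [degIn_le_one_iff.1 hd b hb w (hSU hw) hab hwu.symm]
        exact Finset.mem_insert_of_mem hw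
      · by_cases hbu : b = u
        · simp [hbu]
        · exact Finset.mem_insert_of_mem (hc a ha b (Finset.mem_erase.2 ⟨hbu, hb⟩) hab)
    rw [← this, Finset.erase_insert huS]
  · push Not at h
    exfalso
    refine huS ((hU S hSU hne fun a ha b hb hab => ?_) ▸ hu)
    exact hc a ha b (Finset.mem_erase.2 ⟨fun e => h a ha (e ▸ hab), hb⟩) hab

/-- A connected set of maximum degree at most two that has an end vertex can be labelled
injectively by `0, 1, …` so that adjacent vertices get consecutive labels. -/
lemma PreconnectedIn.exists_path_labelling {U : Finset V} (hU : G.PreconnectedIn U)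
    (hd : ∀ v ∈ U, G.degIn U v ≤ 2) {t : V} (ht : t ∈ U) (ht1 : G.degIn U t ≤ 1) :
    ∃ f : V → ℕ, f t = 0 ∧ (∀ v ∈ U, f v < U.card) ∧ Set.InjOn f U ∧
      (∀ v ∈ U, ∀ w ∈ U, G.Adj v w → f v ≤ f w + 1) ∧ 2 * U.card ≤ G.volIn U + 2 := by
  induction hn : U.card generalizing U t with
  | zero => simp_all
  | succ n ih =>
    have hcard : (U.erase t).card = n := by rw [Finset.card_erase_of_mem ht, hn]; rfl
    have hvol := volIn_erase_add (G := G) ht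
    rcases Nat.eq_zero_or_pos (G.degIn U t) with h0 | hpos
    · have h1 : {t} = U := by
        refine hU {t} (by simpa using ht) ⟨t, by simp⟩ ?_
        intro a ha b hb hab
        rw [Finset.mem_singleton.1 ha] at hab
        exact absurd hab (degIn_eq_zero_iff.1 h0 b hb)
      subst h1
      refine ⟨fun _ => 0, rfl, by simp, by simp, by simp, ?_⟩
      simp at hn
      omega
    · obtain ⟨w, hw, htw⟩ := degIn_pos_iff.1 hpos
      have hw' : w ∈ U.erase t := Finset.mem_erase.2 ⟨htw.ne', hw⟩
      have hwd := degIn_erase_of_adj ht htw.symm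
      have hwd2 := hd w hw
      -- The only neighbour `w` of the end `t` is an end of what remains, so the labelling there
      -- starts at `w` and is shifted by one.
      obtain ⟨f, hf0, hflt, hfinj, hfadj, hfv⟩ := ih (hU.erase ht ht1)
        (fun v hv => (degIn_mono (Finset.erase_subset _ _) v).trans
          (hd v (Finset.mem_of_mem_erase hv))) hw' (by omega) hcard
      have huniq : ∀ v ∈ U, G.Adj t v → v = w := fun v hv h =>
        degIn_le_one_iff.1 ht1 v hv w hw h htw
      refine ⟨fun v => if v = t then 0 else f v + 1, by simp, ?_, ?_, ?_, by omega⟩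
      · intro v hv
        by_cases h : v = t
        · simp [h]
        · have := hflt v (Finset.mem_erase.2 ⟨h, hv⟩)
          simp [h]; omega
      · intro a ha b hb hab
        by_cases h1 : a = t <;> by_cases h2 : b = t <;> simp_all
        exact hfinj (by simp_all) (by simp_all) hab
      · intro a ha b hb hab
        by_cases h1 : a = t <;> by_cases h2 : b = t
        · simp [h1]
        · simp [h1]
        · have := huniq a ha (h2 ▸ hab.symm)
          subst this
          simp [h1, h2, hf0]
        · have := hfadj a (Finset.mem_erase.2 ⟨h1, ha⟩) b (Finset.mem_erase.2 ⟨h2, hb⟩) hab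
          simp [h1, h2]; omega


/-- A property of finite sets that holds for connected parts and is passed on to unions of parts
without edges between them holds for every set. -/
lemma induction_on_components {P : Finset V → Prop} (U : Finset V) (h0 : P ∅)
    (hunion : ∀ S T, Disjoint S T → S ∪ T ⊆ U → (∀ a ∈ S, ∀ b ∈ T, ¬ G.Adj a b) →
      P S → P T → P (S ∪ T))
    (hconn : ∀ S ⊆ U, S.Nonempty → G.PreconnectedIn S →
      (∀ a ∈ S, ∀ b ∈ U, G.Adj a b → b ∈ S) → P S) : P U := by
  -- Closedness in `U` is carried along, because connected parts must be closed in all of `U` and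
  -- not only in the set that is being split.
  suffices ∀ n, ∀ W ⊆ U, W.card = n → (∀ a ∈ W, ∀ b ∈ U, G.Adj a b → b ∈ W) → P W from
    this _ U subset_rfl rfl fun _ _ b hb _ => hb
  intro n
  induction n using Nat.strong_induction_on with
  | _ n ih =>
    intro W hW hn hcl
    rcases W.eq_empty_or_nonempty with rfl | hne
    · exact h0
    by_cases hc : G.PreconnectedIn W
    · exact hconn W hW hne hc hcl
    unfold PreconnectedIn at hc
    push Not at hc
    obtain ⟨S, hS, hSne, hScl, hSW⟩ := hc
    have hlt : S.card < W.card := Finset.card_lt_card (hS.ssubset_of_ne hSW)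
    have hlt' : (W \ S).card < W.card := by
      rw [Finset.card_sdiff_of_subset hS]
      have := hSne.card_pos
      omega
    have hno : ∀ a ∈ S, ∀ b ∈ W \ S, ¬ G.Adj a b := fun a ha b hb hab =>
      (Finset.mem_sdiff.1 hb).2 (hScl a ha b (Finset.mem_sdiff.1 hb).1 hab)
    rw [← Finset.union_sdiff_of_subset hS]
    refine hunion _ _ Finset.disjoint_sdiff ?_ hno ?_ ?_
    · rw [Finset.union_sdiff_of_subset hS]; exact hW
    · exact ih _ (hn ▸ hlt) S (hS.trans hW) rfl fun a ha b hb hab =>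
        hScl a ha b (hcl a (hS ha) b hb hab) hab
    · refine ih _ (hn ▸ hlt') _ (Finset.sdiff_subset.trans hW) rfl fun a ha b hb hab => ?_
      have haW := (Finset.mem_sdiff.1 ha).1
      exact Finset.mem_sdiff.2 ⟨hcl a haW b hb hab, fun hbS => hno b hbS a ha hab.symm⟩

end SimpleGraph

/-! ### Elimination plans for paths, cycles and pendant parts. -/

namespace SimpleGraph

variable {V : Type*} [DecidableEq V] (G : SimpleGraph V) [DecidableRel G.Adj]

/-- A plan of depth at most `k` for eliminating the vertices in `U`: parts without edges between
them are treated separately, and a step eliminates a vertex or both ends of an edge. -/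
inductive EdgeElim : ℕ → Finset V → Prop
  | empty (k : ℕ) : EdgeElim k ∅
  | union {k : ℕ} {S T : Finset V} (hST : Disjoint S T) (h : ∀ a ∈ S, ∀ b ∈ T, ¬ G.Adj a b)
      (hS : EdgeElim k S) (hT : EdgeElim k T) : EdgeElim k (S ∪ T)
  | vertex {k : ℕ} {U : Finset V} {u : V} (hu : u ∈ U) (h : EdgeElim k (U.erase u)) :
      EdgeElim (k + 1) U
  | edge {k : ℕ} {U : Finset V} {u v : V} (hu : u ∈ U) (hv : v ∈ U) (huv : G.Adj u v)
      (h : EdgeElim k ((U.erase u).erase v)) : EdgeElim (k + 1) U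

variable {G}

namespace EdgeElim

lemma mono {k l : ℕ} {U : Finset V} (h : G.EdgeElim k U) (hkl : k ≤ l) : G.EdgeElim l U := by
  induction h generalizing l with
  | empty => exact .empty l
  | union hST h _ _ ih1 ih2 => exact .union hST h (ih1 hkl) (ih2 hkl)
  | vertex hu _ ih =>
    obtain ⟨l, rfl⟩ : ∃ m, l = m + 1 := ⟨l - 1, by omega⟩
    exact .vertex hu (ih (by omega))
  | edge hu hv huv _ ih =>
    obtain ⟨l, rfl⟩ : ∃ m, l = m + 1 := ⟨l - 1, by omega⟩
    exact .edge hu hv huv (ih (by omega))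

lemma of_components {k : ℕ} (U : Finset V)
    (h : ∀ S ⊆ U, S.Nonempty → G.PreconnectedIn S →
      (∀ a ∈ S, ∀ b ∈ U, G.Adj a b → b ∈ S) → G.EdgeElim k S) : G.EdgeElim k U :=
  induction_on_components U (.empty k) (fun _ _ hd _ he hS hT => .union hd he hS hT) h

/-- A set of maximum degree at most one needs a single step. -/
lemma of_degIn_le_one {U : Finset V} (hU : ∀ v ∈ U, G.degIn U v ≤ 1) : G.EdgeElim 1 U := by
  refine of_components U fun S hS hne hc hcl => ?_
  obtain ⟨v, hv⟩ := hne
  by_cases h : ∃ w ∈ S, G.Adj v w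
  · obtain ⟨w, hw, hvw⟩ := h
    refine .edge hv hw hvw ?_
    have : {v, w} = S := by
      refine hc _ (by simp [Finset.insert_subset_iff, hv, hw]) (by simp) ?_
      intro a ha b hb hab
      simp only [Finset.mem_insert, Finset.mem_singleton] at ha ⊢
      rcases ha with rfl | rfl
      · exact .inr (degIn_le_one_iff.1 (hU a (hS hv)) b (hS hb) w (hS hw) hab hvw)
      · exact .inl (degIn_le_one_iff.1 (hU a (hS hw)) b (hS hb) v (hS hv) hab hvw.symm)
    have h0 : (S.erase v).erase w = ∅ := by
      rw [← this]; ext x; simp; tauto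
    rw [h0]
    exact .empty 0
  · push Not at h
    have : {v} = S := by
      refine hc _ (by simpa using hv) (by simp) ?_
      intro a ha b hb hab
      rw [Finset.mem_singleton.1 ha] at hab
      exact absurd hab (h b hb)
    refine .vertex hv ?_
    rw [← this]
    simp [EdgeElim.empty]

/-- Eliminating a path by repeatedly removing an edge in the middle. -/
lemma of_path_labelling {k : ℕ} {U : Finset V} {f : V → ℕ} {a : ℕ}
    (hinj : Set.InjOn f U) (hadj : ∀ v ∈ U, ∀ w ∈ U, G.Adj v w → f v ≤ f w + 1)
    (hlo : ∀ v ∈ U, a ≤ f v) (hhi : ∀ v ∈ U, f v + 2 < a + 2 ^ (k + 1)) : G.EdgeElim k U := by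
  induction k generalizing U a with
  | zero =>
    have : U = ∅ := Finset.eq_empty_of_forall_notMem fun v hv => by
      have := hlo v hv; have := hhi v hv; omega
    rw [this]
    exact .empty 0
  | succ k ih =>
    have hpow : 2 ^ (k + 1 + 1) = 2 * 2 ^ (k + 1) := by ring
    have hpos : 2 ≤ 2 ^ (k + 1) := by
      have := Nat.one_le_two_pow (n := k); rw [pow_succ]; omega
    obtain ⟨q, hq⟩ : ∃ q, 2 ^ (k + 1) = q + 2 := ⟨2 ^ (k + 1) - 2, by omega⟩
    -- Depth `k` handles `q = 2 ^ (k + 1) - 2` consecutive labels, and `2 ^ (k + 2) - 2 = 2 * q +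
    -- 2`. The labels `c` and `c + 1` are the two in the middle.
    set c := a + q with hc
    have low : ∀ W ⊆ U, (∀ v ∈ W, f v < c) → G.EdgeElim k W := fun W hW hlt =>
      ih (a := a) (hinj.mono (by exact_mod_cast hW)) (fun v hv w hw => hadj v (hW hv) w (hW hw))
        (fun v hv => hlo v (hW hv)) (fun v hv => by have := hlt v hv; omega)
    have high : ∀ W ⊆ U, (∀ v ∈ W, c + 2 ≤ f v) → G.EdgeElim k W := fun W hW hlt =>
      ih (a := c + 2) (hinj.mono (by exact_mod_cast hW))
        (fun v hv w hw => hadj v (hW hv) w (hW hw)) hlt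
        (fun v hv => by have := hhi v (hW hv); omega)
    by_cases hedge : ∃ u ∈ U, ∃ v ∈ U, f u = c ∧ f v = c + 1 ∧ G.Adj u v
    · obtain ⟨u, hu, v, hv, hfu, hfv, huv⟩ := hedge
      refine .edge hu hv huv ?_
      have hne : ∀ w ∈ (U.erase u).erase v, w ∈ U ∧ f w ≠ c ∧ f w ≠ c + 1 := by
        intro w hw
        simp only [Finset.mem_erase] at hw
        exact ⟨hw.2.2, fun h => hw.2.1 (hinj hw.2.2 hu (by omega)),
          fun h => hw.1 (hinj hw.2.2 hv (by omega))⟩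
      rw [← Finset.filter_union_filter_not_eq (fun w => f w < c) ((U.erase u).erase v)]
      refine .union (Finset.disjoint_filter_filter_not _ _ _) ?_ (low _ ?_ ?_) (high _ ?_ ?_)
      · intro x hx y hy hxy
        simp only [Finset.mem_filter] at hx hy
        have := hne x hx.1; have := hne y hy.1
        have := hadj y (hne y hy.1).1 x (hne x hx.1).1 hxy.symm
        omega
      · exact fun w hw => (hne w (Finset.mem_filter.1 hw).1).1
      · exact fun w hw => (Finset.mem_filter.1 hw).2
      · exact fun w hw => (hne w (Finset.mem_filter.1 hw).1).1
      · intro w hw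
        have := hne w (Finset.mem_filter.1 hw).1
        have := (Finset.mem_filter.1 hw).2
        omega
    -- Without an edge between the middle labels no edge crosses from `c` to `c + 1`. The two halves
    -- are then separate parts, and each may spend the step on its own middle vertex.
    · rw [← Finset.filter_union_filter_not_eq (fun w => f w < c + 1) U]
      refine .union (Finset.disjoint_filter_filter_not _ _ _) ?_ ?_ ?_
      · intro x hx y hy hxy
        simp only [Finset.mem_filter] at hx hy
        have := hadj y hy.1 x hx.1 hxy.symm
        exact hedge ⟨x, hx.1, y, hy.1, by omega, by omega, hxy⟩
      · by_cases h : ∃ u ∈ U, f u = c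
        · obtain ⟨u, hu, hfu⟩ := h
          refine .vertex (u := u) (by simp [hu, hfu]) (low _ ?_ ?_)
          · exact (Finset.erase_subset _ _).trans (Finset.filter_subset _ _)
          · intro w hw
            simp only [Finset.mem_erase, Finset.mem_filter] at hw
            have : f w ≠ c := fun e => hw.1 (hinj hw.2.1 hu (by omega))
            omega
        · push Not at h
          refine (low _ (Finset.filter_subset _ _) fun w hw => ?_).mono (Nat.le_succ k)
          simp only [Finset.mem_filter] at hw
          have := h w hw.1
          omega
      · by_cases h : ∃ u ∈ U, f u = c + 1
        · obtain ⟨u, hu, hfu⟩ := h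
          refine .vertex (u := u) (by simp [hu, hfu]) (high _ ?_ ?_)
          · exact (Finset.erase_subset _ _).trans (Finset.filter_subset _ _)
          · intro w hw
            simp only [Finset.mem_erase, Finset.mem_filter] at hw
            have : f w ≠ c + 1 := fun e => hw.1 (hinj hw.2.1 hu (by omega))
            omega
        · push Not at h
          refine (high _ (Finset.filter_subset _ _) fun w hw => ?_).mono (Nat.le_succ k)
          simp only [Finset.mem_filter] at hw
          have := h w hw.1
          omega

/-- This is where halving meets the rate of five edges per level, both for plans and for DAG
elimination forests. It is tight at `q = 1`. -/
lemma five_mul_add_le_two_pow (q : ℕ) : 5 * q + 3 ≤ 4 * 2 ^ q := by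
  induction q with
  | zero => norm_num
  | succ q ih =>
    rcases Nat.eq_zero_or_pos q with rfl | h
    · norm_num
    · rw [pow_succ]; omega

/-- Sets of maximum degree at most two. -/
lemma of_degIn_le_two {U : Finset V} (hU : ∀ v ∈ U, G.degIn U v ≤ 2) :
    G.EdgeElim ((G.volIn U + 2) / 10 + 2) U := by
  refine of_components U fun S hS hne hc hcl => ?_
  have hvS := volIn_mono (G := G) hS
  have hS2 : ∀ v ∈ S, G.degIn S v ≤ 2 := fun v hv => (degIn_mono hS v).trans (hU v (hS hv))
  have key := five_mul_add_le_two_pow ((G.volIn U + 2) / 10)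
  set q := (G.volIn U + 2) / 10 with hq
  by_cases h1 : ∃ t ∈ S, G.degIn S t ≤ 1
  · obtain ⟨t, ht, ht1⟩ := h1
    obtain ⟨f, -, hlt, hinj, hadj, hvol⟩ := hc.exists_path_labelling hS2 ht ht1
    refine of_path_labelling (a := 0) hinj hadj (fun _ _ => Nat.zero_le _) fun v hv => ?_
    have := hlt v hv
    have h3 : 2 ^ (q + 2 + 1) = 8 * 2 ^ q := by ring
    omega
  -- A cycle: removing both ends of an edge takes away three edges and leaves only paths.
  · push Not at h1
    obtain ⟨u, hu⟩ := hne
    obtain ⟨v, hv, huv⟩ := degIn_pos_iff.1 (by have := h1 u hu; omega : 0 < G.degIn S u)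
    refine .edge hu hv huv ?_
    have hvol := volIn_erase_erase_add hu hv huv
    have := h1 u hu
    have := h1 v hv
    refine of_components _ fun T hT hTne hTc hTcl => ?_
    have hTS : T ⊆ S := hT.trans ((Finset.erase_subset _ _).trans (Finset.erase_subset _ _))
    -- Since `S` is connected, `T` has a neighbour outside itself, and the vertex of `T` next to it
    -- is an end of the path `T`.
    have hTlt : ∃ t ∈ T, ∃ x ∈ S, x ∉ T ∧ G.Adj t x := by
      by_contra hcon
      push Not at hcon
      have : T = S := hc T hTS hTne fun a ha b hb hab => by
        by_contra hbT
        exact hcon a ha b hb hbT hab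
      have := hT (this ▸ hu)
      simp at this
    obtain ⟨t, ht, x, hx, hxT, htx⟩ := hTlt
    have ht1 : G.degIn T t ≤ 1 := by
      have h3 := degIn_erase_of_adj hx htx
      have h4 := degIn_mono (G := G) (S := T) (U := S.erase x)
        (fun y hy => Finset.mem_erase.2 ⟨fun e => hxT (e ▸ hy), hTS hy⟩) t
      have := hS2 t (hTS ht)
      omega
    obtain ⟨f, -, hlt, hinj, hadj, hvolT⟩ := hTc.exists_path_labelling
      (fun w hw => (degIn_mono hTS w).trans (hS2 w (hTS hw))) ht ht1
    have := volIn_mono (G := G) hT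
    refine of_path_labelling (a := 0) hinj hadj (fun _ _ => Nat.zero_le _) fun w hw => ?_
    have := hlt w hw
    have h3 : 2 ^ (q + 1 + 1) = 4 * 2 ^ q := by ring
    omega

/-- Components with at most two vertices that hang on single vertices cost one more step. -/
lemma of_pendant {k : ℕ} {B : Finset V} (hB : G.EdgeElim k B) {U : Finset V} (hBU : B ⊆ U)
    (hP : ∀ v ∈ U \ B, G.degIn (U \ B) v ≤ 1) (g : V → V)
    (hg : ∀ p ∈ U \ B, ∀ b ∈ B, G.Adj p b → b = g p)
    (hgg : ∀ p ∈ U \ B, ∀ p' ∈ U \ B, G.Adj p p' → g p = g p') : G.EdgeElim (k + 1) U := by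
  induction hB generalizing U with
  -- Once all of `B` is gone, only components with at most two vertices remain, and the additional
  -- step is spent here.
  | empty k => exact (of_degIn_le_one (by simpa using hP)).mono (by omega)
  | @union k S T hST hno _ _ ih1 ih2 =>
    -- Pendant vertices follow their anchor `g p`, also if it has already been eliminated. In the
    -- latter case they are put with `T`.
    set S' := S ∪ (U \ (S ∪ T)).filter (fun p => g p ∈ S) with hS'
    set T' := T ∪ (U \ (S ∪ T)).filter (fun p => ¬ g p ∈ S) with hT'
    have hU : U = S' ∪ T' := by
      ext x
      have := @hBU x
      simp only [hS', hT', Finset.mem_union, Finset.mem_filter, Finset.mem_sdiff] at this ⊢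
      tauto
    have hnot : ∀ x ∈ S, x ∉ T := fun x h1 h2 => Finset.disjoint_left.1 hST h1 h2
    have hS1 : S' \ S ⊆ U \ (S ∪ T) := by
      intro x hx
      simp only [hS', Finset.mem_sdiff, Finset.mem_union, Finset.mem_filter] at hx ⊢
      tauto
    have hT1 : T' \ T ⊆ U \ (S ∪ T) := by
      intro x hx
      simp only [hT', Finset.mem_sdiff, Finset.mem_union, Finset.mem_filter] at hx ⊢
      tauto
    rw [hU]
    refine .union ?_ ?_ (ih1 Finset.subset_union_left ?_ ?_ ?_)
      (ih2 Finset.subset_union_left ?_ ?_ ?_)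
    · rw [Finset.disjoint_left]
      intro x
      have := hnot x
      simp only [hS', hT', Finset.mem_union, Finset.mem_filter, Finset.mem_sdiff]
      tauto
    · intro a ha b hb hab
      simp only [hS', hT', Finset.mem_union, Finset.mem_filter] at ha hb
      rcases ha with ha | ha <;> rcases hb with hb | hb
      · exact hno a ha b hb hab
      · exact hb.2 (hg b hb.1 a (Finset.mem_union_left _ ha) hab.symm ▸ ha)
      · exact hnot _ ha.2 (hg a ha.1 b (Finset.mem_union_right _ hb) hab ▸ hb)
      · exact hb.2 (hgg a ha.1 b hb.1 hab ▸ ha.2)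
    · exact fun v hv => (degIn_mono hS1 v).trans (hP v (hS1 hv))
    · exact fun p hp b hb => hg p (hS1 hp) b (Finset.mem_union_left _ hb)
    · exact fun p hp p' hp' => hgg p (hS1 hp) p' (hS1 hp')
    · exact fun v hv => (degIn_mono hT1 v).trans (hP v (hT1 hv))
    · exact fun p hp b hb => hg p (hT1 hp) b (Finset.mem_union_right _ hb)
    · exact fun p hp p' hp' => hgg p (hT1 hp) p' (hT1 hp')
  | @vertex k B u hu _ ih =>
    have he : U.erase u \ B.erase u = U \ B := by
      ext x
      simp only [Finset.mem_sdiff, Finset.mem_erase]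
      exact ⟨fun h => ⟨h.1.2, fun hx => h.2 ⟨h.1.1, hx⟩⟩,
        fun h => ⟨⟨fun e => h.2 (e ▸ hu), h.1⟩, fun hx => h.2 hx.2⟩⟩
    refine .vertex (hBU hu) (ih (Finset.erase_subset_erase _ hBU) ?_ ?_ ?_) <;> rw [he]
    · exact hP
    · exact fun p hp b hb => hg p hp b (Finset.mem_of_mem_erase hb)
    · exact hgg
  | @edge k B u v hu hv huv _ ih =>
    have he : (U.erase u).erase v \ (B.erase u).erase v = U \ B := by
      ext x
      simp only [Finset.mem_sdiff, Finset.mem_erase]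
      exact ⟨fun h => ⟨h.1.2.2, fun hx => h.2 ⟨h.1.1, h.1.2.1, hx⟩⟩,
        fun h => ⟨⟨fun e => h.2 (e ▸ hv), fun e => h.2 (e ▸ hu), h.1⟩, fun hx => h.2 hx.2.2⟩⟩
    refine .edge (hBU hu) (hBU hv) huv
      (ih (Finset.erase_subset_erase _ (Finset.erase_subset_erase _ hBU)) ?_ ?_ ?_) <;> rw [he]
    · exact hP
    · exact fun p hp b hb => hg p hp b (Finset.mem_of_mem_erase (Finset.mem_of_mem_erase hb))
    · exact hgg

end EdgeElim

end SimpleGraph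

/-! ### Every pattern with `ℓ` edges has a plan of depth at most `ℓ / 5 + 3`. -/

namespace SimpleGraph

variable {V : Type*} [DecidableEq V] {G : SimpleGraph V} [DecidableRel G.Adj]

lemma adj_of_degIn_eq {S U : Finset V} (hS : S ⊆ U) {v : V} (h : G.degIn U v ≤ G.degIn S v)
    {w : V} (hw : w ∈ U) (hvw : G.Adj v w) : w ∈ S := by
  have := Finset.eq_of_subset_of_card_le (Finset.filter_subset_filter (G.Adj v) hS) h
  exact (Finset.mem_filter.1 (this ▸ Finset.mem_filter.2 ⟨hw, hvw⟩)).1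

lemma exists_of_degIn_eq_three {U : Finset V} {v : V} (h : G.degIn U v = 3) :
    ∃ a b c, a ∈ U ∧ b ∈ U ∧ c ∈ U ∧ G.Adj v a ∧ G.Adj v b ∧ G.Adj v c ∧ a ≠ b ∧ a ≠ c ∧ b ≠ c ∧
      ∀ x ∈ U, G.Adj v x → x = a ∨ x = b ∨ x = c := by
  obtain ⟨a, b, c, hab, hac, hbc, he⟩ := Finset.card_eq_three.1 h
  have hm : ∀ x, (x ∈ U ∧ G.Adj v x) ↔ x = a ∨ x = b ∨ x = c := fun x => by
    rw [← Finset.mem_filter, he]; simp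
  have ha := (hm a).2 (by simp)
  have hb := (hm b).2 (by simp)
  have hc := (hm c).2 (by simp)
  exact ⟨a, b, c, ha.1, hb.1, hc.1, ha.2, hb.2, hc.2, hab, hac, hbc, fun x h1 h2 => (hm x).1 ⟨h1, h2⟩⟩

variable (G) in
/-- All degrees in `U` are at most three, and neighbours of vertices of degree three have degree at
most two. -/
structure SparseIn (U : Finset V) : Prop where
  le_three : ∀ v ∈ U, G.degIn U v ≤ 3
  le_two : ∀ v ∈ U, ∀ w ∈ U, G.Adj v w → G.degIn U v = 3 → G.degIn U w ≤ 2

lemma SparseIn.mono {S U : Finset V} (hU : G.SparseIn U) (hS : S ⊆ U) : G.SparseIn S where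
  le_three v hv := (degIn_mono hS v).trans (hU.le_three v (hS hv))
  le_two v hv w hw hvw h := (degIn_mono hS w).trans (hU.le_two v (hS hv) w (hS hw) hvw
    (le_antisymm (hU.le_three v (hS hv)) (h ▸ degIn_mono hS v)))

variable (G) in
/-- The vertices of `U` whose degree in `U` is not one. -/
def coreIn (U : Finset V) : Finset V := U.filter fun v => G.degIn U v ≠ 1

namespace EdgeElim

/-- By sparsity, the neighbour in `hcore` has core degree one. Dropping all such `dead` neighbours
from the core leaves a set `B` of maximum degree two. A dead vertex has at most one neighbour
besides its anchor, namely a leaf. So outside `B` there are only components with at most two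
vertices, each attached to at most one vertex of `B`, and `of_pendant` adds one step to
`of_degIn_le_two`. -/
lemma of_core {U : Finset V}
    (hU : G.SparseIn U)
    (hcore : ∀ v ∈ G.coreIn U, G.degIn (G.coreIn U) v = 3 →
      ∃ w ∈ G.coreIn U, G.Adj v w ∧ G.degIn (G.coreIn U) w ≠ 2) :
    G.EdgeElim ((G.volIn (G.coreIn U) + 2) / 10 + 3) U := by
  set A := G.coreIn U with hA
  have hAU : A ⊆ U := Finset.filter_subset _ _
  rcases U.eq_empty_or_nonempty with rfl | ⟨c, hcU⟩
  · exact .empty _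
  let dead : V → Prop := fun w => G.degIn A w = 1 ∧ ∃ v ∈ A, G.Adj w v ∧ G.degIn A v = 3
  classical
  set B := A.filter (fun w => ¬ dead w) with hB
  have hBA : B ⊆ A := Finset.filter_subset _ _
  have hB2 : ∀ v ∈ B, G.degIn B v ≤ 2 := by
    intro v hv
    have hvA := hBA hv
    have h3 := (degIn_mono hAU v).trans (hU.le_three v (hAU hvA))
    have hm := degIn_mono (G := G) hBA v
    by_contra hcon
    have hv3 : G.degIn A v = 3 := by omega
    obtain ⟨w, hw, hvw, hw2⟩ := hcore v hvA hv3
    have hU3 : G.degIn U v = 3 :=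
      le_antisymm (hU.le_three v (hAU hvA)) (hv3 ▸ degIn_mono hAU v)
    have h4 := (degIn_mono hAU w).trans (hU.le_two v (hAU hvA) w (hAU hw) hvw hU3)
    have h5 : 0 < G.degIn A w := degIn_pos_iff.2 ⟨v, hvA, hvw.symm⟩
    have hdead : dead w := ⟨by omega, v, hvA, hvw.symm, hv3⟩
    have := adj_of_degIn_eq hBA (by omega) hw hvw
    exact (Finset.mem_filter.1 this).2 hdead
  have hvol := volIn_mono (G := G) hBA
  choose! h hhA hhadj hh3 using fun w (hw : dead w) => hw.2
  have hhB : ∀ w, dead w → h w ∈ B := fun w hw =>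
    Finset.mem_filter.2 ⟨hhA w hw, fun hd => by have := hd.1; have := hh3 w hw; omega⟩
  have hP : ∀ p ∈ U \ B, dead p ∧ p ∈ A ∨ ¬ dead p ∧ G.degIn U p = 1 := by
    intro p hp
    simp only [Finset.mem_sdiff, hB, Finset.mem_filter, hA, coreIn] at hp
    by_cases hd : dead p
    · obtain ⟨v, hv, hpv, -⟩ := hd.2
      left
      refine ⟨hd, Finset.mem_filter.2 ⟨hp.1, fun h1 => ?_⟩⟩
      have hv3 := hd.2.choose_spec.2.2
      have hva : hd.2.choose ∈ A := hd.2.choose_spec.1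
      have hpva := hd.2.choose_spec.2.1
      have hle := degIn_mono (G := G) hAU hd.2.choose
      have hle3 := hU.le_three _ (hAU hva)
      have := adj_of_degIn_eq hAU (by omega) hp.1 hpva.symm
      exact (Finset.mem_filter.1 this).2 h1
    · exact .inr ⟨hd, by_contra fun h1 => hp.2 ⟨⟨hp.1, h1⟩, hd⟩⟩
  have hnb : ∀ p, G.degIn U p = 1 → ∃ y ∈ U, G.Adj p y := fun p hp =>
    degIn_pos_iff.1 (by omega)
  choose! nb hnbU hnbadj using hnb
  -- The anchor of a leaf is its neighbour, or the anchor of its neighbour if that is dead. The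
  -- arbitrary value `c` serves leaves whose neighbour is a leaf, which are attached to nothing.
  let g : V → V := fun p => if dead p then h p else
    if nb p ∈ B then nb p else if dead (nb p) then h (nb p) else c
  have hdeadP : ∀ w ∈ U, dead w → w ∈ A → ∀ x ∈ U \ B, G.Adj w x → G.degIn U x = 1 := by
    intro w hw hd hwA x hx hwx
    rcases hP x hx with h1 | h1
    · have := degIn_le_one_iff.1 hd.1.le x h1.2 (h w) (hhA w hd) hwx (hhadj w hd)
      have := hh3 w hd
      have := h1.1.1
      simp_all
    · exact h1.2
  refine (of_pendant (of_degIn_le_two hB2) (hBA.trans hAU) ?_ g ?_ ?_).mono (by omega)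
  · intro p hp
    rcases hP p hp with h1 | h1
    · have hpU := (Finset.mem_sdiff.1 hp).1
      have hvB := hhB p h1.1
      have hle : G.degIn (U \ B) p ≤ G.degIn (U.erase (h p)) p := degIn_mono (fun x hx =>
        Finset.mem_erase.2 ⟨fun e => (Finset.mem_sdiff.1 hx).2 (e ▸ hvB),
          (Finset.mem_sdiff.1 hx).1⟩) p
      have h2 := degIn_erase_of_adj (hAU (hhA p h1.1)) (hhadj p h1.1)
      have h3 := hU.le_two (h p) (hAU (hhA p h1.1)) p hpU (hhadj p h1.1).symm
        (le_antisymm (hU.le_three _ (hAU (hhA p h1.1))) (hh3 p h1.1 ▸ degIn_mono hAU _))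
      omega
    · exact (degIn_mono Finset.sdiff_subset p).trans h1.2.le
  · intro p hp b hb hpb
    rcases hP p hp with h1 | h1
    · simp only [g, h1.1, if_true]
      exact degIn_le_one_iff.1 h1.1.1.le b (hBA hb) _ (hhA p h1.1) hpb (hhadj p h1.1)
    · have : b = nb p := degIn_le_one_iff.1 h1.2.le b (hAU (hBA hb)) _ (hnbU p h1.2) hpb
        (hnbadj p h1.2)
      simp only [g, h1.1, if_false, ← this, hb, if_true]
  · intro p hp p' hp' hpp
    have aux : ∀ q ∈ U \ B, ∀ q' ∈ U \ B, G.Adj q q' → dead q → g q = g q' := by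
      intro q hq q' hq' hqq hd
      have hqU := (Finset.mem_sdiff.1 hq).1
      have hqA : q ∈ A := by
        rcases hP q hq with h1 | h1
        · exact h1.2
        · exact absurd hd h1.1
      have hq1 := hdeadP q hqU hd hqA q' hq' hqq
      have hnd : ¬ dead q' := by
        rcases hP q' hq' with h1 | h1
        · exact absurd hq1 (Finset.mem_filter.1 h1.2).2
        · exact h1.1
      have hnbq : nb q' = q := degIn_le_one_iff.1 hq1.le _ (hnbU q' hq1) q hqU (hnbadj q' hq1)
        hqq.symm
      simp only [g, hd, hnd, hnbq, (Finset.mem_sdiff.1 hq).2, if_true, if_false]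
    rcases hP p hp with h1 | h1
    · exact aux p hp p' hp' hpp h1.1
    · rcases hP p' hp' with h2 | h2
      · exact (aux p' hp' p hp hpp.symm h2.1).symm
      · have e1 : nb p = p' := degIn_le_one_iff.1 h1.2.le _ (hnbU p h1.2) p'
          (Finset.mem_sdiff.1 hp').1 (hnbadj p h1.2) hpp
        have e2 : nb p' = p := degIn_le_one_iff.1 h2.2.le _ (hnbU p' h2.2) p
          (Finset.mem_sdiff.1 hp).1 (hnbadj p' h2.2) hpp.symm
        simp only [g, h1.1, h2.1, e1, e2, (Finset.mem_sdiff.1 hp').2, (Finset.mem_sdiff.1 hp).2,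
          if_false]

/-- If `of_core` does not apply, some `v` has core degree three and only core neighbours of core
degree two. Deleting `v` turns these neighbours into leaves, which leave the core. With two
nonadjacent ones among them the core loses `3 + 1 + 1` edges, enough to pay for the step. -/
lemma of_sparse {U : Finset V} (hU : G.SparseIn U) :
    G.EdgeElim ((G.volIn (G.coreIn U) + 2) / 10 + 3) U := by
  induction hn : U.card generalizing U with
  | zero => rw [Finset.card_eq_zero.1 hn]; exact .empty _
  | succ n ih =>
    by_cases hcore : ∀ v ∈ G.coreIn U, G.degIn (G.coreIn U) v = 3 →
        ∃ w ∈ G.coreIn U, G.Adj v w ∧ G.degIn (G.coreIn U) w ≠ 2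
    · exact of_core hU hcore
    push Not at hcore
    obtain ⟨v, hvA, hv3, hw⟩ := hcore
    set A := G.coreIn U with hA
    have hAU : A ⊆ U := Finset.filter_subset _ _
    have hvU := hAU hvA
    have hvU3 : G.degIn U v ≤ 3 := hU.le_three v hvU
    have hnbr : ∀ x ∈ U, G.Adj v x → x ∈ A := fun x hx hvx =>
      adj_of_degIn_eq hAU (by omega) hx hvx
    have hnbr2 : ∀ x ∈ A, G.Adj v x → G.degIn (U.erase v) x = 1 := by
      intro x hx hvx
      have h1 := degIn_erase_of_adj hvU hvx.symm
      have h2 := hU.le_two v hvU x (hAU hx) hvx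
        (le_antisymm hvU3 (hv3 ▸ degIn_mono hAU v))
      have h3 := degIn_mono (G := G) hAU x
      have h4 := hw x hx hvx
      omega
    obtain ⟨a, b, c, ha, hb, hc, hva, hvb, hvc, hab, hac, hbc, -⟩ := exists_of_degIn_eq_three hv3
    -- After the deletion of `v` the degree of `a` is one, so `a` is not adjacent to both `b` and
    -- `c`. Nonadjacency makes the remaining edges at `a` and `d` distinct.
    obtain ⟨d, hd, hvd, had, hnad⟩ : ∃ d ∈ A, G.Adj v d ∧ a ≠ d ∧ ¬ G.Adj a d := by
      by_contra hcon
      push Not at hcon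
      have hb' := hcon b hb hvb hab
      have hc' := hcon c hc hvc hac
      have h1 := hnbr2 a ha hva
      exact hbc (degIn_le_one_iff.1 h1.le b (Finset.mem_erase.2 ⟨hvb.ne', hAU hb⟩) c
        (Finset.mem_erase.2 ⟨hvc.ne', hAU hc⟩) hb' hc')
    have hsub : G.coreIn (U.erase v) ⊆ ((A.erase v).erase a).erase d := by
      intro x hx
      obtain ⟨hx1, hx2⟩ := Finset.mem_filter.1 hx
      obtain ⟨hxv, hxU⟩ := Finset.mem_erase.1 hx1
      have hxnv : ¬ G.Adj v x := fun hvx => hx2 (hnbr2 x (hnbr x hxU hvx) hvx)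
      rw [degIn_erase_of_not_adj fun h => hxnv h.symm] at hx2
      simp only [Finset.mem_erase]
      exact ⟨fun e => hxnv (e ▸ hvd), fun e => hxnv (e ▸ hva), hxv,
        Finset.mem_filter.2 ⟨hxU, hx2⟩⟩
    have hmono := volIn_mono (G := G) hsub
    have e1 := volIn_erase_add (G := G) hvA
    have e2 := volIn_erase_add (G := G) (U := A.erase v) (u := a) (by simp [hva.ne', ha])
    have e3 := volIn_erase_add (G := G) (U := (A.erase v).erase a) (u := d)
      (by simp [hvd.ne', hd, had.symm])
    have d1 := degIn_erase_of_adj hvA hva.symm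
    have d2 := degIn_erase_of_adj hvA hvd.symm
    rw [degIn_erase_of_not_adj fun h => hnad h.symm] at e3
    have := hw a ha hva
    have := hw d hd hvd
    refine (EdgeElim.vertex hvU (ih (hU.mono (Finset.erase_subset _ _)) ?_)).mono ?_
    · rw [Finset.card_erase_of_mem hvU, hn]; rfl
    · omega

/-- Every graph with `ℓ` edges has an elimination plan of depth at most `⌊ℓ / 5⌋ + 3`. -/
theorem exists_plan (U : Finset V) : G.EdgeElim (G.volIn U / 10 + 3) U := by
  induction hn : U.card using Nat.strong_induction_on generalizing U with
  | _ n ih =>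
  refine of_components U fun S hSU hne hc _ => ?_
  refine EdgeElim.mono (k := G.volIn S / 10 + 3) ?_ (by have := volIn_mono (G := G) hSU; omega)
  have IH : ∀ T, T ⊆ S → T ≠ S → G.EdgeElim (G.volIn T / 10 + 3) T := fun T hT hTS =>
    ih _ (hn ▸ (Finset.card_lt_card (hT.ssubset_of_ne hTS)).trans_le (Finset.card_le_card hSU)) T rfl
  have herase : ∀ u ∈ S, S.erase u ≠ S := fun u hu h => by
    have := h ▸ hu; simp at this
  by_cases h5 : ∃ u ∈ S, 5 ≤ G.degIn S u
  · obtain ⟨u, hu, h5⟩ := h5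
    have := volIn_erase_add (G := G) hu
    exact (EdgeElim.vertex hu (IH _ (Finset.erase_subset _ _) (herase u hu))).mono (by omega)
  push Not at h5
  -- Eliminating both ends kills at least `6 - 1` edges, as the edge itself is counted twice.
  by_cases h6 : ∃ u ∈ S, ∃ v ∈ S, G.Adj u v ∧ 6 ≤ G.degIn S u + G.degIn S v
  · obtain ⟨u, hu, v, hv, huv, h6⟩ := h6
    have := volIn_erase_erase_add hu hv huv
    refine (EdgeElim.edge hu hv huv (IH _ ?_ ?_)).mono (by omega)
    · exact (Finset.erase_subset _ _).trans (Finset.erase_subset _ _)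
    · intro h; have := h ▸ hu; simp at this
  push Not at h6
  -- The degree sum along an edge is now at most five, so the neighbours of `u` are leaves and `S`
  -- is a star.
  by_cases h4 : ∃ u ∈ S, G.degIn S u = 4
  · obtain ⟨u, hu, h4⟩ := h4
    have hnb : ∀ w ∈ S, G.Adj u w → G.degIn S w ≤ 1 := fun w hw huw => by
      have := h6 u hu w hw huw; omega
    have hS : insert u (S.filter (G.Adj u)) = S := by
      refine hc _ (Finset.insert_subset hu (Finset.filter_subset _ _)) (by simp) ?_
      intro a ha b hb hab
      simp only [Finset.mem_insert, Finset.mem_filter] at ha ⊢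
      rcases ha with rfl | ha
      · exact .inr ⟨hb, hab⟩
      · exact .inl (degIn_le_one_iff.1 (hnb a ha.1 ha.2) b hb u hu hab ha.2.symm)
    refine (EdgeElim.vertex hu (of_degIn_le_one fun w hw => ?_)).mono (by omega)
    obtain ⟨hwu, hwS⟩ := Finset.mem_erase.1 hw
    refine (degIn_mono (Finset.erase_subset _ _) w).trans (hnb w hwS ?_)
    rw [← hS] at hwS
    simpa [hwu] using (Finset.mem_insert.1 hwS).resolve_left hwu |> fun h => (Finset.mem_filter.1 h).2
  push Not at h4
  have hK : G.SparseIn S := by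
    refine ⟨fun v hv => ?_, fun v hv w hw hvw h3 => ?_⟩
    · have := h5 v hv; have := h4 v hv; omega
    · have := h6 v hv w hw hvw; omega
  -- The edge at a leaf is not in the core, which compensates for the `+ 2` in `of_sparse`.
  by_cases h1 : ∃ p ∈ S, G.degIn S p = 1
  · obtain ⟨p, hp, h1⟩ := h1
    have e := volIn_erase_add (G := G) hp
    have := volIn_mono (G := G) (S := G.coreIn S) (U := S.erase p) (fun x hx => by
      have := Finset.mem_filter.1 hx
      exact Finset.mem_erase.2 ⟨fun e => this.2 (e ▸ h1), this.1⟩)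
    exact (of_sparse hK).mono (by omega)
  push Not at h1
  by_cases h3 : ∃ u ∈ S, G.degIn S u = 3
  swap
  · push Not at h3
    refine (of_degIn_le_two fun v hv => ?_).mono (by omega : (G.volIn S + 2) / 10 + 2 ≤ _)
    have := hK.le_three v hv; have := h3 v hv; omega
  obtain ⟨u, hu, h3⟩ := h3
  have hnb : ∀ w ∈ S, G.Adj u w → G.degIn S w = 2 := fun w hw huw => by
    have := hK.le_two u hu w hw huw h3
    have := h1 w hw
    have : 0 < G.degIn S w := degIn_pos_iff.2 ⟨u, hu, huw.symm⟩
    omega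
  have hnb1 : ∀ w ∈ S, G.Adj u w → G.degIn (S.erase u) w = 1 := fun w hw huw => by
    have := degIn_erase_of_adj hu huw.symm; have := hnb w hw huw; omega
  -- Eliminating `u` and `c` kills only `3 + 2 - 1 = 4` edges. But the edge `ab` becomes a component
  -- of its own, is treated separately, and is the fifth edge that no longer counts.
  have triangle : ∀ a ∈ S, ∀ b ∈ S, ∀ c ∈ S, G.Adj u a → G.Adj u b → G.Adj u c → a ≠ b → a ≠ c →
      b ≠ c → G.Adj a b → G.EdgeElim (G.volIn S / 10 + 3) S := by
    intro a ha b hb c hc' hua hub huc hab hac hbc hadj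
    set T := (S.erase u).erase c with hT
    have haT : a ∈ T := by simp [hT, ha, hua.ne', hac]
    have hbT : b ∈ T := by simp [hT, hb, hub.ne', hbc]
    have hau : a ∈ S.erase u := Finset.mem_of_mem_erase haT
    have hbu : b ∈ S.erase u := Finset.mem_of_mem_erase hbT
    have hcu : c ∈ S.erase u := by simp [hc', huc.ne']
    have nac : ¬ G.Adj a c := fun h =>
      hbc (degIn_le_one_iff.1 (hnb1 a ha hua).le b hbu c hcu hadj h)
    have nbc : ¬ G.Adj b c := fun h =>
      hac (degIn_le_one_iff.1 (hnb1 b hb hub).le a hau c hcu hadj.symm h)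
    have hda : G.degIn T a = 1 := by
      rw [hT, degIn_erase_of_not_adj nac, hnb1 a ha hua]
    have hdb : G.degIn T b = 1 := by
      rw [hT, degIn_erase_of_not_adj nbc, hnb1 b hb hub]
    have e1 := volIn_erase_erase_add hu hc' huc
    rw [← hT] at e1
    have e2 := volIn_erase_erase_add haT hbT hadj
    have := hnb c hc' huc
    have hsplit : ({a, b} : Finset V) ∪ (T.erase a).erase b = T := by
      ext x
      simp only [Finset.mem_union, Finset.mem_insert, Finset.mem_singleton, Finset.mem_erase]
      constructor
      · rintro ((rfl | rfl) | h)
        · exact haT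
        · exact hbT
        · exact h.2.2
      · intro h; by_cases x = a <;> by_cases x = b <;> tauto
    have hTS : T ⊆ S := (Finset.erase_subset _ _).trans (Finset.erase_subset _ _)
    have hR : G.EdgeElim (G.volIn ((T.erase a).erase b) / 10 + 3) ((T.erase a).erase b) := by
      refine IH _ (((Finset.erase_subset _ _).trans (Finset.erase_subset _ _)).trans hTS) ?_
      intro h; have := h ▸ ha; simp at this
    refine (EdgeElim.edge hu hc' huc (k := G.volIn ((T.erase a).erase b) / 10 + 3) ?_).mono
      (by omega)
    rw [← hT]
    refine hsplit.rec (motive := fun X _ => G.EdgeElim _ X) ?_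
    refine .union ?_ ?_ ((of_degIn_le_one (U := {a, b}) ?_).mono (by omega)) hR
    · rw [Finset.disjoint_left]; intro x; simp; tauto
    · intro x hx y hy hxy
      simp only [Finset.mem_insert, Finset.mem_singleton, Finset.mem_erase] at hx hy
      rcases hx with rfl | rfl
      · exact hy.1 (degIn_le_one_iff.1 hda.le y hy.2.2 b hbT hxy hadj)
      · exact hy.2.1 (degIn_le_one_iff.1 hdb.le y hy.2.2 a haT hxy hadj.symm)
    · have hsub : ({a, b} : Finset V) ⊆ T := by simp [Finset.insert_subset_iff, haT, hbT]
      intro v hv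
      simp only [Finset.mem_insert, Finset.mem_singleton] at hv
      rcases hv with rfl | rfl
      · exact hda ▸ degIn_mono hsub _
      · exact hdb ▸ degIn_mono hsub _
  obtain ⟨a, b, c, ha, hb, hc', hua, hub, huc, hab, hac, hbc, -⟩ := exists_of_degIn_eq_three h3
  by_cases nab : G.Adj a b
  · exact triangle a ha b hb c hc' hua hub huc hab hac hbc nab
  by_cases nac : G.Adj a c
  · exact triangle a ha c hc' b hb hua huc hub hac hab hbc.symm nac
  by_cases nbc : G.Adj b c
  · exact triangle b hb c hc' a ha hub huc hua hbc hab.symm hac.symm nbc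
  -- Deleting `u` kills three edges and makes leaves of `a`, `b`, `c`, so the core loses three more
  -- edges, distinct since `a`, `b`, `c` are pairwise nonadjacent. Five of the six pay for the step
  -- and one for the `+ 2` in `of_sparse`.
  have hsub : G.coreIn (S.erase u) ⊆ (((S.erase u).erase a).erase b).erase c := by
    intro x hx
    obtain ⟨hx1, hx2⟩ := Finset.mem_filter.1 hx
    have hxu : ¬ G.Adj u x := fun h => hx2 (hnb1 x (Finset.mem_of_mem_erase hx1) h)
    simp only [Finset.mem_erase] at hx1 ⊢
    exact ⟨fun e => hxu (e ▸ huc), fun e => hxu (e ▸ hub), fun e => hxu (e ▸ hua), hx1⟩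
  have hmono := volIn_mono (G := G) hsub
  have e0 := volIn_erase_add (G := G) hu
  have e1 := volIn_erase_add (G := G) (U := S.erase u) (u := a) (by simp [hua.ne', ha])
  have e2 := volIn_erase_add (G := G) (U := (S.erase u).erase a) (u := b)
    (by simp [hub.ne', hb, hab.symm])
  have e3 := volIn_erase_add (G := G) (U := ((S.erase u).erase a).erase b) (u := c)
    (by simp [huc.ne', hc', hac.symm, hbc.symm])
  rw [hnb1 a ha hua] at e1
  rw [degIn_erase_of_not_adj fun h => nab h.symm, hnb1 b hb hub] at e2
  rw [degIn_erase_of_not_adj fun h => nbc h.symm, degIn_erase_of_not_adj fun h => nac h.symm,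
    hnb1 c hc' huc] at e3
  exact (EdgeElim.vertex hu (of_sparse (hK.mono (Finset.erase_subset _ _)))).mono (by omega)

end EdgeElim

end SimpleGraph

/-! ### DAG elimination forests, root maps and halving along a line. -/

namespace Digraph

variable {V : Type*} {D : Digraph V}

variable (D) in
/-- The sub-digraph induced by `U` is nonempty and connected. -/
def ConnectedOn (U : Set V) : Prop :=
  U.Nonempty ∧ ∀ S ⊆ U, S.Nonempty →
    (∀ a ∈ S, ∀ b ∈ U, D.Adj a b ∨ D.Adj b a → b ∈ S) → S = U

lemma underlyingOn_adj {U : Set V} {a b : U} :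
    (D.underlyingOn U).Adj a b ↔ (a : V) ≠ b ∧ (D.Adj a b ∨ D.Adj b a) := by
  simp [underlyingOn, toSimpleGraphInclusive, SimpleGraph.fromRel_adj]

lemma mem_of_reachable {U S : Set V} {a b : U} (h : (D.underlyingOn U).Reachable a b)
    (hS : ∀ x ∈ S, ∀ y : U, (D.underlyingOn U).Reachable a y → D.Adj x y ∨ D.Adj y x → (y : V) ∈ S)
    (ha : (a : V) ∈ S) : (b : V) ∈ S := by
  rw [SimpleGraph.reachable_iff_reflTransGen] at h
  induction h with
  | refl => exact ha
  | @tail x y hax hxy ih =>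
    exact hS x ih y ((SimpleGraph.reachable_iff_reflTransGen _ _).2 (hax.tail hxy))
      (underlyingOn_adj.1 hxy).2

lemma connected_underlyingOn_iff {U : Set V} :
    (D.underlyingOn U).Connected ↔ D.ConnectedOn U := by
  constructor
  · intro h
    obtain ⟨⟨u, hu⟩⟩ := h.nonempty
    refine ⟨⟨u, hu⟩, fun S hS ⟨s, hs⟩ hcl => subset_antisymm hS fun v hv => ?_⟩
    exact mem_of_reachable (h.preconnected ⟨s, hS hs⟩ ⟨v, hv⟩)
      (fun x hx y _ hxy => hcl x hx y y.2 hxy) hs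
  · rintro ⟨⟨u, hu⟩, h⟩
    have : Nonempty U := ⟨⟨u, hu⟩⟩
    refine ⟨fun a b => ?_⟩
    have := h (Subtype.val '' {x : U | (D.underlyingOn U).Reachable a x}) (by simp)
      ⟨a, a, .refl _, rfl⟩ ?_
    · have hb : (b : V) ∈ Subtype.val '' {x : U | (D.underlyingOn U).Reachable a x} := this.ge b.2
      obtain ⟨x, hx, hxb⟩ := hb
      exact Subtype.ext hxb ▸ hx
    · rintro _ ⟨x, hx, rfl⟩ y hy hxy
      by_cases hne : (x : V) = y
      · exact ⟨x, hx, hne⟩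
      · exact ⟨⟨y, hy⟩, SimpleGraph.Reachable.trans hx
          (SimpleGraph.Adj.reachable (underlyingOn_adj.2 ⟨hne, hxy⟩)), rfl⟩

lemma connectedOn_supp {U : Set V} (C : (D.underlyingOn U).ConnectedComponent) :
    D.ConnectedOn (Subtype.val '' C.supp) := by
  refine ⟨C.nonempty_supp.image _, ?_⟩
  rintro S hS ⟨s, hs⟩ hcl
  refine subset_antisymm hS ?_
  rintro _ ⟨v, hv, rfl⟩
  obtain ⟨t, ht, rfl⟩ := hS hs
  have hCt : (D.underlyingOn U).connectedComponentMk t = C := ht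
  have hCv : (D.underlyingOn U).connectedComponentMk v = C := hv
  refine mem_of_reachable (SimpleGraph.ConnectedComponent.exact (hCt.trans hCv.symm))
    (fun x hx y hy hxy => hcl x hx y ⟨y, ?_, rfl⟩ hxy) hs
  exact (SimpleGraph.ConnectedComponent.sound hy.symm).trans hCt

lemma supp_closed {U : Set V} (C : (D.underlyingOn U).ConnectedComponent) :
    ∀ a ∈ Subtype.val '' C.supp, ∀ b ∈ U, D.Adj a b ∨ D.Adj b a → b ∈ Subtype.val '' C.supp := by
  rintro _ ⟨a, ha, rfl⟩ b hb hab
  by_cases hne : (a : V) = b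
  · exact ⟨a, ha, hne⟩
  refine ⟨⟨b, hb⟩, ?_, rfl⟩
  have hCa : (D.underlyingOn U).connectedComponentMk a = C := ha
  exact (SimpleGraph.ConnectedComponent.sound (SimpleGraph.Adj.reachable
    (underlyingOn_adj.2 ⟨hne, hab⟩)).symm).trans hCa

variable (D) in
/-- There is a DAG elimination forest of depth at most `k`. -/
def HasForest (k : ℕ) (U : Set V) : Prop := ∃ F : ElimForest D U, F.depth ≤ k

namespace HasForest

lemma mono {k l : ℕ} {U : Set V} (h : D.HasForest k U) (hkl : k ≤ l) : D.HasForest l U := by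
  obtain ⟨F, hF⟩ := h
  exact ⟨F, hF.trans (by exact_mod_cast hkl)⟩

lemma empty (k : ℕ) : D.HasForest k ∅ := ⟨.empty, by simp [ElimForest.depth]⟩

lemma root {k : ℕ} {U : Set V} (hU : D.ConnectedOn U) {s : V} (hs : D.IsSourceIn U s)
    (h : D.HasForest k (U \ D.reachIn U s)) : D.HasForest (k + 1) U := by
  obtain ⟨F, hF⟩ := h
  refine ⟨.root U (connected_underlyingOn_iff.2 hU) s hs F, ?_⟩
  rw [ElimForest.depth]
  push_cast
  gcongr

lemma of_components {k : ℕ} {U : Set V}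
    (h : ∀ S ⊆ U, D.ConnectedOn S →
      (∀ a ∈ S, ∀ b ∈ U, D.Adj a b ∨ D.Adj b a → b ∈ S) → D.HasForest k S) :
    D.HasForest k U := by
  rcases U.eq_empty_or_nonempty with rfl | hne
  · exact empty k
  by_cases hU : (D.underlyingOn U).Connected
  · exact h U subset_rfl (connected_underlyingOn_iff.1 hU) fun _ _ b hb _ => hb
  · choose F hF using fun C : (D.underlyingOn U).ConnectedComponent =>
      h (Subtype.val '' C.supp) (by simp) (connectedOn_supp C) (supp_closed C)
    refine ⟨.union U hne hU F, ?_⟩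
    rw [ElimForest.depth]
    exact iSup_le hF

end HasForest

lemma ConnectedOn.forall_or_forall {U : Set V} (hU : D.ConnectedOn U) (p : V → Prop)
    (hp : ∀ a ∈ U, ∀ b ∈ U, D.Adj a b ∨ D.Adj b a → p a → p b) :
    (∀ v ∈ U, p v) ∨ (∀ v ∈ U, ¬ p v) := by
  by_cases h : ∃ v ∈ U, p v
  · obtain ⟨v, hv, hpv⟩ := h
    left
    have := hU.2 {v ∈ U | p v} (Set.sep_subset _ _) ⟨v, hv, hpv⟩ fun a ha b hb hab =>
      ⟨hb, hp a ha.1 b hb hab ha.2⟩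
    exact fun w hw => (this.ge hw).2
  · push Not at h
    exact .inr h

lemma self_mem_reachIn (U : Set V) (s : V) : s ∈ D.reachIn U s := .refl

lemma mem_reachIn_of_adj {U : Set V} {s a b : V} (ha : a ∈ U) (hb : b ∈ U)
    (h : a ∈ D.reachIn U s) (hab : D.Adj a b) : b ∈ D.reachIn U s := h.tail ⟨ha, hb, hab⟩

variable (D) in
/-- `ρ` maps every vertex of `U` to a source of `U` from which it can be reached. -/
def IsRootMap (U : Set V) (ρ : V → V) : Prop :=
  ∀ v ∈ U, D.IsSourceIn U (ρ v) ∧ v ∈ D.reachIn U (ρ v)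

/-- A directed path that ends in a predecessor-closed set lies in it. Deleting reachable sets and
passing to components leaves only such sets, so a single root map serves the whole elimination. -/
lemma IsRootMap.of_predClosed {S U : Set V} {ρ : V → V} (h : D.IsRootMap U ρ) (hS : S ⊆ U)
    (hcl : ∀ v ∈ S, ∀ a ∈ U, D.Adj a v → a ∈ S) : D.IsRootMap S ρ := by
  intro v hv
  obtain ⟨hs, hr⟩ := h v (hS hv)
  have key : ρ v ∈ S ∧ v ∈ D.reachIn S (ρ v) := by
    change Relation.ReflTransGen _ _ _ at hr
    clear hs
    generalize ρ v = s at hr ⊢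
    induction hr using Relation.ReflTransGen.head_induction_on with
    | refl => exact ⟨hv, .refl⟩
    | head hac _ ih =>
      have := hcl _ ih.1 _ hac.1 hac.2.2
      exact ⟨this, ih.2.head ⟨this, ih.1, hac.2.2⟩⟩
  exact ⟨⟨key.1, fun a ha => hs.2 a (hS ha)⟩, key.2⟩

/-- If the classes of a root map can be arranged along a line of fewer than `2 ^ k` positions so
that edges only join equal or consecutive positions, then depth `k` suffices. -/
lemma HasForest.of_labelling {k : ℕ} {U : Set V} {ρ : V → V} (hρ : D.IsRootMap U ρ) {f : V → ℕ}
    (hinj : ∀ v ∈ U, ∀ w ∈ U, f v = f w → ρ v = ρ w)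
    (hadj : ∀ v ∈ U, ∀ w ∈ U, D.Adj v w ∨ D.Adj w v → f v ≤ f w + 1) {a : ℕ}
    (hlo : ∀ v ∈ U, a ≤ f v) (hhi : ∀ v ∈ U, f v + 1 < a + 2 ^ k) : D.HasForest k U := by
  induction k generalizing U a with
  | zero =>
    have : U = ∅ := Set.eq_empty_of_forall_notMem fun v hv => by
      have := hlo v hv; have := hhi v hv; omega
    rw [this]
    exact .empty 0
  | succ k ih =>
    have hpow : 2 ^ (k + 1) = 2 * 2 ^ k := by ring
    have hpos := Nat.one_le_two_pow (n := k)
    -- Depth `k` handles `q = 2 ^ k - 1` positions, and `2 ^ (k + 1) - 1 = 2 * q + 1`, so the middle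
    -- position is `a + q`.
    obtain ⟨q, hq⟩ : ∃ q, 2 ^ k = q + 1 := ⟨2 ^ k - 1, by omega⟩
    have side : ∀ T ⊆ U, (∀ v ∈ T, ∀ b ∈ U, D.Adj b v → b ∈ T) → D.ConnectedOn T →
        (∀ v ∈ T, f v ≠ a + q) → D.HasForest k T := by
      intro T hT hcl hc hne
      have hρT := hρ.of_predClosed hT hcl
      have hinjT : ∀ v ∈ T, ∀ w ∈ T, f v = f w → ρ v = ρ w :=
        fun v hv w hw => hinj v (hT hv) w (hT hw)
      have hadjT : ∀ v ∈ T, ∀ w ∈ T, D.Adj v w ∨ D.Adj w v → f v ≤ f w + 1 :=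
        fun v hv w hw => hadj v (hT hv) w (hT hw)
      rcases hc.forall_or_forall (fun v => f v < a + q) (fun x hx y hy hxy hlt => by
        have := hadjT y hy x hx hxy.symm; have := hne x hx; have := hne y hy; omega) with h | h
      · refine ih hρT hinjT hadjT (fun v hv => hlo v (hT hv)) fun v hv => ?_
        have := h v hv; omega
      · refine ih (a := a + q + 1) hρT hinjT hadjT (fun v hv => ?_) fun v hv => ?_
        · have := h v hv; have := hne v hv; omega
        · have := hhi v (hT hv); omega
    refine of_components fun S hS hc hcl => ?_
    have hclS : ∀ v ∈ S, ∀ b ∈ U, D.Adj b v → b ∈ S := fun v hv b hb h => hcl v hv b hb (.inr h)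
    by_cases hex : ∃ v ∈ S, f v = a + q
    · obtain ⟨v, hv, hfv⟩ := hex
      have hρS := hρ.of_predClosed hS hclS
      refine root hc (hρS v hv).1 (of_components fun T hT hTc hTcl => ?_)
      refine side T (fun x hx => hS (hT hx).1) ?_ hTc ?_
      · intro x hx b hb hbx
        have hxS := hT hx
        have hbS := hclS x hxS.1 b hb hbx
        exact hTcl x hx b ⟨hbS, fun h => hxS.2 (mem_reachIn_of_adj hbS hxS.1 h hbx)⟩ (.inr hbx)
      -- All vertices at the middle position have the same source and disappear with it.
      · intro x hx hfx
        have hxS := hT hx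
        refine hxS.2 ?_
        rw [hinj v (hS hv) x (hS hxS.1) (hfv.trans hfx.symm)]
        exact (hρS x hxS.1).2
    · push Not at hex
      exact (side S hS hclS hc hex).mono (Nat.le_succ k)

lemma HasForest.of_edgeless {U : Set V} (hU : ∀ a ∈ U, ∀ b ∈ U, ¬ D.Adj a b) :
    D.HasForest 1 U := by
  refine of_components fun S hS hc _ => ?_
  obtain ⟨v, hv⟩ := hc.1
  have hS1 : {v} = S := hc.2 {v} (by simpa using hv) (by simp) fun a ha b hb hab => by
    rw [Set.mem_singleton_iff.1 ha] at hab
    exact absurd hab (not_or.2 ⟨hU v (hS hv) b (hS hb), hU b (hS hb) v (hS hv)⟩)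
  refine root hc (s := v) ⟨hv, fun w hw => hU w (hS hw) v (hS hv)⟩ ?_
  have : S \ D.reachIn S v = ∅ := by
    rw [← hS1, Set.sdiff_eq_empty]
    simpa using self_mem_reachIn _ _
  rw [this]
  exact .empty 0

/-- Each vertex chooses an in-neighbour in `U`, and following the choices backwards ends at a
source. The last clause records that the chosen edge stays inside the class; this supplies the extra
edges counted in `of_three_neighbors`. -/
lemma IsAcyclic.exists_rootMap [Finite V] (hD : D.IsAcyclic) (U : Set V) :
    ∃ ρ : V → V, D.IsRootMap U ρ ∧ (∀ s, D.IsSourceIn U s → ρ s = s) ∧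
      ∀ v ∈ U, ¬ D.IsSourceIn U v → ∃ p ∈ U, D.Adj p v ∧ ρ p = ρ v := by
  classical
  have : Std.Irrefl (Relation.TransGen D.Adj) := ⟨hD⟩
  have wf : WellFounded (Relation.TransGen D.Adj) :=
    Finite.wellFounded_of_trans_of_irrefl _
  let ρ : V → V := wf.fix fun v rec =>
    if h : ∃ p ∈ U, D.Adj p v then rec h.choose (.single h.choose_spec.2) else v
  have hρ : ∀ v, ρ v = if h : ∃ p ∈ U, D.Adj p v then ρ h.choose else v := fun v => wf.fix_eq _ v
  have h1 : ∀ s, D.IsSourceIn U s → ρ s = s := fun s hs => by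
    rw [hρ, dif_neg]
    rintro ⟨p, hp, hps⟩
    exact hs.2 p hp hps
  have h2 : ∀ v ∈ U, ¬ D.IsSourceIn U v → ∃ p ∈ U, D.Adj p v ∧ ρ p = ρ v := fun v hv hs => by
    have h : ∃ p ∈ U, D.Adj p v := by
      by_contra hcon
      exact hs ⟨hv, fun p hp hpv => hcon ⟨p, hp, hpv⟩⟩
    refine ⟨h.choose, h.choose_spec.1, h.choose_spec.2, ?_⟩
    rw [hρ v, dif_pos h]
  refine ⟨ρ, fun v => ?_, h1, h2⟩
  induction v using wf.induction with
  | _ v ih =>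
    intro hv
    by_cases hs : D.IsSourceIn U v
    · rw [h1 v hs]
      exact ⟨hs, .refl⟩
    · obtain ⟨p, hp, hpv, he⟩ := h2 v hv hs
      have := ih p (.single hpv) hp
      rw [he] at this
      exact ⟨this.1, mem_reachIn_of_adj hp hv this.2 hpv⟩

end Digraph

/-! ### The root graph and the bound on DAG treedepth. -/

namespace Digraph

variable {V : Type*} {D : Digraph V}

variable (D) in
/-- The edges of the sub-digraph induced by `U`. -/
def edgesOn (U : Set V) : Set (V × V) := {p | p.1 ∈ U ∧ p.2 ∈ U ∧ D.Adj p.1 p.2}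

variable (D) in
/-- The edges of the sub-digraph induced by `U` that are deleted with `s`. -/
def edgesBelow (U : Set V) (s : V) : Set (V × V) := {p ∈ D.edgesOn U | p.2 ∈ D.reachIn U s}

section

variable [Finite V]

lemma ncard_edgesOn_mono {S U : Set V} (h : S ⊆ U) : (D.edgesOn S).ncard ≤ (D.edgesOn U).ncard :=
  Set.ncard_le_ncard fun _ hp => ⟨h hp.1, h hp.2.1, hp.2.2⟩

lemma ncard_edgesOn_diff (U : Set V) (s : V) :
    (D.edgesOn (U \ D.reachIn U s)).ncard + (D.edgesBelow U s).ncard ≤ (D.edgesOn U).ncard := by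
  rw [← Set.ncard_union_eq]
  · refine Set.ncard_le_ncard ?_
    rintro p (hp | hp)
    · exact ⟨hp.1.1, hp.2.1.1, hp.2.2⟩
    · exact hp.1
  · rw [Set.disjoint_left]
    exact fun p hp hp' => hp.2.1.2 hp'.2

lemma card_le_ncard_of_subset {α : Type*} [Finite α] {F : Finset α} {E : Set α}
    (h : ∀ x ∈ F, x ∈ E) : F.card ≤ E.ncard := by
  rw [← Set.ncard_coe_finset]
  exact Set.ncard_le_ncard h

lemma eq_of_subset_of_le {α : Type*} [Finite α] {F : Finset α} {E : Set α}
    (h : ∀ x ∈ F, x ∈ E) (hc : E.ncard ≤ F.card) : ∀ x ∈ E, x ∈ F := by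
  rw [← Set.ncard_coe_finset] at hc
  have := Set.eq_of_subset_of_ncard_le (s := (F : Set α)) h hc
  exact fun x hx => (this ▸ hx : x ∈ (F : Set α))

end

variable (D) in
/-- The graph on the sources of `U` in which two sources are adjacent if an edge joins their classes
under the root map `ρ`. -/
def rootGraph (U : Set V) (ρ : V → V) : SimpleGraph V where
  Adj s t := s ≠ t ∧ ∃ a ∈ U, ∃ b ∈ U, (D.Adj a b ∨ D.Adj b a) ∧ ρ a = s ∧ ρ b = t
  symm := ⟨fun _ _ ⟨h, a, ha, b, hb, hab, h1, h2⟩ => ⟨h.symm, b, hb, a, ha, hab.symm, h2, h1⟩⟩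
  loopless := ⟨fun _ h => h.1 rfl⟩

/-- If every source lies above at most four edges but the class of some source touches three other
classes, then all edges have the same head. -/
lemma HasForest.of_three_neighbors [Finite V] {U : Set V} (hU : D.ConnectedOn U) {ρ : V → V}
    (hρ : D.IsRootMap U ρ)
    (hpar : ∀ v ∈ U, ¬ D.IsSourceIn U v → ∃ p ∈ U, D.Adj p v ∧ ρ p = ρ v)
    (h4 : ∀ s, D.IsSourceIn U s → (D.edgesBelow U s).ncard ≤ 4) {s : V} (hs : D.IsSourceIn U s)
    {t : Fin 3 → V} (htinj : Function.Injective t) (ht : ∀ i, (D.rootGraph U ρ).Adj s (t i)) :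
    D.HasForest 2 U := by
  classical
  have hedge : ∀ i, ∃ x ∈ U, ∃ b ∈ U, D.Adj x b ∧ (ρ x = s ∧ ρ b = t i ∨ ρ x = t i ∧ ρ b = s) := by
    intro i
    obtain ⟨-, a, ha, b, hb, hab, rfl, h2⟩ := ht i
    rcases hab with h | h
    · exact ⟨a, ha, b, hb, h, .inl ⟨rfl, h2⟩⟩
    · exact ⟨b, hb, a, ha, h, .inr ⟨h2, rfl⟩⟩
  choose x hxU b hbU hxb hρxb using hedge
  have hst : ∀ i, s ≠ t i := fun i => (ht i).1
  have hns : ∀ i, ¬ D.IsSourceIn U (b i) := fun i h => h.2 _ (hxU i) (hxb i)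
  -- The chosen edge into `b i` stays inside a class, so it differs from all the crossing edges `(x
  -- j, b j)`.
  choose p hpU hpb hρp using fun i => hpar (b i) (hbU i) (hns i)
  have hbs : ∀ i, b i ∈ D.reachIn U s := by
    intro i
    rcases hρxb i with h | h
    · exact mem_reachIn_of_adj (hxU i) (hbU i) (h.1 ▸ (hρ _ (hxU i)).2) (hxb i)
    · exact h.2 ▸ (hρ _ (hbU i)).2
  have hne : ∀ i, ρ (x i) ≠ ρ (b i) := by
    intro i h
    rcases hρxb i with h' | h'
    · exact hst i (h'.1.symm.trans (h.trans h'.2))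
    · exact hst i (h'.2.symm.trans (h.symm.trans h'.1))
  have hf : ∀ i j, i ≠ j → (x i, b i) ≠ (x j, b j) := by
    intro i j hij h
    obtain ⟨h1, h2⟩ := Prod.mk.inj h
    have htij : t i ≠ t j := fun e => hij (htinj e)
    rcases hρxb i with hi | hi <;> rcases hρxb j with hj | hj
    · exact htij (hi.2.symm.trans ((congrArg ρ h2).trans hj.2))
    · exact hst j (hi.1.symm.trans ((congrArg ρ h1).trans hj.1))
    · exact hst i (hj.1.symm.trans ((congrArg ρ h1.symm).trans hi.1))
    · exact htij (hi.1.symm.trans ((congrArg ρ h1).trans hj.1))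
  have hfp : ∀ i j, (x i, b i) ≠ (p j, b j) := by
    intro i j h
    obtain ⟨h1, h2⟩ := Prod.mk.inj h
    exact hne i (by rw [h1, h2]; exact hρp j)
  have hmemx : ∀ i, ∀ r, b i ∈ D.reachIn U r → (x i, b i) ∈ D.edgesBelow U r :=
    fun i r hr => ⟨⟨hxU i, hbU i, hxb i⟩, hr⟩
  have hmemp : ∀ i, ∀ r, b i ∈ D.reachIn U r → (p i, b i) ∈ D.edgesBelow U r :=
    fun i r hr => ⟨⟨hpU i, hbU i, hpb i⟩, hr⟩
  -- Every `b i` is reachable from `s`. Two different heads would give three crossing and two inner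
  -- edges below `s`, one too many.
  have hbeq : ∀ i j, b i = b j := by
    intro i j
    by_contra hij
    have hc : ({(x 0, b 0), (x 1, b 1), (x 2, b 2), (p i, b i), (p j, b j)} :
        Finset (V × V)).card = 5 := by
      rw [Finset.card_insert_of_notMem, Finset.card_insert_of_notMem,
        Finset.card_insert_of_notMem, Finset.card_insert_of_notMem, Finset.card_singleton]
      · simp [hij]
      · simp only [Finset.mem_insert, Finset.mem_singleton, not_or]
        exact ⟨hfp _ _, hfp _ _⟩
      · simp only [Finset.mem_insert, Finset.mem_singleton, not_or]
        exact ⟨hf _ _ (by decide), hfp _ _, hfp _ _⟩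
      · simp only [Finset.mem_insert, Finset.mem_singleton, not_or]
        exact ⟨hf _ _ (by decide), hf _ _ (by decide), hfp _ _, hfp _ _⟩
    have := card_le_ncard_of_subset (F := {(x 0, b 0), (x 1, b 1), (x 2, b 2), (p i, b i),
      (p j, b j)}) (E := D.edgesBelow U s) (by
        intro y hy
        simp only [Finset.mem_insert, Finset.mem_singleton] at hy
        rcases hy with rfl | rfl | rfl | rfl | rfl
        exacts [hmemx _ s (hbs _), hmemx _ s (hbs _), hmemx _ s (hbs _), hmemp _ s (hbs _),
          hmemp _ s (hbs _)])
    have := h4 s hs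
    omega
  -- The common head cannot be in the classes of two different `t i`, so it belongs to the class of
  -- `s`.
  have hρb : ∀ i, ρ (b i) = s ∧ ρ (x i) = t i := by
    have h01 : t 0 ≠ t 1 := fun e => by simpa using htinj e
    have hs0 : ρ (b 0) = s := by
      rcases hρxb 0 with h | h
      · rcases hρxb 1 with h' | h'
        · exact absurd (h.2.symm.trans ((congrArg ρ (hbeq 0 1)).trans h'.2)) h01
        · exact (congrArg ρ (hbeq 0 1)).trans h'.2
      · exact h.2
    intro i
    rcases hρxb i with h | h
    · exact absurd (hs0.symm.trans ((congrArg ρ (hbeq 0 i)).trans h.2)) (hst i)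
    · exact ⟨h.2, h.1⟩
  set F : Finset (V × V) := {(x 0, b 0), (x 1, b 1), (x 2, b 2), (p 0, b 0)} with hF
  have hFc : F.card = 4 := by
    rw [hF, Finset.card_insert_of_notMem, Finset.card_insert_of_notMem,
      Finset.card_insert_of_notMem, Finset.card_singleton]
    · simp only [Finset.mem_singleton]
      exact hfp _ _
    · simp only [Finset.mem_insert, Finset.mem_singleton, not_or]
      exact ⟨hf _ _ (by decide), hfp _ _⟩
    · simp only [Finset.mem_insert, Finset.mem_singleton, not_or]
      exact ⟨hf _ _ (by decide), hf _ _ (by decide), hfp _ _⟩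
  -- A source that reaches the common head has the four edges of `F` below it, hence no others. This
  -- applies to `s` and to every `t i`.
  have hall : ∀ r, D.IsSourceIn U r → b 0 ∈ D.reachIn U r → ∀ e ∈ D.edgesBelow U r, e ∈ F := by
    intro r hr hbr
    refine eq_of_subset_of_le (fun y hy => ?_) (hFc ▸ h4 r hr)
    simp only [hF, Finset.mem_insert, Finset.mem_singleton] at hy
    rcases hy with rfl | rfl | rfl | rfl
    exacts [hmemx _ r hbr, hmemx _ r (hbeq 1 0 ▸ hbr), hmemx _ r (hbeq 2 0 ▸ hbr), hmemp _ r hbr]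
  have hbt : ∀ i, b 0 ∈ D.reachIn U (t i) := fun i =>
    hbeq i 0 ▸ mem_reachIn_of_adj (hxU i) (hbU i) ((hρb i).2 ▸ (hρ _ (hxU i)).2) (hxb i)
  have htsrc : ∀ i, D.IsSourceIn U (t i) := fun i => (hρb i).2 ▸ (hρ _ (hxU i)).1
  let Z : Set V := {v ∈ U | v ∈ D.reachIn U s ∨ ∃ i, v ∈ D.reachIn U (t i)}
  have hZF : ∀ a ∈ U, ∀ v ∈ Z, D.Adj a v → (a, v) ∈ F := by
    intro a ha v hv hav
    rcases hv.2 with h | ⟨i, h⟩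
    · exact hall s hs (hbs 0) _ ⟨⟨ha, hv.1, hav⟩, h⟩
    · exact hall (t i) (htsrc i) (hbt i) _ ⟨⟨ha, hv.1, hav⟩, h⟩
  -- Every edge with head in `Z` is in `F`, so its tail is some `x i` or `p 0` and lies in `Z`
  -- again. By connectivity all edges belong to `F` and share one head.
  have hZ : Z = U := by
    refine hU.2 Z (Set.sep_subset _ _) ⟨s, hs.1, .inl (self_mem_reachIn _ _)⟩ ?_
    intro a ha v hv hav
    rcases hav with hav | hav
    · refine ⟨hv, ?_⟩
      rcases ha.2 with h | ⟨i, h⟩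
      · exact .inl (mem_reachIn_of_adj ha.1 hv h hav)
      · exact .inr ⟨i, mem_reachIn_of_adj ha.1 hv h hav⟩
    · have := hZF v hv a ha hav
      have hxt : ∀ i, x i ∈ Z := fun i => ⟨hxU i, .inr ⟨i, (hρb i).2 ▸ (hρ _ (hxU i)).2⟩⟩
      simp only [hF, Finset.mem_insert, Finset.mem_singleton, Prod.mk.injEq] at this
      rcases this with ⟨rfl, -⟩ | ⟨rfl, -⟩ | ⟨rfl, -⟩ | ⟨rfl, -⟩
      · exact hxt 0
      · exact hxt 1
      · exact hxt 2
      · exact ⟨hv, .inl ((hρb 0).1 ▸ hρp 0 ▸ (hρ _ hv).2)⟩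
  refine HasForest.root hU hs (HasForest.of_edgeless fun a ha v hv hav => ?_)
  have := hZF a ha.1 v (hZ ▸ hv.1) hav
  have hvb : v = b 0 := by
    simp only [hF, Finset.mem_insert, Finset.mem_singleton, Prod.mk.injEq] at this
    rcases this with ⟨-, h⟩ | ⟨-, h⟩ | ⟨-, h⟩ | ⟨-, h⟩
    exacts [h, h.trans (hbeq 1 0), h.trans (hbeq 2 0), h]
  exact hv.2 (hvb ▸ hbs 0)

/-- In a connected digraph in which every source lies above at most four edges, there are more edges
than sources, unless there are at most four sources. -/
lemma card_sources_lt [Finite V] {U : Set V} (hU : D.ConnectedOn U)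
    (h4 : ∀ s, D.IsSourceIn U s → (D.edgesBelow U s).ncard ≤ 4) {S : Finset V}
    (hS : ∀ s, s ∈ S ↔ D.IsSourceIn U s) (h5 : 5 ≤ S.card) :
    S.card + 1 ≤ (D.edgesOn U).ncard := by
  classical
  have hout : ∀ s ∈ S, ∃ v ∈ U, D.Adj s v := by
    intro s hs
    have hsrc := (hS s).1 hs
    by_contra hcon
    push Not at hcon
    have hU1 : {s} = U := hU.2 {s} (by simpa using hsrc.1) (by simp) fun a ha b hb hab => by
      rw [Set.mem_singleton_iff.1 ha] at hab
      exact absurd hab (not_or.2 ⟨hcon b hb, hsrc.2 b hb⟩)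
    have : S ⊆ {s} := fun t ht => by
      have := ((hS t).1 ht).1
      rw [← hU1] at this
      simpa using this
    have := Finset.card_le_card this
    simp at this
    omega
  choose! o hoU hadj using hout
  set F : Finset (V × V) := S.image fun s => (s, o s) with hF
  have hFc : F.card = S.card := Finset.card_image_of_injective _ fun a b h => (Prod.mk.inj h).1
  have hFE : ∀ e ∈ F, e ∈ D.edgesOn U := by
    intro e he
    obtain ⟨s, hs, rfl⟩ := Finset.mem_image.1 he
    exact ⟨((hS s).1 hs).1, hoU s hs, hadj s hs⟩
  by_contra hlt
  -- Without further edges, every edge is the chosen out-edge of a source. Connectivity then makes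
  -- `U` a star into one sink, with all its at least five edges below each source.
  have hEF := eq_of_subset_of_le hFE (by omega)
  have hE : ∀ a ∈ U, ∀ v ∈ U, D.Adj a v → a ∈ S ∧ o a = v := by
    intro a ha v hv hav
    obtain ⟨s, hs, he⟩ := Finset.mem_image.1 (hEF (a, v) ⟨ha, hv, hav⟩)
    obtain ⟨rfl, rfl⟩ := Prod.mk.inj he
    exact ⟨hs, rfl⟩
  obtain ⟨s, hs⟩ : S.Nonempty := Finset.card_pos.1 (by omega)
  have hsrc := (hS s).1 hs
  have hbS : o s ∉ S := fun h => ((hS _).1 h).2 s hsrc.1 (hadj s hs)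
  have hZ : {v ∈ U | v = o s ∨ v ∈ S ∧ o v = o s} = U := by
    refine hU.2 _ (Set.sep_subset _ _) ⟨o s, hoU s hs, .inl rfl⟩ ?_
    rintro a ⟨ha, ha'⟩ v hv (hav | hav)
    · obtain ⟨h1, h2⟩ := hE a ha v hv hav
      rcases ha' with rfl | ha'
      · exact absurd h1 hbS
      · exact ⟨hv, .inl (h2 ▸ ha'.2)⟩
    · obtain ⟨h1, h2⟩ := hE v hv a ha hav
      rcases ha' with rfl | ha'
      · exact ⟨hv, .inr ⟨h1, h2⟩⟩
      · exact absurd hav (((hS a).1 ha'.1).2 v hv)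
  have hos : ∀ t ∈ S, o t = o s := by
    intro t ht
    have : t ∈ {v ∈ U | v = o s ∨ v ∈ S ∧ o v = o s} := hZ.ge ((hS t).1 ht).1
    rcases this.2 with h | h
    · exact absurd (h ▸ ht) hbS
    · exact h.2
  have := card_le_ncard_of_subset (F := F) (E := D.edgesBelow U s) fun e he => by
    refine ⟨hFE e he, ?_⟩
    obtain ⟨t, ht, rfl⟩ := Finset.mem_image.1 he
    simp only [hos t ht]
    exact mem_reachIn_of_adj hsrc.1 (hoU s hs) (self_mem_reachIn _ _) (hadj s hs)
  have := h4 s hsrc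
  omega

lemma preconnectedIn_rootGraph {U : Set V} (hU : D.ConnectedOn U) {ρ : V → V}
    (hρ : D.IsRootMap U ρ) (hsrc : ∀ s, D.IsSourceIn U s → ρ s = s) {S : Finset V}
    (hS : ∀ s, s ∈ S ↔ D.IsSourceIn U s) : (D.rootGraph U ρ).PreconnectedIn S := by
  rintro W hW ⟨w, hw⟩ hcl
  have hwU := (hS w).1 (hW hw)
  have : {v ∈ U | ρ v ∈ W} = U := by
    refine hU.2 _ (Set.sep_subset _ _) ⟨w, hwU.1, by rwa [hsrc w hwU]⟩ ?_
    rintro a ⟨ha, haW⟩ v hv hav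
    refine ⟨hv, ?_⟩
    by_cases h : ρ a = ρ v
    · rwa [← h]
    · exact hcl _ haW _ ((hS _).2 (hρ v hv).1) ⟨h, a, ha, v, hv, hav, rfl, rfl⟩
  refine subset_antisymm hW fun s hs => ?_
  have hsU := (hS s).1 hs
  have h : s ∈ {v ∈ U | ρ v ∈ W} := this.ge hsU.1
  rw [← hsrc s hsU]
  exact h.2

/-- The root graph is a path or a cycle. Deleting any one source costs one level and leaves paths
with fewer than `2 ^ k` sources, along which `of_labelling` applies. -/
lemma HasForest.of_degIn_rootGraph_le_two [Finite V] {U : Set V} (hU : D.ConnectedOn U)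
    {ρ : V → V} (hρ : D.IsRootMap U ρ) (hsrc : ∀ s, D.IsSourceIn U s → ρ s = s) {S : Finset V}
    (hS : ∀ s, s ∈ S ↔ D.IsSourceIn U s) [DecidableEq V] [DecidableRel (D.rootGraph U ρ).Adj]
    (h2 : ∀ s ∈ S, (D.rootGraph U ρ).degIn S s ≤ 2) {k : ℕ} (hk : S.card ≤ 2 ^ k) :
    D.HasForest (k + 1) U := by
  have hX := preconnectedIn_rootGraph hU hρ hsrc hS
  obtain ⟨v₀, hv₀⟩ := hU.1
  have hs := (hρ v₀ hv₀).1
  set s := ρ v₀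
  have hsS := (hS s).2 hs
  refine .root hU hs ?_
  set U' := U \ D.reachIn U s with hU'
  have hpc : ∀ v ∈ U', ∀ a ∈ U, D.Adj a v → a ∈ U' := fun v hv a ha hav =>
    ⟨ha, fun h => hv.2 (mem_reachIn_of_adj ha hv.1 h hav)⟩
  suffices h : ∀ C ⊆ U', D.ConnectedOn C → (∀ v ∈ C, ∀ a ∈ U, D.Adj a v → a ∈ C) →
      (∀ v ∈ C, ρ v ∈ S.erase s) → D.HasForest k C by
    refine .of_components fun C hC hCc hCcl => h C hC hCc ?_ ?_
    · exact fun v hv a ha hav => hCcl v hv a (hpc v (hC hv) a ha hav) (.inr hav)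
    · intro v hv
      have hv' := hC hv
      refine Finset.mem_erase.2 ⟨fun e => hv'.2 (e ▸ (hρ v hv'.1).2), (hS _).2 (hρ v hv'.1).1⟩
  -- An edge between classes is an adjacency of the root graph, so the classes met by a connected
  -- set lie in one component of the root graph without `s`.
  refine SimpleGraph.induction_on_components (G := D.rootGraph U ρ)
    (P := fun T => ∀ C ⊆ U', D.ConnectedOn C → (∀ v ∈ C, ∀ a ∈ U, D.Adj a v → a ∈ C) →
      (∀ v ∈ C, ρ v ∈ T) → D.HasForest k C) (S.erase s) ?_ ?_ ?_
  · intro C _ hC _ h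
    obtain ⟨v, hv⟩ := hC.1
    simpa using h v hv
  · intro T₁ T₂ hd _ hno h1 h2 C hCU hC hCp hCT
    rcases hC.forall_or_forall (fun v => ρ v ∈ T₁) (fun a ha b hb hab haT => by
      rcases Finset.mem_union.1 (hCT b hb) with h | h
      · exact h
      · exact absurd ⟨fun e => Finset.disjoint_left.1 hd haT (e ▸ h), a, (hCU ha).1, b,
          (hCU hb).1, hab, rfl, rfl⟩ (hno _ haT _ h)) with h | h
    · exact h1 C hCU hC hCp h
    · exact h2 C hCU hC hCp fun v hv => (Finset.mem_union.1 (hCT v hv)).resolve_left (h v hv)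
  · intro T hT hTne hTc hTcl C hCU hC hCp hCT
    have hTS : T ⊆ S := hT.trans (Finset.erase_subset _ _)
    have hsT : s ∉ T := fun h => by simpa using hT h
    -- A neighbour of the deleted source has lost a neighbour, so it is an end of the path `T`.
    obtain ⟨t, ht, hts⟩ : ∃ t ∈ T, (D.rootGraph U ρ).Adj t s := by
      by_contra hcon
      push Not at hcon
      refine hsT ((hX T hTS hTne fun a ha b hb hab => ?_) ▸ hsS)
      exact hTcl a ha b (Finset.mem_erase.2 ⟨fun e => hcon a ha (e ▸ hab), hb⟩) hab
    have ht1 : (D.rootGraph U ρ).degIn T t ≤ 1 := by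
      have h3 := SimpleGraph.degIn_erase_of_adj hsS hts
      have h4 := SimpleGraph.degIn_mono (G := D.rootGraph U ρ) hT t
      have := h2 t (hTS ht)
      omega
    obtain ⟨f, -, hlt, hinj, hadj, -⟩ := hTc.exists_path_labelling
      (fun v hv => (SimpleGraph.degIn_mono hTS v).trans (h2 v (hTS hv))) ht ht1
    have hcard := Finset.card_le_card hT
    rw [Finset.card_erase_of_mem hsS] at hcard
    have hpos : 0 < S.card := Finset.card_pos.2 ⟨s, hsS⟩
    refine .of_labelling (hρ.of_predClosed (fun v hv => (hCU hv).1) hCp) (f := fun v => f (ρ v))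
      (fun v hv w hw h => hinj (hCT v hv) (hCT w hw) h) ?_ (a := 0) (fun _ _ => Nat.zero_le _) ?_
    · intro v hv w hw hvw
      by_cases h : ρ v = ρ w
      · simp [h]
      · exact hadj _ (hCT v hv) _ (hCT w hw)
          ⟨h, v, (hCU hv).1, w, (hCU hw).1, hvw, rfl, rfl⟩
    · intro v hv
      have := hlt _ (hCT v hv)
      omega

theorem HasForest.of_isAcyclic [Finite V] (hD : D.IsAcyclic) (U : Set V) :
    D.HasForest ((D.edgesOn U).ncard / 5 + 3) U := by
  classical
  induction hn : U.ncard using Nat.strong_induction_on generalizing U with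
  | _ n ih =>
  refine of_components fun S hSU hc _ => ?_
  refine HasForest.mono (k := (D.edgesOn S).ncard / 5 + 3) ?_
    (by have := ncard_edgesOn_mono (D := D) hSU; omega)
  by_cases h5 : ∃ s, D.IsSourceIn S s ∧ 5 ≤ (D.edgesBelow S s).ncard
  · obtain ⟨s, hs, h5⟩ := h5
    have hlt : (S \ D.reachIn S s).ncard < n := by
      rw [← hn]
      refine (Set.ncard_lt_ncard ?_).trans_le (Set.ncard_le_ncard hSU)
      exact ⟨Set.sdiff_subset, fun h => (h hs.1).2 (self_mem_reachIn _ _)⟩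
    have := ncard_edgesOn_diff (D := D) S s
    exact (root hc hs (ih _ hlt _ rfl)).mono (by omega)
  push Not at h5
  have h4 : ∀ s, D.IsSourceIn S s → (D.edgesBelow S s).ncard ≤ 4 := fun s hs => by
    have := h5 s hs; omega
  obtain ⟨ρ, hρ, hsrc, hpar⟩ := hD.exists_rootMap S
  have := Fintype.ofFinite V
  set R : Finset V := Finset.univ.filter fun s => D.IsSourceIn S s with hR
  have hRm : ∀ s, s ∈ R ↔ D.IsSourceIn S s := fun s => by simp [hR]
  by_cases h2 : ∀ s ∈ R, (D.rootGraph S ρ).degIn R s ≤ 2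
  -- With `q = ℓ / 5` there are at most `ℓ - 1 ≤ 5 * q + 3 ≤ 2 ^ (q + 2)` sources, or at most four.
  · refine of_degIn_rootGraph_le_two hc hρ hsrc hRm h2 (k := (D.edgesOn S).ncard / 5 + 2) ?_
    have key := SimpleGraph.EdgeElim.five_mul_add_le_two_pow ((D.edgesOn S).ncard / 5)
    have hpow : 2 ^ ((D.edgesOn S).ncard / 5 + 2) = 4 * 2 ^ ((D.edgesOn S).ncard / 5) := by ring
    by_cases hR5 : 5 ≤ R.card
    · have := card_sources_lt hc h4 hRm hR5
      omega
    · have := Nat.one_le_two_pow (n := (D.edgesOn S).ncard / 5)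
      omega
  · push Not at h2
    obtain ⟨s, hs, h2⟩ := h2
    obtain ⟨a, b, c, ha, hb, hc', hab, hac, hbc⟩ := Finset.two_lt_card_iff.1 h2
    simp only [Finset.mem_filter] at ha hb hc'
    refine (of_three_neighbors hc hρ hpar h4 ((hRm s).1 hs) (t := ![a, b, c]) ?_ ?_).mono (by omega)
    · intro i j
      fin_cases i <;> fin_cases j <;> simp [hab, hac, hbc, hab.symm, hac.symm, hbc.symm]
    · intro i
      fin_cases i
      exacts [ha.2, hb.2, hc'.2]

theorem dagTreedepth_le [Finite V] (hD : D.IsAcyclic) :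
    D.dagTreedepth ≤ ((D.numEdges / 5 + 3 : ℕ) : ℕ∞) := by
  obtain ⟨F, hF⟩ := HasForest.of_isAcyclic hD Set.univ
  refine (iInf_le _ F).trans ?_
  simpa [edgesOn, numEdges] using hF

end Digraph

/-! ### Structured commands, their machine code and rules for running them. -/

namespace RAM

variable {n : ℕ} {G : SimpleGraph (Fin n)}

/-- The operations of the machine, on registers that are named by natural numbers. -/
inductive Op : Type
  | const (c : ℕ)
  | add (a b : ℕ)
  | sub (a b : ℕ)
  | mul (a b : ℕ)
  | div (a b : ℕ)
  | order
  | degree (a : ℕ)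
  | neighbor (a b : ℕ)
  | adjacent (a b : ℕ)

/-- The result of an operation. -/
def Op.value (L : G.AdjLists) (σ : ℕ → ℕ) : Op → ℕ
  | .const c => c
  | .add a b => σ a + σ b
  | .sub a b => σ a - σ b
  | .mul a b => σ a * σ b
  | .div a b => σ a / σ b
  | .order => n
  | .degree a => L.degree (σ a)
  | .neighbor a b => L.neighbor (σ a) (σ b)
  | .adjacent a b => L.matrixEntry (σ a) (σ b)

/-- A number that is at least the name of each register that is read. -/
def Op.bound : Op → ℕ
  | .const _ => 0
  | .add a b => max a b
  | .sub a b => max a b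
  | .mul a b => max a b
  | .div a b => max a b
  | .order => 0
  | .degree a => a
  | .neighbor a b => max a b
  | .adjacent a b => max a b

/-- The register of a machine with registers `0, …, S`. -/
def toReg (S r : ℕ) : Fin (S + 1) := Fin.ofNat (S + 1) r

/-- The instruction for an operation. -/
def Op.instr (S : ℕ) (r : ℕ) : Op → Instr (S + 1)
  | .const c => .const (toReg S r) c
  | .add a b => .add (toReg S r) (toReg S a) (toReg S b)
  | .sub a b => .sub (toReg S r) (toReg S a) (toReg S b)
  | .mul a b => .mul (toReg S r) (toReg S a) (toReg S b)
  | .div a b => .div (toReg S r) (toReg S a) (toReg S b)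
  | .order => .order (toReg S r)
  | .degree a => .degree (toReg S r) (toReg S a)
  | .neighbor a b => .neighbor (toReg S r) (toReg S a) (toReg S b)
  | .adjacent a b => .adjacent (toReg S r) (toReg S a) (toReg S b)

lemma getElem?_of_eq_append {α : Type*} {C pre suf : List α} {x : α} {k : ℕ}
    (hC : C = pre ++ x :: suf) (hk : pre.length = k) : C[k]? = some x := by
  subst hC hk
  simp

/-- Structured commands. Loops expect `0` in register `0` and `1` in register `1`; the body of
`loop i m body` is run for `i = 0, 1, …` as long as the content of `i` is less than that of `m`. -/
inductive Cmd : Type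
  | op (r : ℕ) (o : Op)
  | seq (c₁ c₂ : Cmd)
  | loop (i m : ℕ) (body : Cmd)

namespace Cmd

/-- The number of instructions. -/
def length : Cmd → ℕ
  | op _ _ => 1
  | seq c₁ c₂ => c₁.length + c₂.length
  | loop _ _ body => body.length + 4

/-- A number that is at least the name of each register that is used. -/
def bound : Cmd → ℕ
  | op r o => max r o.bound
  | seq c₁ c₂ => max c₁.bound c₂.bound
  | loop i m body => max (max i m) (max 1 body.bound)

/-- The machine code of a command, to be placed at position `p`. -/
def code (S : ℕ) : ℕ → Cmd → List (Instr (S + 1))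
  | _, op r o => [o.instr S r]
  | p, seq c₁ c₂ => c₁.code S p ++ c₂.code S (p + c₁.length)
  | p, loop i m body =>
    -- With `0` and `1` in registers `0` and `1` the first jump is unconditional. It leads to the
    -- test at the end, so an empty range skips the body.
    [.const (toReg S i) 0, .jumpLt (toReg S 0) (toReg S 1) (p + body.length + 3)] ++
      body.code S (p + 2) ++
      [.add (toReg S i) (toReg S i) (toReg S 1), .jumpLt (toReg S i) (toReg S m) (p + 2)]

lemma length_code (S : ℕ) (c : Cmd) (p : ℕ) : (c.code S p).length = c.length := by
  induction c generalizing p with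
  | op => rfl
  | seq c₁ c₂ h1 h2 => simp [code, length, h1, h2]
  | loop i m body h => simp [code, length, h]

end Cmd

/-- The configuration at position `p` with register contents `σ`. -/
def Config.of (S p : ℕ) (σ : ℕ → ℕ) : Config (S + 1) := ⟨p, fun r => σ r⟩

lemma Config.of_reg {S p r : ℕ} {σ : ℕ → ℕ} (hr : r ≤ S) : (Config.of S p σ).reg (toReg S r) = σ r := by
  simp [Config.of, toReg, Nat.mod_eq_of_lt (Nat.lt_succ_of_le hr)]

lemma Config.of_store {S p r x : ℕ} {σ : ℕ → ℕ} (hr : r ≤ S) :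
    (Config.of S p σ).store (toReg S r) x = Config.of S (p + 1) (Function.update σ r x) := by
  unfold Config.store Config.of
  congr 1
  funext j
  by_cases h : (j : ℕ) = r
  · have : j = toReg S r := by
      ext; simp [toReg, Nat.mod_eq_of_lt (Nat.lt_succ_of_le hr), h]
    rw [this, Function.update_self]
    rw [← this, h, Function.update_self]
  · have : j ≠ toReg S r := by
      rintro rfl
      simp [toReg, Nat.mod_eq_of_lt (Nat.lt_succ_of_le hr)] at h
    rw [Function.update_of_ne this, Function.update_of_ne h]

lemma exec_op {S p r : ℕ} {σ : ℕ → ℕ} {o : Op} (L : G.AdjLists) (hr : r ≤ S) (ho : o.bound ≤ S) :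
    exec L (Config.of S p σ) (o.instr S r) =
      Config.of S (p + 1) (Function.update σ r (o.value L σ)) := by
  cases o <;> simp only [Op.bound, max_le_iff] at ho <;>
    simp only [Op.instr, exec, Op.value, Config.of_store hr] <;>
    first
      | rfl
      | rw [Config.of_reg ho.1, Config.of_reg ho.2]
      | rw [Config.of_reg ho]

/-- The program `P` gets from `c` to `c'` in `t` steps, and no register exceeds `B` meanwhile. -/
def Program.Reaches (P : Program) (L : G.AdjLists) (B : ℕ) (c c' : Config P.numRegs) (t : ℕ) :
    Prop :=
  (P.step L)^[t] c = c' ∧ ∀ i ≤ t, ∀ r, ((P.step L)^[i] c).reg r ≤ B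

namespace Program.Reaches

variable {P : Program} {L : G.AdjLists} {B : ℕ} {c c' c'' : Config P.numRegs} {t t' : ℕ}

lemma trans (h : P.Reaches L B c c' t) (h' : P.Reaches L B c' c'' t') :
    P.Reaches L B c c'' (t + t') := by
  refine ⟨by rw [add_comm, Function.iterate_add_apply, h.1, h'.1], fun i hi r => ?_⟩
  rcases le_total i t with hit | hit
  · exact h.2 i hit r
  · obtain ⟨j, rfl⟩ := Nat.exists_eq_add_of_le hit
    rw [add_comm, Function.iterate_add_apply, h.1]
    exact h'.2 j (by omega) r

lemma single {i : Instr P.numRegs} (hi : P.code[c.pc]? = some i) (hc : exec L c i = c')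
    (hB : ∀ r, c.reg r ≤ B) (hB' : ∀ r, c'.reg r ≤ B) : P.Reaches L B c c' 1 := by
  have h1 : P.step L c = c' := by rw [Program.step, hi]; exact hc
  refine ⟨h1, fun j hj r => ?_⟩
  obtain rfl | rfl : j = 0 ∨ j = 1 := by omega
  · exact hB r
  · rw [Function.iterate_one, h1]; exact hB' r

end Program.Reaches

/-- Started with register contents `σ`, the command `c` stops after at most `T` steps with register
contents that satisfy `Q`, and no register exceeds `B` meanwhile. -/
def Runs (L : G.AdjLists) (B : ℕ) (c : Cmd) (σ : ℕ → ℕ) (T : ℕ) (Q : (ℕ → ℕ) → Prop) : Prop :=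
  ∃ σ' t, t ≤ T ∧ Q σ' ∧ (∀ r, σ' r ≤ B) ∧
    ∀ (S p : ℕ) (C pre suf : List (Instr (S + 1))) (o : Fin (S + 1)), c.bound ≤ S →
      C = pre ++ c.code S p ++ suf → pre.length = p →
      Program.Reaches ⟨S + 1, C, o⟩ L B (Config.of S p σ) (Config.of S (p + c.length) σ') t

namespace Runs

variable {L : G.AdjLists} {B T T₁ T₂ : ℕ} {c c₁ c₂ : Cmd} {σ : ℕ → ℕ} {Q Q₁ : (ℕ → ℕ) → Prop}

lemma mono {Q' : (ℕ → ℕ) → Prop} {T' : ℕ} (h : Runs L B c σ T Q) (hT : T ≤ T')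
    (hQ : ∀ τ, (∀ r, τ r ≤ B) → Q τ → Q' τ) : Runs L B c σ T' Q' := by
  obtain ⟨σ', t, ht, hq, hB, h⟩ := h
  exact ⟨σ', t, ht.trans hT, hQ _ hB hq, hB, h⟩

lemma update_le {r x : ℕ} (hσ : ∀ r, σ r ≤ B) (hx : x ≤ B) : ∀ j, Function.update σ r x j ≤ B := by
  intro j
  rw [Function.update_apply]
  split_ifs
  exacts [hx, hσ j]

lemma op {r : ℕ} {o : Op} (hσ : ∀ r, σ r ≤ B) (hv : o.value L σ ≤ B)
    (hQ : Q (Function.update σ r (o.value L σ))) : Runs L B (.op r o) σ 1 Q := by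
  refine ⟨_, 1, le_rfl, hQ, update_le hσ hv, fun S p C pre suf o' hb hC hp => ?_⟩
  simp only [Cmd.bound, max_le_iff] at hb
  refine .single (i := o.instr S r) ?_ (exec_op L hb.1 hb.2) (fun _ => hσ _)
    fun _ => update_le hσ hv _
  subst hC hp
  simp [Config.of, Cmd.code]

lemma seq (h₁ : Runs L B c₁ σ T₁ Q₁)
    (h₂ : ∀ τ, (∀ r, τ r ≤ B) → Q₁ τ → Runs L B c₂ τ T₂ Q) : Runs L B (.seq c₁ c₂) σ (T₁ + T₂) Q := by
  obtain ⟨σ₁, t₁, ht₁, hQ₁, hB₁, h₁⟩ := h₁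
  obtain ⟨σ₂, t₂, ht₂, hQ₂, hB₂, h₂⟩ := h₂ σ₁ hB₁ hQ₁
  refine ⟨σ₂, t₁ + t₂, by omega, hQ₂, hB₂, fun S p C pre suf o hb hC hp => ?_⟩
  simp only [Cmd.bound, max_le_iff] at hb
  have r1 := h₁ S p C pre (c₂.code S (p + c₁.length) ++ suf) o hb.1
    (by simp [hC, Cmd.code]) hp
  have r2 := h₂ S (p + c₁.length) C (pre ++ c₁.code S p) suf o hb.2
    (by simp [hC, Cmd.code]) (by simp [Cmd.length_code, hp])
  rw [Cmd.length, ← add_assoc]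
  exact r1.trans r2

/-- `I j` is the invariant at the test with counter `j`. Each round adds an increment and a test to
the body; the `3` is for initialization, the entry jump and the failing last test. -/
lemma loop {i m N : ℕ} {body : Cmd} {T : ℕ → ℕ} (I : ℕ → (ℕ → ℕ) → Prop) (hσ : ∀ r, σ r ≤ B)
    (h0 : σ 0 = 0) (h1 : σ 1 = 1) (hi : 2 ≤ i) (hN : N ≤ B) (hstart : I 0 (Function.update σ i 0))
    (hI : ∀ j ≤ N, ∀ τ, I j τ → τ i = j ∧ τ m = N)
    (hstep : ∀ j < N, ∀ τ, (∀ r, τ r ≤ B) → I j τ → Runs L B body τ (T j)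
      fun τ' => τ' i = j ∧ τ' 1 = 1 ∧ I (j + 1) (Function.update τ' i (j + 1))) :
    Runs L B (.loop i m body) σ (∑ j ∈ Finset.range N, (T j + 2) + 3) (I N) := by
  -- Induction on the number `d` of remaining rounds, with the machine standing at the test.
  have key : ∀ d j, j + d = N → ∀ τ, (∀ r, τ r ≤ B) → I j τ → ∃ σ' t,
      t ≤ ∑ j ∈ Finset.Ico j N, (T j + 2) + 1 ∧ I N σ' ∧ (∀ r, σ' r ≤ B) ∧
      ∀ (S p : ℕ) (C pre suf : List (Instr (S + 1))) (o : Fin (S + 1)),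
        (Cmd.loop i m body).bound ≤ S → C = pre ++ (Cmd.loop i m body).code S p ++ suf →
        pre.length = p → Program.Reaches ⟨S + 1, C, o⟩ L B
          (Config.of S (p + body.length + 3) τ) (Config.of S (p + (body.length + 4)) σ') t := by
    intro d
    induction d with
    | zero =>
      rintro j rfl τ hτ hIτ
      refine ⟨τ, 1, by simp, hIτ, hτ, fun S p C pre suf o hb hC hp => ?_⟩
      simp only [Cmd.bound, max_le_iff] at hb
      refine .single (i := .jumpLt (toReg S i) (toReg S m) (p + 2)) ?_ ?_ (fun _ => hτ _)
        fun _ => hτ _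
      · exact getElem?_of_eq_append (pre := pre ++ [.const (toReg S i) 0,
          .jumpLt (toReg S 0) (toReg S 1) (p + body.length + 3)] ++ body.code S (p + 2) ++
          [.add (toReg S i) (toReg S i) (toReg S 1)]) (suf := suf) (by simp [hC, Cmd.code])
          (by simp [Config.of, Cmd.length_code, hp]; omega)
      · rw [exec, Config.of_reg hb.1.1, Config.of_reg hb.1.2, (hI _ le_rfl τ hIτ).1,
          (hI _ le_rfl τ hIτ).2]
        simp [Config.of]
        omega
    | succ d ih =>
      intro j hj τ hτ hIτ
      obtain ⟨τ', t, ht, ⟨hτi, hτ1, hIτ'⟩, hBτ', hrun⟩ := hstep j (by omega) τ hτ hIτ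
      have hBu : ∀ r, Function.update τ' i (j + 1) r ≤ B := update_le hBτ' (by omega)
      obtain ⟨σ', t', ht', hIσ', hBσ', hrun'⟩ := ih (j + 1) (by omega) _ hBu hIτ'
      refine ⟨σ', 1 + t + 1 + t', ?_, hIσ', hBσ', fun S p C pre suf o hb hC hp => ?_⟩
      · rw [← Finset.sum_Ioo_add_eq_sum_Ico (by omega : j < N)]
        have : Finset.Ioo j N = Finset.Ico (j + 1) N := by ext; simp
        rw [this]
        omega
      have hb' := hb
      simp only [Cmd.bound, max_le_iff] at hb
      have e1 : Program.Reaches ⟨S + 1, C, o⟩ L B (Config.of S (p + body.length + 3) τ)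
          (Config.of S (p + 2) τ) 1 := by
        refine .single (i := .jumpLt (toReg S i) (toReg S m) (p + 2)) ?_ ?_ (fun _ => hτ _)
          fun _ => hτ _
        · exact getElem?_of_eq_append (pre := pre ++ [.const (toReg S i) 0,
            .jumpLt (toReg S 0) (toReg S 1) (p + body.length + 3)] ++ body.code S (p + 2) ++
            [.add (toReg S i) (toReg S i) (toReg S 1)]) (suf := suf) (by simp [hC, Cmd.code])
            (by simp [Config.of, Cmd.length_code, hp]; omega)
        · rw [exec, Config.of_reg hb.1.1, Config.of_reg hb.1.2, (hI _ (by omega) τ hIτ).1,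
            (hI _ (by omega) τ hIτ).2, if_pos (by omega)]
          rfl
      have e2 := hrun S (p + 2) C (pre ++ [.const (toReg S i) 0,
        .jumpLt (toReg S 0) (toReg S 1) (p + body.length + 3)])
        ([.add (toReg S i) (toReg S i) (toReg S 1), .jumpLt (toReg S i) (toReg S m) (p + 2)] ++ suf)
        o hb.2.2 (by simp [hC, Cmd.code]) (by simp [hp])
      have e3 : Program.Reaches ⟨S + 1, C, o⟩ L B (Config.of S (p + 2 + body.length) τ')
          (Config.of S (p + body.length + 3) (Function.update τ' i (j + 1))) 1 := by
        refine .single (i := .add (toReg S i) (toReg S i) (toReg S 1)) ?_ ?_ (fun _ => hBτ' _)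
          fun _ => hBu _
        · exact getElem?_of_eq_append (pre := pre ++ [.const (toReg S i) 0,
            .jumpLt (toReg S 0) (toReg S 1) (p + body.length + 3)] ++ body.code S (p + 2))
            (suf := .jumpLt (toReg S i) (toReg S m) (p + 2) :: suf) (by simp [hC, Cmd.code])
            (by simp [Config.of, Cmd.length_code, hp]; omega)
        · rw [exec, Config.of_reg hb.1.1, Config.of_reg hb.2.1, Config.of_store hb.1.1, hτi, hτ1]
          congr 1
          omega
      have e4 := hrun' S p C pre suf o hb' hC hp
      exact ((e1.trans e2).trans e3).trans e4
  have hB0 : ∀ r, Function.update σ i 0 r ≤ B := update_le hσ (Nat.zero_le _)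
  obtain ⟨σ', t, ht, hIσ', hBσ', hrun⟩ := key N 0 (by omega) _ hB0 hstart
  refine ⟨σ', 1 + 1 + t, ?_, hIσ', hBσ', fun S p C pre suf o hb hC hp => ?_⟩
  · rw [Finset.range_eq_Ico]; omega
  have hb' := hb
  simp only [Cmd.bound, max_le_iff] at hb
  have e1 : Program.Reaches ⟨S + 1, C, o⟩ L B (Config.of S p σ)
      (Config.of S (p + 1) (Function.update σ i 0)) 1 := by
    refine .single (i := .const (toReg S i) 0) ?_ ?_ (fun _ => hσ _) fun _ => hB0 _
    · subst hC hp
      simp [Config.of, Cmd.code]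
    · rw [exec, Config.of_store hb.1.1]
  have e2 : Program.Reaches ⟨S + 1, C, o⟩ L B (Config.of S (p + 1) (Function.update σ i 0))
      (Config.of S (p + body.length + 3) (Function.update σ i 0)) 1 := by
    refine .single (i := .jumpLt (toReg S 0) (toReg S 1) (p + body.length + 3)) ?_ ?_
      (fun _ => hB0 _) fun _ => hB0 _
    · subst hC hp
      simp [Config.of, Cmd.code]
    · rw [exec, Config.of_reg (Nat.zero_le _), Config.of_reg hb.2.1,
        Function.update_of_ne (by omega), Function.update_of_ne (by omega), h0, h1,
        if_pos (by omega)]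
      rfl
  exact (e1.trans e2).trans (hrun S p C pre suf o hb' hC hp)

end Runs

end RAM

/-! ### Recursive counting of extensions of a partial homomorphism. -/

namespace SimpleGraph

variable {α : Type*} [Fintype α] [DecidableEq α] {n : ℕ}

open scoped Classical in
/-- The maps that agree with `φ` outside `U` and send the edges of `H` between `U` and `U ∪ A` to
edges of `G`. -/
noncomputable def extensions (H : SimpleGraph α) (G : SimpleGraph (Fin n)) (A U : Finset α)
    (φ : α → Fin n) : Finset (α → Fin n) :=
  Finset.univ.filter fun ψ => (∀ a ∉ U, ψ a = φ a) ∧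
    ∀ a ∈ U, ∀ b, b ∈ U ∨ b ∈ A → H.Adj a b → G.Adj (ψ a) (ψ b)

variable {H : SimpleGraph α} {G : SimpleGraph (Fin n)} {A U : Finset α} {φ : α → Fin n}

lemma mem_extensions {ψ : α → Fin n} : ψ ∈ H.extensions G A U φ ↔ (∀ a ∉ U, ψ a = φ a) ∧
    ∀ a ∈ U, ∀ b, b ∈ U ∨ b ∈ A → H.Adj a b → G.Adj (ψ a) (ψ b) := by
  simp [extensions]

lemma card_extensions_le : (H.extensions G A U φ).card ≤ n ^ Fintype.card α :=
  (Finset.card_le_univ _).trans (by simp)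

lemma card_extensions_empty : (H.extensions G A ∅ φ).card = 1 := by
  rw [Finset.card_eq_one]
  refine ⟨φ, Finset.ext fun ψ => ?_⟩
  simp [mem_extensions, funext_iff]

/-- No edge joins the parts, so an extension is an arbitrary pair of extensions to `S` and to `T`.
-/
lemma card_extensions_union {S T : Finset α} (hST : Disjoint S T)
    (h : ∀ a ∈ S, ∀ b ∈ T, ¬ H.Adj a b) :
    (H.extensions G A (S ∪ T) φ).card =
      (H.extensions G A S φ).card * (H.extensions G A T φ).card := by
  rw [← Finset.card_product]
  have hd : ∀ a ∈ S, a ∉ T := fun a h1 h2 => Finset.disjoint_left.1 hST h1 h2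
  refine Finset.card_nbij' (fun ψ => (fun a => if a ∈ S then ψ a else φ a,
    fun a => if a ∈ T then ψ a else φ a)) (fun p a => if a ∈ S then p.1 a else p.2 a) ?_ ?_ ?_ ?_
  · intro ψ hψ
    simp only [Finset.mem_coe, mem_extensions, Finset.mem_union, Finset.mem_product] at hψ ⊢
    refine ⟨⟨fun a ha => if_neg ha, fun a ha b hb hab => ?_⟩,
      ⟨fun a ha => if_neg ha, fun a ha b hb hab => ?_⟩⟩
    · have hbT : b ∉ T := fun hb => h a ha b hb hab
      have := hψ.2 a (.inl ha) b (by tauto) hab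
      by_cases hbS : b ∈ S
      · simpa [ha, hbS] using this
      · rw [hψ.1 b (by tauto)] at this
        simpa [ha, hbS] using this
    · have hbS : b ∉ S := fun hb => h b hb a ha hab.symm
      have := hψ.2 a (.inr ha) b (by tauto) hab
      by_cases hbT : b ∈ T
      · simpa [ha, hbT] using this
      · rw [hψ.1 b (by tauto)] at this
        simpa [ha, hbT] using this
  · rintro ⟨ψ₁, ψ₂⟩ hψ
    simp only [Finset.mem_coe, mem_extensions, Finset.mem_union, Finset.mem_product] at hψ ⊢
    obtain ⟨⟨h1, h1'⟩, ⟨h2, h2'⟩⟩ := hψ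
    refine ⟨fun a ha => ?_, fun a ha b hb hab => ?_⟩
    · rw [if_neg (by tauto), h2 a (by tauto)]
    · by_cases haS : a ∈ S
      · have hbT : b ∉ T := fun hb => h a haS b hb hab
        have := h1' a haS b (by tauto) hab
        by_cases hbS : b ∈ S
        · simpa [haS, hbS] using this
        · rw [h1 b hbS] at this
          simpa [haS, hbS, h2 b hbT] using this
      · have haT : a ∈ T := by tauto
        have hbS : b ∉ S := fun hb => h b hb a haT hab.symm
        have := h2' a haT b (by tauto) hab
        simpa [haS, hbS] using this
  · intro ψ hψ
    funext a
    have := (mem_extensions.1 hψ).1 a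
    simp only [Finset.mem_union] at this
    by_cases haS : a ∈ S <;> by_cases haT : a ∈ T <;> simp_all
  · rintro ⟨ψ₁, ψ₂⟩ hψ
    simp only [Finset.mem_coe, mem_extensions, Finset.mem_product] at hψ
    obtain ⟨⟨h1, -⟩, ⟨h2, -⟩⟩ := hψ
    refine Prod.ext (funext fun a => ?_) (funext fun a => ?_)
    · by_cases haS : a ∈ S
      · simp [haS]
      · simp [haS, h1 a haS]
    · by_cases haT : a ∈ T
      · have : a ∉ S := fun h => hd a h haT
        simp [haT, this]
      · simp [haT, h2 a haT]

open scoped Classical in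
/-- The indicator of `x` being a possible image of `u`, given the images of the vertices in `A`. -/
noncomputable def indicator (H : SimpleGraph α) (G : SimpleGraph (Fin n)) (A : Finset α)
    (φ : α → Fin n) (u : α) (x : Fin n) : ℕ :=
  if ∀ b ∈ A, H.Adj u b → G.Adj x (φ b) then 1 else 0

lemma card_extensions_vertex (hAU : Disjoint A U) {u : α} (hu : u ∈ U) :
    (H.extensions G A U φ).card = ∑ x, H.indicator G A φ u x *
      (H.extensions G (insert u A) (U.erase u) (Function.update φ u x)).card := by
  have hAU' : ∀ a ∈ A, a ∉ U := fun a h1 h2 => Finset.disjoint_left.1 hAU h1 h2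
  rw [Finset.card_eq_sum_card_fiberwise (f := fun ψ => ψ u) (t := Finset.univ) (by simp)]
  refine Finset.sum_congr rfl fun x _ => ?_
  unfold indicator
  split_ifs with h
  · rw [one_mul]
    congr 1
    ext ψ
    simp only [Finset.mem_filter, mem_extensions, Finset.mem_erase, Finset.mem_insert]
    constructor
    · rintro ⟨⟨h1, h2⟩, rfl⟩
      refine ⟨fun a ha => ?_, fun a ha b hb hab => h2 a ha.2 b ?_ hab⟩
      · by_cases hau : a = u
        · subst hau; simp
        · rw [Function.update_of_ne hau]
          exact h1 a fun hh => ha ⟨hau, hh⟩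
      · rcases hb with hb | rfl | hb
        exacts [.inl hb.2, .inl hu, .inr hb]
    · rintro ⟨h1, h2⟩
      have hux : ψ u = x := by simpa using h1 u (by simp)
      have hA : ∀ b ∈ A, ψ b = φ b := fun b hb => by
        have hbu : b ≠ u := fun e => hAU' b hb (e ▸ hu)
        rw [h1 b fun hh => hAU' b hb hh.2, Function.update_of_ne hbu]
      refine ⟨⟨fun a ha => ?_, fun a ha b hb hab => ?_⟩, hux⟩
      · rw [h1 a fun hh => ha hh.2, Function.update_of_ne (show a ≠ u from fun e => ha (e ▸ hu))]
      · by_cases hau : a = u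
        · subst hau
          rcases hb with hb | hb
          · have := h2 b ⟨hab.ne', hb⟩ a (by simp) hab.symm
            exact this.symm
          · rw [hux, hA b hb]
            exact h b hb hab
        · refine h2 a ⟨hau, ha⟩ b ?_ hab
          by_cases hbu : b = u
          · exact .inr (.inl hbu)
          · tauto
  · rw [zero_mul, Finset.card_eq_zero, Finset.filter_eq_empty_iff]
    rintro ψ hψ rfl
    rw [mem_extensions] at hψ
    exact h fun b hb hub => hψ.1 b (hAU' b hb) ▸ hψ.2 u hu b (.inr hb) hub

lemma indicator_insert {u v : α} (huv : H.Adj u v) {x y : Fin n} [DecidableRel G.Adj]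
    (hu : u ∉ A) :
    H.indicator G (insert u A) (Function.update φ u x) v y =
      if G.Adj x y then H.indicator G A φ v y else 0 := by
  classical
  unfold indicator
  have : (∀ b ∈ insert u A, H.Adj v b → G.Adj y (Function.update φ u x b)) ↔
      G.Adj x y ∧ ∀ b ∈ A, H.Adj v b → G.Adj y (φ b) := by
    rw [Finset.forall_mem_insert]
    refine and_congr ?_ (forall₂_congr fun b hb => ?_)
    · simp [huv.symm, G.adj_comm]
    · rw [Function.update_of_ne (show b ≠ u from fun e => hu (e ▸ hb))]
  by_cases h1 : G.Adj x y <;> by_cases h2 : ∀ b ∈ A, H.Adj v b → G.Adj y (φ b) <;>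
    simp only [this, h1, h2, if_true, if_false] <;> simp

/-- Two vertex steps in succession. Once `u` has image `x`, only neighbours of `x` are possible for
`v`, so the inner sum runs over an adjacency list instead of all vertices. -/
lemma card_extensions_edge (hAU : Disjoint A U) {u v : α} (hu : u ∈ U) (hv : v ∈ U)
    (huv : H.Adj u v) (L : G.AdjLists) :
    (H.extensions G A U φ).card = ∑ x, ((L.nbrs x).map fun y =>
      H.indicator G A φ u x * (H.indicator G A φ v y *
        (H.extensions G (insert v (insert u A)) ((U.erase u).erase v)
          (Function.update (Function.update φ u x) v y)).card)).sum := by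
  classical
  rw [card_extensions_vertex hAU hu]
  refine Finset.sum_congr rfl fun x _ => ?_
  have huA : u ∉ A := fun h => Finset.disjoint_left.1 hAU h hu
  have hd : Disjoint (insert u A) (U.erase u) := by
    rw [Finset.disjoint_insert_left]
    exact ⟨by simp, hAU.mono_right (Finset.erase_subset _ _)⟩
  rw [card_extensions_vertex hd (Finset.mem_erase.2 ⟨huv.ne', hv⟩), List.sum_map_mul_left]
  congr 1
  rw [← List.sum_toFinset _ (L.nodup x)]
  have : (L.nbrs x).toFinset = Finset.univ.filter (G.Adj x) := by
    ext y; simp [L.mem_iff]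
  rw [this, Finset.sum_filter]
  refine Finset.sum_congr rfl fun y _ => ?_
  rw [indicator_insert huv huA]
  split_ifs <;> simp

end SimpleGraph

/-! ### Host queries, summation loops and adjacency checks. -/

namespace SimpleGraph.AdjLists

variable {n : ℕ} {G : SimpleGraph (Fin n)} (L : G.AdjLists)

lemma degree_val (x : Fin n) : L.degree x = (L.nbrs x).length := by simp [degree]

lemma neighbor_val (x : Fin n) {i : ℕ} (hi : i < (L.nbrs x).length) :
    L.neighbor x i = ((L.nbrs x)[i] : Fin n) := by
  simp [neighbor, hi]

open scoped Classical in
lemma matrixEntry_val (x y : Fin n) : L.matrixEntry x y = if G.Adj x y then 1 else 0 := by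
  simp [matrixEntry, L.mem_iff]

end SimpleGraph.AdjLists

namespace RAM

open SimpleGraph

variable {n : ℕ} {G : SimpleGraph (Fin n)} {L : G.AdjLists} {B : ℕ} {σ : ℕ → ℕ}

/-- Adding up values in the register `acc` by a loop. -/
lemma Runs.sum_loop {acc i m N : ℕ} {body : Cmd} (g T : ℕ → ℕ) (K : ℕ → Prop)
    (hσ : ∀ r, σ r ≤ B) (h0 : σ 0 = 0) (h1 : σ 1 = 1) (hi : 2 ≤ i) (hm : σ m = N)
    (hacc : acc ≠ i) (hK1 : K 1) (hKm : K m) (hKi : ¬ K i)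
    (hB : σ acc + ∑ j ∈ Finset.range N, g j ≤ B)
    (hbody : ∀ j < N, ∀ τ, (∀ r, τ r ≤ B) → τ i = j → (∀ r, K r → τ r = σ r) →
      τ acc + g j ≤ B → Runs L B body τ (T j)
        fun τ' => τ' acc = τ acc + g j ∧ τ' i = j ∧ ∀ r, K r → τ' r = σ r) :
    Runs L B (.loop i m body) σ (∑ j ∈ Finset.range N, (T j + 2) + 3)
      fun τ => τ acc = σ acc + ∑ j ∈ Finset.range N, g j ∧ ∀ r, K r → τ r = σ r := by
  have hKne : ∀ r, K r → r ≠ i := fun r hr e => hKi (e ▸ hr)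
  refine (Runs.loop (N := N) (T := T) (fun j τ => τ i = j ∧
    τ acc = σ acc + ∑ j ∈ Finset.range j, g j ∧ ∀ r, K r → τ r = σ r) hσ h0 h1 hi
    (hm ▸ hσ m) ?_ ?_ ?_).mono le_rfl fun τ _ h => h.2
  · refine ⟨by simp, by simp [Function.update_of_ne hacc], fun r hr => ?_⟩
    rw [Function.update_of_ne (hKne r hr)]
  · exact fun j _ τ h => ⟨h.1, (h.2.2 m hKm).trans hm⟩
  · intro j hj τ hτ h
    have hle : σ acc + ∑ j ∈ Finset.range (j + 1), g j ≤ B := by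
      refine le_trans ?_ hB
      gcongr
      exact hj
    rw [Finset.sum_range_succ] at hle
    refine (hbody j hj τ hτ h.1 h.2.2 (by rw [h.2.1]; omega)).mono le_rfl fun τ' _ h' => ?_
    refine ⟨h'.2.1, (h'.2.2 1 hK1).trans h1, by simp, ?_, fun r hr => ?_⟩
    · rw [Function.update_of_ne hacc, h'.1, h.2.1, Finset.sum_range_succ]; omega
    · rw [Function.update_of_ne (hKne r hr)]; exact h'.2.2 r hr

/-- Replace the content of `r` by `0` unless the vertex in `x` is adjacent to all vertices in the
registers `l`. -/
def Cmd.checks (x tmp r : ℕ) : List ℕ → Cmd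
  -- There is no empty command; writing to the scratch register stands in for it.
  | [] => .op tmp (.const 0)
  | a :: l => .seq (.op tmp (.adjacent x a)) (.seq (.op r (.mul r tmp)) (checks x tmp r l))

open scoped Classical in
lemma Runs.checks {x tmp r : ℕ} (hxt : x ≠ tmp) (hxr : x ≠ r) (htr : tmp ≠ r) {ι : Type*}
    (l : List ι) (env : ι → ℕ) (hl : ∀ a ∈ l, env a ≠ tmp ∧ env a ≠ r) (hσ : ∀ r, σ r ≤ B)
    (hB : 1 ≤ B) {u : Fin n} (hu : σ x = u) {φ : ι → Fin n} (hφ : ∀ a ∈ l, σ (env a) = φ a) :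
    Runs L B (Cmd.checks x tmp r (l.map env)) σ (2 * l.length + 1) fun τ =>
      τ r = (if ∀ a ∈ l, G.Adj u (φ a) then 1 else 0) * σ r ∧
        ∀ j, j ≠ tmp → j ≠ r → τ j = σ j := by
  induction l generalizing σ with
  | nil =>
    refine Runs.op hσ (Nat.zero_le _) ⟨?_, fun j hj _ => Function.update_of_ne hj _ _⟩
    simp [Function.update_of_ne htr.symm]
  | cons a l ih =>
    simp only [List.mem_cons, forall_eq_or_imp] at hl hφ
    have hv : (Op.adjacent x (env a)).value L σ = if G.Adj u (φ a) then 1 else 0 := by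
      rw [Op.value, hu, hφ.1, L.matrixEntry_val]
    have hv1 : (Op.adjacent x (env a)).value L σ ≤ 1 := by rw [hv]; split_ifs <;> simp
    rw [List.map_cons, Cmd.checks]
    refine (Runs.seq (T₁ := 1) (T₂ := 1 + (2 * l.length + 1))
      (Q₁ := fun τ => τ = Function.update σ tmp ((Op.adjacent x (env a)).value L σ))
      (Runs.op hσ (hv1.trans hB) rfl) ?_).mono
      (by simp only [List.length_cons]; omega) fun _ _ h => h
    rintro τ hτ rfl
    set τ := Function.update σ tmp ((Op.adjacent x (env a)).value L σ) with hτdef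
    have hval : (Op.mul r tmp).value L τ = (if G.Adj u (φ a) then 1 else 0) * σ r := by
      rw [Op.value, hτdef, Function.update_self, Function.update_of_ne htr.symm, hv, mul_comm]
    have hother : ∀ j, j ≠ tmp → j ≠ r → Function.update τ r ((Op.mul r tmp).value L τ) j = σ j :=
      fun j h1 h2 => by rw [Function.update_of_ne h2, hτdef, Function.update_of_ne h1]
    have hvB : (Op.mul r tmp).value L τ ≤ B := by
      rw [hval]
      refine le_trans ?_ (hσ r)
      split_ifs <;> simp
    refine Runs.seq (Q₁ := fun τ' => τ' = Function.update τ r ((Op.mul r tmp).value L τ))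
      (Runs.op hτ hvB rfl) ?_
    rintro τ' hτ' rfl
    refine (ih hl.2 hτ' ?_ ?_).mono le_rfl ?_
    · rw [hother x hxt hxr, hu]
    · exact fun b hb => by rw [hother _ (hl.2 b hb).1 (hl.2 b hb).2, hφ.2 b hb]
    · rintro τ'' - ⟨h1, h2⟩
      refine ⟨?_, fun j hj hj' => (h2 j hj hj').trans (hother j hj hj')⟩
      rw [h1, Function.update_self, hval]
      simp only [List.mem_cons, forall_eq_or_imp, ite_and]
      split_ifs <;> simp

variable {α : Type*} [Fintype α] [DecidableEq α] {H : SimpleGraph α}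

/-- The registers that hold the images of the neighbours of `u` in `A`. -/
noncomputable def nbrRegs (H : SimpleGraph α) [DecidableRel H.Adj] (A : Finset α) (u : α) :
    List α := (A.filter (H.Adj u)).toList

lemma Runs.indicator [DecidableRel H.Adj] {x tmp r : ℕ} (hxt : x ≠ tmp) (hxr : x ≠ r)
    (htr : tmp ≠ r) (A : Finset α) (u : α) (env : α → ℕ)
    (henv : ∀ a ∈ A, env a ≠ tmp ∧ env a ≠ r) (hσ : ∀ r, σ r ≤ B) (hB : 1 ≤ B) {v : Fin n}
    (hv : σ x = v) {φ : α → Fin n} (hφ : ∀ a ∈ A, σ (env a) = φ a) :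
    Runs L B (Cmd.checks x tmp r ((nbrRegs H A u).map env)) σ (2 * Fintype.card α + 1) fun τ =>
      τ r = H.indicator G A φ u v * σ r ∧ ∀ j, j ≠ tmp → j ≠ r → τ j = σ j := by
  have hA : ∀ a ∈ nbrRegs H A u, a ∈ A := fun a ha =>
    (Finset.mem_filter.1 (Finset.mem_toList.1 ha)).1
  refine (Runs.checks hxt hxr htr (nbrRegs H A u) env (fun a ha => henv a (hA a ha)) hσ hB hv
    (fun a ha => hφ a (hA a ha))).mono ?_ ?_
  · have : (nbrRegs H A u).length ≤ Fintype.card α := by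
      rw [nbrRegs, Finset.length_toList]
      exact Finset.card_le_univ _
    omega
  · rintro τ - ⟨h1, h2⟩
    refine ⟨?_, h2⟩
    rw [h1, SimpleGraph.indicator]
    congr 2
    simp [nbrRegs]

end RAM

/-! ### From elimination plans to counting commands. -/

namespace RAM

open SimpleGraph

variable {α : Type*} [Fintype α] [DecidableEq α]

/-- The command `c` computes the number of extensions to `U` of a map that is given on `A`, in time
`K * n ^ k` on graphs with at most `D * n / 2` edges. The images of the vertices `a ∈ A` are
in the registers `env a`, the result is in register `b`, and smaller registers keep their values. -/
def CountsExtensions (H : SimpleGraph α) (D k : ℕ) (A U : Finset α) (env : α → ℕ) (b : ℕ) (c : Cmd)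
    (K : ℕ) : Prop :=
  ∀ (n : ℕ) (G : SimpleGraph (Fin n)) (L : G.AdjLists), 1 ≤ n →
    ∑ x, (L.nbrs x).length ≤ D * n → ∀ B, n ^ Fintype.card α + n + 2 ≤ B →
    ∀ σ : ℕ → ℕ, (∀ r, σ r ≤ B) → σ 0 = 0 → σ 1 = 1 →
    ∀ φ : α → Fin n, (∀ a ∈ A, σ (env a) = φ a) →
      Runs L B c σ (K * n ^ k)
        fun τ => τ b = (H.extensions G A U φ).card ∧ ∀ j < b, τ j = σ j

variable {H : SimpleGraph α} [DecidableRel H.Adj] {D k : ℕ} {A U : Finset α} {env : α → ℕ} {b : ℕ}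

namespace CountsExtensions

lemma empty : CountsExtensions H D k A ∅ env b (.op b (.const 1)) 1 := by
  intro n G L hn _ B hB σ hσ _ _ φ _
  refine (Runs.op hσ (by simp only [Op.value]; omega) ?_).mono ?_ fun _ _ h => h
  · refine ⟨by simp [Op.value, card_extensions_empty], fun j hj => ?_⟩
    rw [Function.update_of_ne hj.ne]
  · rw [one_mul]; exact Nat.one_le_pow _ _ hn

lemma union {S T : Finset α} (hST : Disjoint S T) (h : ∀ a ∈ S, ∀ b ∈ T, ¬ H.Adj a b)
    (henv : ∀ a ∈ A, env a < b) (hb : 2 ≤ b) {c₁ c₂ : Cmd} {K₁ K₂ : ℕ}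
    (h₁ : CountsExtensions H D k A S env b c₁ K₁)
    (h₂ : CountsExtensions H D k A T env (b + 1) c₂ K₂) :
    CountsExtensions H D k A (S ∪ T) env b (.seq c₁ (.seq c₂ (.op b (.mul b (b + 1)))))
      (K₁ + K₂ + 1) := by
  intro n G L hn hD B hB σ hσ h0 h1 φ hφ
  refine (Runs.seq (h₁ n G L hn hD B hB σ hσ h0 h1 φ hφ) (T₂ := K₂ * n ^ k + 1)
    fun τ hτ hτQ => Runs.seq (h₂ n G L hn hD B hB τ hτ ?_ ?_ φ ?_)
      fun τ' hτ' hτQ' => Runs.op hτ' ?_ ?_).mono ?_ fun _ _ h => h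
  · rw [hτQ.2 0 (by omega), h0]
  · rw [hτQ.2 1 (by omega), h1]
  · intro a ha
    rw [hτQ.2 _ (henv a ha), hφ a ha]
  · rw [Op.value, hτQ'.2 b (by omega), hτQ.1, hτQ'.1, ← card_extensions_union hST h]
    exact card_extensions_le.trans (by omega)
  · refine ⟨?_, fun j hj => ?_⟩
    · rw [Function.update_self, Op.value, hτQ'.2 b (by omega), hτQ.1, hτQ'.1,
        card_extensions_union hST h]
    · rw [Function.update_of_ne hj.ne, hτQ'.2 j (by omega), hτQ.2 j hj]
  · have := Nat.one_le_pow k n hn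
    ring_nf
    omega

/-- Register `b` holds the sum, `b + 1` the image of `u`, `b + 2` the number `n`, `b + 3` is
scratch, and `b + 4` receives the inner count. The inner count is computed for every image and then
multiplied by the indicator, so no branching is needed. -/
lemma vertex (hAU : Disjoint A U) (henv : ∀ a ∈ A, env a < b) (hb : 2 ≤ b) {u : α} (hu : u ∈ U)
    {c : Cmd} {K : ℕ} (h : CountsExtensions H D k (insert u A) (U.erase u)
      (Function.update env u (b + 1)) (b + 4) c K) :
    CountsExtensions H D (k + 1) A U env b
      (.seq (.op b (.const 0)) (.seq (.op (b + 2) .order) (.loop (b + 1) (b + 2)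
        (.seq c (.seq (.checks (b + 1) (b + 3) (b + 4) ((nbrRegs H A u).map env))
          (.op b (.add b (b + 4))))))))
      (K + 2 * Fintype.card α + 9) := by
  intro n G L hn hD B hB σ hσ h0 h1 φ hφ
  have huA : u ∉ A := fun h => Finset.disjoint_left.1 hAU h hu
  set cnt : Fin n → ℕ := fun x => H.indicator G A φ u x *
    (H.extensions G (insert u A) (U.erase u) (Function.update φ u x)).card with hcnt
  set g : ℕ → ℕ := fun j => if hj : j < n then cnt ⟨j, hj⟩ else 0 with hg
  have hsum : ∑ j ∈ Finset.range n, g j = (H.extensions G A U φ).card := by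
    rw [card_extensions_vertex hAU hu, Finset.sum_range]
    exact Finset.sum_congr rfl fun x _ => by simp [hg, hcnt]
  have hle : (H.extensions G A U φ).card ≤ n ^ Fintype.card α := card_extensions_le
  refine (Runs.seq (T₁ := 1) (Q₁ := fun τ => τ = Function.update σ b 0)
    (T₂ := 1 + (∑ j ∈ Finset.range n, (K * n ^ k + (2 * Fintype.card α + 1 + 1) + 2) + 3))
    (Runs.op hσ (Nat.zero_le _) rfl) ?_).mono ?_ fun _ _ h => h
  swap
  · rw [Finset.sum_const, Finset.card_range, smul_eq_mul, pow_succ]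
    have := Nat.one_le_pow k n hn
    have h2 : n ≤ n ^ k * n := Nat.le_mul_of_pos_left n this
    ring_nf at h2 ⊢
    nlinarith
  rintro τ hτ rfl
  refine Runs.seq (Q₁ := fun τ => τ = Function.update (Function.update σ b 0) (b + 2) n)
    (Runs.op hτ (by rw [Op.value]; omega) rfl) ?_
  rintro τ hτ' rfl
  set ρ := Function.update (Function.update σ b 0) (b + 2) n with hρ
  have hρσ : ∀ j < b, ρ j = σ j := fun j hj => by
    rw [hρ, Function.update_of_ne (by omega), Function.update_of_ne (by omega)]
  have hρb : ρ b = 0 := by rw [hρ, Function.update_of_ne (by omega), Function.update_self]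
  refine (Runs.sum_loop (acc := b) (N := n) g (fun _ => K * n ^ k + (2 * Fintype.card α + 1 + 1))
    (fun r => r < b ∨ r = b + 2) hτ' (by rw [hρσ 0 (by omega), h0])
    (by rw [hρσ 1 (by omega), h1]) (by omega) (by simp [hρ]) (by omega) (.inl (by omega))
    (.inr rfl) (by omega) (by rw [hsum, hρb]; omega) ?_).mono le_rfl ?_
  · intro j hj τ hτ hτj hτK hτB
    have hτσ : ∀ r < b, τ r = σ r := fun r hr => (hτK r (.inl hr)).trans (hρσ r hr)
    have hgj : g j = cnt ⟨j, hj⟩ := dif_pos hj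
    refine Runs.seq (h n G L hn hD B hB τ hτ (by rw [hτσ 0 (by omega), h0])
      (by rw [hτσ 1 (by omega), h1]) (Function.update φ u ⟨j, hj⟩) ?_) fun τ₁ hτ₁ hQ₁ => ?_
    · intro a ha
      rcases Finset.mem_insert.1 ha with rfl | ha
      · simp [hτj]
      · have hau : a ≠ u := fun e => huA (e ▸ ha)
        rw [Function.update_of_ne hau, Function.update_of_ne hau, hτσ _ (henv a ha), hφ a ha]
    have hτ₁σ : ∀ r < b, τ₁ r = σ r := fun r hr => (hQ₁.2 r (by omega)).trans (hτσ r hr)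
    refine Runs.seq (Runs.indicator (by omega) (by omega) (by omega) A u env
      (fun a ha => by have := henv a ha; omega) hτ₁ (by omega) (v := ⟨j, hj⟩)
      (by rw [hQ₁.2 _ (by omega), hτj]) (φ := φ)
      fun a ha => by rw [hτ₁σ _ (henv a ha), hφ a ha]) fun τ₂ hτ₂ hQ₂ => ?_
    have hval : (Op.add b (b + 4)).value L τ₂ = τ b + g j := by
      rw [Op.value, hQ₂.2 b (by omega) (by omega), hQ₁.2 b (by omega), hQ₂.1, hQ₁.1, hgj]
    refine Runs.op hτ₂ (hval ▸ hτB) ⟨by rw [Function.update_self, hval], ?_, fun r hr => ?_⟩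
    · rw [Function.update_of_ne (by omega), hQ₂.2 _ (by omega) (by omega), hQ₁.2 _ (by omega), hτj]
    · rw [Function.update_of_ne (by omega), hQ₂.2 _ (by omega) (by omega), hQ₁.2 _ (by omega),
        hτK r hr]
  · rintro τ - ⟨h2, h3⟩
    exact ⟨by rw [h2, hsum, hρb, zero_add], fun j hj => (h3 j (.inl hj)).trans (hρσ j hj)⟩

/-- As for a vertex, with a second loop: `b + 3` is a position in the adjacency list, `b + 4` the
degree, `b + 5` the image of `v`. The inner loops have at most `D * n` rounds altogether, so two
pattern vertices cost a single factor `n`. -/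
lemma edge (hAU : Disjoint A U) (henv : ∀ a ∈ A, env a < b) (hb : 2 ≤ b) {u v : α} (hu : u ∈ U)
    (hv : v ∈ U) (huv : H.Adj u v) {c : Cmd} {K : ℕ}
    (h : CountsExtensions H D k (insert v (insert u A)) ((U.erase u).erase v)
      (Function.update (Function.update env u (b + 1)) v (b + 5)) (b + 7) c K) :
    CountsExtensions H D (k + 1) A U env b
      (.seq (.op b (.const 0)) (.seq (.op (b + 2) .order) (.loop (b + 1) (b + 2)
        (.seq (.op (b + 4) (.degree (b + 1))) (.loop (b + 3) (b + 4)
          (.seq (.op (b + 5) (.neighbor (b + 1) (b + 3))) (.seq c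
            (.seq (.checks (b + 5) (b + 6) (b + 7) ((nbrRegs H A v).map env))
              (.seq (.checks (b + 1) (b + 6) (b + 7) ((nbrRegs H A u).map env))
                (.op b (.add b (b + 7))))))))))))
      (D * (K + 4 * Fintype.card α + 6) + 11) := by
  intro n G L hn hD B hB σ hσ h0 h1 φ hφ
  have huA : u ∉ A := fun h => Finset.disjoint_left.1 hAU h hu
  have hvA : v ∉ A := fun h => Finset.disjoint_left.1 hAU h hv
  set cnt : Fin n → Fin n → ℕ := fun x y => H.indicator G A φ u x * (H.indicator G A φ v y *
    (H.extensions G (insert v (insert u A)) ((U.erase u).erase v)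
      (Function.update (Function.update φ u x) v y)).card) with hcnt
  set g : Fin n → ℕ → ℕ := fun x j =>
    if hj : j < (L.nbrs x).length then cnt x (L.nbrs x)[j] else 0 with hg
  set g' : ℕ → ℕ := fun j =>
    if hj : j < n then ∑ i ∈ Finset.range (L.degree j), g ⟨j, hj⟩ i else 0 with hg'
  have hsum' : ∀ x, ((L.nbrs x).map (cnt x)).sum = ∑ i ∈ Finset.range (L.degree x), g x i := by
    intro x
    rw [L.degree_val, Finset.sum_range, ← List.sum_ofFn]
    congr 1
    refine List.ext_getElem (by simp) fun i h1 h2 => ?_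
    simp only [List.length_map] at h1
    simp [hg]
  have hsum : ∑ j ∈ Finset.range n, g' j = (H.extensions G A U φ).card := by
    rw [card_extensions_edge hAU hu hv huv L, Finset.sum_range]
    refine Finset.sum_congr rfl fun x _ => ?_
    rw [hsum' x]
    simp [hg']
  have hle : (H.extensions G A U φ).card ≤ n ^ Fintype.card α := card_extensions_le
  set M := K * n ^ k + 4 * Fintype.card α + 4 with hM
  have hdegsum : ∑ j ∈ Finset.range n, L.degree j = ∑ x, (L.nbrs x).length := by
    rw [Finset.sum_range]
    exact Finset.sum_congr rfl fun x _ => L.degree_val x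
  refine (Runs.seq (T₁ := 1) (Q₁ := fun τ => τ = Function.update σ b 0)
    (T₂ := 1 + (∑ j ∈ Finset.range n,
      (1 + (∑ i ∈ Finset.range (L.degree j), (M + 2) + 3) + 2) + 3))
    (Runs.op hσ (Nat.zero_le _) rfl) ?_).mono ?_ fun _ _ h => h
  swap
  · simp only [Finset.sum_add_distrib, Finset.sum_const, Finset.card_range, smul_eq_mul]
    rw [← Finset.sum_mul, ← Finset.sum_mul, hdegsum, pow_succ]
    have h1 := Nat.one_le_pow k n hn
    have h2 : n ≤ n ^ k * n := Nat.le_mul_of_pos_left n h1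
    have h3 : (∑ x, (L.nbrs x).length) * (M + 2) ≤
        D * (K + 4 * Fintype.card α + 6) * (n ^ k * n) := by
      calc _ ≤ (D * n) * ((K + 4 * Fintype.card α + 6) * n ^ k) := by
            gcongr
            rw [hM]
            nlinarith
        _ = _ := by ring
    nlinarith
  rintro τ hτ rfl
  refine Runs.seq (Q₁ := fun τ => τ = Function.update (Function.update σ b 0) (b + 2) n)
    (Runs.op hτ (by rw [Op.value]; omega) rfl) ?_
  rintro τ hτ' rfl
  set ρ := Function.update (Function.update σ b 0) (b + 2) n with hρ
  have hρσ : ∀ j < b, ρ j = σ j := fun j hj => by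
    rw [hρ, Function.update_of_ne (by omega), Function.update_of_ne (by omega)]
  have hρb : ρ b = 0 := by rw [hρ, Function.update_of_ne (by omega), Function.update_self]
  refine (Runs.sum_loop (acc := b) (N := n) g'
    (fun j => 1 + (∑ i ∈ Finset.range (L.degree j), (M + 2) + 3))
    (fun r => r < b ∨ r = b + 2) hτ' (by rw [hρσ 0 (by omega), h0])
    (by rw [hρσ 1 (by omega), h1]) (by omega) (by simp [hρ]) (by omega) (.inl (by omega))
    (.inr rfl) (by omega) (by rw [hsum, hρb]; omega) ?_).mono le_rfl ?_
  swap
  · rintro τ - ⟨h2, h3⟩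
    exact ⟨by rw [h2, hsum, hρb, zero_add], fun j hj => (h3 j (.inl hj)).trans (hρσ j hj)⟩
  intro j hj τ hτ hτj hτK hτB
  have hτσ : ∀ r < b, τ r = σ r := fun r hr => (hτK r (.inl hr)).trans (hρσ r hr)
  have hgj : g' j = ∑ i ∈ Finset.range (L.degree j), g ⟨j, hj⟩ i := dif_pos hj
  set x : Fin n := ⟨j, hj⟩ with hx
  have hdegle : L.degree j ≤ B := by
    have : L.degree j = (L.nbrs x).length := L.degree_val x
    rw [this]
    have := (L.nodup x).length_le_card
    rw [Fintype.card_fin] at this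
    omega
  refine Runs.seq (Q₁ := fun τ' => τ' = Function.update τ (b + 4) (L.degree j))
    (Runs.op hτ (by rw [Op.value, hτj]; exact hdegle) (by rw [Op.value, hτj])) ?_
  rintro τ₀ hτ₀ rfl
  set τ₀ := Function.update τ (b + 4) (L.degree j) with hτ₀def
  have hτ₀τ : ∀ r, r ≠ b + 4 → τ₀ r = τ r := fun r hr => Function.update_of_ne hr _ _
  refine (Runs.sum_loop (acc := b) (i := b + 3) (m := b + 4) (N := L.degree j) (g x) (fun _ => M)
    (fun r => r < b ∨ r = b + 1 ∨ r = b + 2 ∨ r = b + 4) hτ₀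
    (by rw [hτ₀τ _ (by omega), hτσ 0 (by omega), h0])
    (by rw [hτ₀τ _ (by omega), hτσ 1 (by omega), h1]) (by omega) (by simp [hτ₀def])
    (by omega) (.inl (by omega)) (by omega) (by omega)
    (by rw [hτ₀τ _ (by omega), ← hgj]; exact hτB) ?_).mono le_rfl ?_
  swap
  · rintro τ' - ⟨h2, h3⟩
    refine ⟨by rw [h2, hτ₀τ _ (by omega), hgj], ?_, fun r hr => ?_⟩
    · rw [h3 _ (by omega), hτ₀τ _ (by omega), hτj]
    · rw [h3 r (by omega), hτ₀τ _ (by omega), hτK r hr]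
  intro i hi' τ₁ hτ₁ hτ₁i hτ₁K hτ₁B
  have hi : i < (L.nbrs x).length := by
    have : L.degree j = (L.nbrs x).length := L.degree_val x
    omega
  set y := (L.nbrs x)[i] with hy
  have hτ₁σ : ∀ r < b, τ₁ r = σ r := fun r hr => by
    rw [hτ₁K r (.inl hr), hτ₀τ _ (by omega), hτσ r hr]
  have hτ₁x : τ₁ (b + 1) = j := by rw [hτ₁K _ (by omega), hτ₀τ _ (by omega), hτj]
  have hnb : (Op.neighbor (b + 1) (b + 3)).value L τ₁ = y := by
    rw [Op.value, hτ₁x, hτ₁i]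
    exact L.neighbor_val x hi
  have hgi : g x i = cnt x y := dif_pos hi
  refine (Runs.seq (T₁ := 1) (T₂ := K * n ^ k + ((2 * Fintype.card α + 1) +
      ((2 * Fintype.card α + 1) + 1))) (Q₁ := fun τ' => τ' = Function.update τ₁ (b + 5) y)
    (Runs.op hτ₁ (by rw [hnb]; have := y.2; omega) (by rw [hnb])) ?_).mono (by omega)
    fun _ _ h => h
  rintro τ₂ hτ₂ rfl
  set τ₂ := Function.update τ₁ (b + 5) (y : ℕ) with hτ₂def
  have hτ₂τ : ∀ r, r ≠ b + 5 → τ₂ r = τ₁ r := fun r hr => Function.update_of_ne hr _ _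
  have hτ₂y : τ₂ (b + 5) = y := Function.update_self _ _ _
  have hτ₂σ : ∀ r < b, τ₂ r = σ r := fun r hr => by rw [hτ₂τ _ (by omega), hτ₁σ r hr]
  refine Runs.seq (h n G L hn hD B hB τ₂ hτ₂ (by rw [hτ₂σ 0 (by omega), h0])
    (by rw [hτ₂σ 1 (by omega), h1]) (Function.update (Function.update φ u x) v y) ?_)
    fun τ₃ hτ₃ hQ₃ => ?_
  · intro a ha
    by_cases hav : a = v
    · subst hav
      simp [hτ₂y]
    rw [Function.update_of_ne hav, Function.update_of_ne hav]
    by_cases hau : a = u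
    · subst hau
      rw [Function.update_self, Function.update_self, hτ₂τ _ (by omega), hτ₁x]
    · have haA : a ∈ A := by simpa [hav, hau] using ha
      rw [Function.update_of_ne hau, Function.update_of_ne hau, hτ₂σ _ (henv a haA), hφ a haA]
  have hτ₃σ : ∀ r < b, τ₃ r = σ r := fun r hr => by rw [hQ₃.2 r (by omega), hτ₂σ r hr]
  refine Runs.seq (Runs.indicator (x := b + 5) (tmp := b + 6) (r := b + 7) (by omega) (by omega)
    (by omega) A v env (fun a ha => by have := henv a ha; omega) hτ₃ (by omega) (v := y)
    (by rw [hQ₃.2 _ (by omega), hτ₂y]) (φ := φ)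
    fun a ha => by rw [hτ₃σ _ (henv a ha), hφ a ha]) fun τ₄ hτ₄ hQ₄ => ?_
  refine Runs.seq (Runs.indicator (x := b + 1) (tmp := b + 6) (r := b + 7) (by omega) (by omega)
    (by omega) A u env (fun a ha => by have := henv a ha; omega) hτ₄ (by omega) (v := x)
    (by rw [hQ₄.2 _ (by omega) (by omega), hQ₃.2 _ (by omega), hτ₂τ _ (by omega), hτ₁x]) (φ := φ)
    fun a ha => by
      have := henv a ha
      rw [hQ₄.2 _ (by omega) (by omega), hτ₃σ _ this, hφ a ha]) fun τ₅ hτ₅ hQ₅ => ?_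
  have hτ₅τ : ∀ r < b + 5, τ₅ r = τ₁ r := fun r hr => by
    rw [hQ₅.2 r (by omega) (by omega), hQ₄.2 r (by omega) (by omega), hQ₃.2 r (by omega),
      hτ₂τ _ (by omega)]
  have hval : (Op.add b (b + 7)).value L τ₅ = τ₁ b + g x i := by
    rw [Op.value, hτ₅τ b (by omega), hQ₅.1, hQ₄.1, hQ₃.1, hgi]
  refine Runs.op hτ₅ (hval ▸ hτ₁B) ⟨by rw [Function.update_self, hval], ?_, fun r hr => ?_⟩
  · rw [Function.update_of_ne (by omega), hτ₅τ _ (by omega), hτ₁i]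
  · rw [Function.update_of_ne (by omega), hτ₅τ r (by omega), hτ₁K r hr]

end CountsExtensions

/-- An elimination plan of depth `k` gives a counting command with running time `O(n ^ k)`. -/
theorem exists_countsExtensions (h : H.EdgeElim k U) (D : ℕ) (A : Finset α) (env : α → ℕ) (b : ℕ)
    (hAU : Disjoint A U) (henv : ∀ a ∈ A, env a < b) (hb : 2 ≤ b) :
    ∃ c K, CountsExtensions H D k A U env b c K := by
  induction h generalizing A env b with
  | empty k => exact ⟨_, _, .empty⟩
  | union hST hno _ _ ih1 ih2 =>
    obtain ⟨c₁, K₁, h₁⟩ := ih1 A env b (hAU.mono_right Finset.subset_union_left) henv hb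
    obtain ⟨c₂, K₂, h₂⟩ := ih2 A env (b + 1) (hAU.mono_right Finset.subset_union_right)
      (fun a ha => (henv a ha).trans (by omega)) (by omega)
    exact ⟨_, _, .union hST hno henv hb h₁ h₂⟩
  | @vertex k U u hu _ ih =>
    obtain ⟨c, K, h⟩ := ih (insert u A) (Function.update env u (b + 1)) (b + 4)
      (by
        rw [Finset.disjoint_insert_left]
        exact ⟨by simp, hAU.mono_right (Finset.erase_subset _ _)⟩)
      (fun a ha => by
        by_cases hau : a = u
        · subst hau; simp
        · rw [Function.update_of_ne hau]
          have := henv a (by simpa [hau] using ha)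
          omega) (by omega)
    exact ⟨_, _, .vertex hAU henv hb hu h⟩
  | @edge k U u v hu hv huv _ ih =>
    obtain ⟨c, K, h⟩ := ih (insert v (insert u A))
      (Function.update (Function.update env u (b + 1)) v (b + 5)) (b + 7)
      (by
        rw [Finset.disjoint_insert_left, Finset.disjoint_insert_left]
        exact ⟨by simp, by simp, hAU.mono_right
          ((Finset.erase_subset _ _).trans (Finset.erase_subset _ _))⟩)
      (fun a ha => by
        by_cases hav : a = v
        · subst hav; simp
        · by_cases hau : a = u
          · subst hau; rw [Function.update_of_ne hav]; simp
          · rw [Function.update_of_ne hav, Function.update_of_ne hau]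
            have := henv a (by simpa [hav, hau] using ha)
            omega) (by omega)
    exact ⟨_, _, .edge hAU henv hb hu hv huv h⟩

end RAM

/-! ### Edges of degenerate hosts, quotients, and counting copies. -/

namespace SimpleGraph

section Degenerate

variable {V : Type*} [DecidableEq V] {G : SimpleGraph V} [DecidableRel G.Adj] {d : ℕ}

/-- Removing a vertex of degree at most `d` in the subgraph induced by `U` loses at most `d` edges.
-/
lemma IsDegenerate.volIn_le (h : G.IsDegenerate d) (U : Finset V) :
    G.volIn U ≤ 2 * d * U.card := by
  induction hm : U.card generalizing U with
  | zero => simp [Finset.card_eq_zero.1 hm, volIn]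
  | succ m ih =>
    obtain ⟨u, hu⟩ : U.Nonempty := Finset.card_pos.1 (by omega)
    obtain ⟨v, hv, hd⟩ := h ((⊤ : G.Subgraph).induce U) ⟨u, hu⟩
    replace hv : v ∈ U := hv
    have : G.degIn U v ≤ d := by
      refine le_trans (le_of_eq ?_) hd
      rw [degIn, ← Set.ncard_coe_finset]
      congr 1
      ext w
      simp [hv]
    have h1 := ih (U.erase v) (by rw [Finset.card_erase_of_mem hv, hm]; rfl)
    have h2 := volIn_erase_add (G := G) hv
    rw [mul_add, mul_one]
    omega

lemma volIn_univ [Fintype V] : G.volIn Finset.univ = 2 * G.edgeSet.ncard := by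
  classical
  rw [Set.ncard_eq_toFinset_card', ← edgeFinset, ← G.sum_degrees_eq_twice_card_edges]
  refine Finset.sum_congr rfl fun v _ => ?_
  rw [degIn, ← card_neighborFinset_eq_degree]
  congr 1
  ext w
  simp

end Degenerate

lemma AdjLists.sum_length_le {n d : ℕ} {G : SimpleGraph (Fin n)} (L : G.AdjLists)
    (h : G.IsDegenerate d) : ∑ x, (L.nbrs x).length ≤ 2 * d * n := by
  classical
  refine le_trans (le_of_eq ?_) ((h.volIn_le Finset.univ).trans (by simp))
  refine Finset.sum_congr rfl fun v _ => ?_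
  rw [degIn, ← List.toFinset_card_of_nodup (L.nodup v)]
  congr 1
  ext w
  simp [L.mem_iff]

lemma card_extensions_univ {α : Type*} [Fintype α] [DecidableEq α] {n : ℕ} {H : SimpleGraph α}
    {G : SimpleGraph (Fin n)} {φ : α → Fin n} :
    (H.extensions G ∅ Finset.univ φ).card = Nat.card (H →g G) := by
  rw [← Nat.card_eq_finsetCard, Nat.card_congr]
  exact {
    toFun := fun ψ => ⟨ψ.1, fun {a b} hab =>
      (mem_extensions.1 ψ.2).2 a (Finset.mem_univ _) b (.inl (Finset.mem_univ _)) hab⟩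
    invFun := fun f => ⟨f, mem_extensions.2
      ⟨fun a ha => absurd (Finset.mem_univ a) ha, fun a _ b _ hab => f.map_adj hab⟩⟩
    left_inv := fun _ => rfl
    right_inv := fun _ => rfl }

section Quotient

variable {α β : Type*} (H : SimpleGraph α) (r : Setoid α)

/-- The graph obtained by identifying equivalent vertices; loops are dropped. -/
def quotientGraph : SimpleGraph (Quotient r) where
  Adj x y := x ≠ y ∧ ∃ a b, ⟦a⟧ = x ∧ ⟦b⟧ = y ∧ H.Adj a b
  symm := ⟨fun _ _ ⟨h, a, b, ha, hb, hab⟩ => ⟨h.symm, b, a, hb, ha, hab.symm⟩⟩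
  loopless := ⟨fun _ h => h.1 rfl⟩

lemma ncard_edgeSet_quotientGraph_le [Finite α] :
    (H.quotientGraph r).edgeSet.ncard ≤ H.edgeSet.ncard := by
  refine (Set.ncard_le_ncard ?_ (Set.toFinite _)).trans
    (Set.ncard_image_le (f := Sym2.map (Quotient.mk r)) (Set.toFinite H.edgeSet))
  intro e
  induction e with
  | h x y =>
    rintro ⟨-, a, b, rfl, rfl, hab⟩
    exact ⟨s(a, b), hab, rfl⟩

variable {H r}

/-- Homomorphisms that are constant on classes are homomorphisms of the quotient graph. -/
def homQuotientEquiv (G : SimpleGraph β) (h : ∀ a b, H.Adj a b → ¬ r a b) :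
    {φ : H →g G // ∀ a b, r a b → φ a = φ b} ≃ (H.quotientGraph r →g G) where
  toFun φ := ⟨Quotient.lift φ.1 φ.2, by
    rintro _ _ ⟨-, a, b, rfl, rfl, hab⟩
    exact φ.1.map_adj hab⟩
  invFun f := ⟨⟨fun a => f ⟦a⟧, fun {a b} hab =>
    f.map_adj ⟨fun e => h a b hab (Quotient.exact e), a, b, rfl, rfl, hab⟩⟩,
    fun a b hab => congrArg f (Quotient.sound hab)⟩
  left_inv _ := rfl
  right_inv f := by
    ext x
    induction x using Quotient.inductionOn
    rfl

end Quotient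

section InclusionExclusion

variable {α β : Type*} (H : SimpleGraph α) (G : SimpleGraph β)

/-- The number of homomorphisms that identify the two members of each pair in `S`. -/
noncomputable def homIdentifying (S : Finset (α × α)) : ℕ :=
  Nat.card {φ : H →g G // ∀ p ∈ S, φ p.1 = φ p.2}

variable {H G}

/-- The kernel of a map is an equivalence relation, so it contains the pairs in `S` exactly if it
contains the relation they generate. -/
lemma homIdentifying_eq (S : Finset (α × α)) :
    H.homIdentifying G S = Nat.card {φ : H →g G //
      ∀ a b, Relation.EqvGen.setoid (fun a b => (a, b) ∈ S) a b → φ a = φ b} := by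
  refine Nat.card_congr (Equiv.subtypeEquivRight fun φ => ⟨fun h a b hab => ?_, fun h p hp => ?_⟩)
  · have : Relation.EqvGen.setoid (fun a b => (a, b) ∈ S) ≤ Setoid.ker φ :=
      Setoid.eqvGen_le fun a b hab => h (a, b) hab
    exact this hab
  · exact h p.1 p.2 (Relation.EqvGen.rel _ _ hp)

variable [Fintype α] [DecidableEq α] [Finite β]

lemma homIdentifying_le (S : Finset (α × α)) :
    H.homIdentifying G S ≤ Nat.card β ^ Fintype.card α := by
  have : Finite (H →g G) := Finite.of_injective _ DFunLike.coe_injective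
  refine (Finite.card_subtype_le _).trans ((Nat.card_le_card_of_injective
    (fun φ : H →g G => (φ : α → β)) DFunLike.coe_injective).trans ?_)
  simp [Nat.card_fun]

/-- Counting injective homomorphisms by inclusion–exclusion. -/
lemma card_copy_add_sum :
    Nat.card (Copy H G) + ∑ S ∈ (Finset.univ : Finset α).offDiag.powerset.filter (Odd ·.card),
        H.homIdentifying G S =
      ∑ S ∈ (Finset.univ : Finset α).offDiag.powerset.filter (¬ Odd ·.card),
        H.homIdentifying G S := by
  classical
  have : Finite (H →g G) := Finite.of_injective _ DFunLike.coe_injective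
  have := Fintype.ofFinite (H →g G)
  -- Both orders of a pair occur and give the same event; inclusion–exclusion tolerates repeated
  -- events.
  have key := Finset.inclusion_exclusion_card_inf_compl (Finset.univ : Finset α).offDiag
    fun p => (Finset.univ.filter fun φ : H →g G => φ p.1 = φ p.2)
  have e1 : ((Finset.univ : Finset α).offDiag.inf fun p =>
      (Finset.univ.filter fun φ : H →g G => φ p.1 = φ p.2)ᶜ).card = Nat.card (Copy H G) := by
    rw [← Nat.card_eq_finsetCard]
    refine Nat.card_congr ?_
    refine (Equiv.subtypeEquivRight (q := fun φ : H →g G => Function.Injective φ) fun φ => ?_).trans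
      ⟨fun φ => ⟨φ.1, φ.2⟩, fun f => ⟨f.1, f.2⟩, fun _ => rfl, fun _ => rfl⟩
    simp only [Finset.mem_inf, Finset.mem_offDiag, Finset.mem_univ, true_and, Finset.mem_compl,
      Finset.mem_filter, Prod.forall]
    exact ⟨fun h a b hab => by_contra fun hne => h a b hne hab, fun h a b hne hab => hne (h hab)⟩
  have e2 : ∀ S : Finset (α × α), (S.inf fun p =>
      (Finset.univ.filter fun φ : H →g G => φ p.1 = φ p.2)).card = H.homIdentifying G S := by
    intro S
    rw [← Nat.card_eq_finsetCard]
    refine Nat.card_congr (Equiv.subtypeEquivRight fun φ => ?_)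
    simp [Finset.mem_inf]
  rw [e1] at key
  simp only [e2] at key
  rw [← Finset.sum_filter_add_sum_filter_not _ (fun S : Finset (α × α) => Odd S.card)] at key
  rw [Finset.sum_congr rfl fun S hS => by rw [(Finset.mem_filter.1 hS).2.neg_one_pow],
    Finset.sum_congr (s₁ := Finset.filter (fun S : Finset (α × α) => ¬ Odd S.card) _) rfl
      fun S hS => by
        rw [(Nat.not_odd_iff_even.1 (Finset.mem_filter.1 hS).2).neg_one_pow]] at key
  simp only [neg_mul, one_mul, Finset.sum_neg_distrib] at key
  zify
  linarith

/-- Labelled and unlabelled copies differ by the number of automorphisms. -/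
lemma card_copy {β : Type*} [Fintype β] {G : SimpleGraph β} :
    Nat.card (Copy H G) = G.copyCount H * Nat.card (H ≃g H) := by
  classical
  have hfin : ∀ G' : G.Subgraph, Finite (H ≃g G'.coe) := fun G' =>
    Finite.of_injective (fun e : H ≃g G'.coe => (e : α → G'.verts)) DFunLike.coe_injective
  -- A labelled copy is its image subgraph together with an isomorphism from `H` onto it. Once one
  -- such isomorphism is fixed, the others correspond to automorphisms of `H`.
  have e : (Σ G' : {G' : G.Subgraph // Nonempty (H ≃g G'.coe)}, (H ≃g G'.1.coe)) ≃ Copy H G := by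
    refine Equiv.ofBijective (fun x => x.1.1.coeCopy.comp x.2.toCopy) ⟨?_, fun f => ?_⟩
    · have hsub : ∀ x : (Σ G' : {G' : G.Subgraph // Nonempty (H ≃g G'.coe)}, (H ≃g G'.1.coe)),
          (x.1.1.coeCopy.comp x.2.toCopy).toSubgraph = x.1.1 := by
        rintro ⟨⟨G', h⟩, e⟩
        change Subgraph.map (G'.hom.comp e.toHom) ⊤ = G'
        simp [Subgraph.map_comp]
      rintro ⟨⟨G₁, h₁⟩, e₁⟩ ⟨⟨G₂, h₂⟩, e₂⟩ h
      obtain rfl : G₁ = G₂ := by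
        exact (hsub ⟨⟨G₁, h₁⟩, e₁⟩).symm.trans ((congrArg _ h).trans (hsub ⟨⟨G₂, h₂⟩, e₂⟩))
      congr 1
      ext a
      exact DFunLike.congr_fun h a
    · refine ⟨⟨⟨f.toSubgraph, ⟨f.isoToSubgraph⟩⟩, f.isoToSubgraph⟩, ?_⟩
      ext a
      rfl
  rw [← Nat.card_congr e, Nat.card_sigma, Finset.sum_congr rfl fun G' _ => Nat.card_congr
    (β := H ≃g H) ?_, Finset.sum_const, smul_eq_mul]
  · unfold copyCount
    congr 1
    rw [Finset.card_univ, Fintype.card_subtype]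
  · exact {
      toFun := fun f => f.trans G'.2.some.symm
      invFun := fun g => g.trans G'.2.some
      left_inv := fun f => by ext a; simp
      right_inv := fun g => by ext a; simp }

end InclusionExclusion

end SimpleGraph

/-! ### Assembling the programs for `hom` and `sub`. -/

namespace RAM

open SimpleGraph

/-- On `d`-degenerate graphs with `n` vertices, the command `c` computes `F` in time `K * n ^ E`,
provided that numbers up to `W * n ^ k + n + 2` fit into a register. The result is in register `b`,
and smaller registers keep their values. -/
def ComputesWithin (d W k E b : ℕ) (F : ∀ n, SimpleGraph (Fin n) → ℕ) (c : Cmd) (K : ℕ) : Prop :=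
  ∀ (n : ℕ) (G : SimpleGraph (Fin n)) (L : G.AdjLists), 1 ≤ n → G.IsDegenerate d →
    ∀ B, W * n ^ k + n + 2 ≤ B → ∀ σ : ℕ → ℕ, (∀ r, σ r ≤ B) → σ 0 = 0 → σ 1 = 1 →
      Runs L B c σ (K * n ^ E) fun τ => τ b = F n G ∧ ∀ j < b, τ j = σ j

variable {d W k E b : ℕ} {F F₁ F₂ : ∀ n, SimpleGraph (Fin n) → ℕ}

namespace ComputesWithin

lemma const {x : ℕ} (hx : x ≤ W) : ComputesWithin d W k E b (fun _ _ => x) (.op b (.const x)) 1 := by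
  intro n G L hn _ B hB σ hσ _ _
  have h1 : W * 1 ≤ W * n ^ k := Nat.mul_le_mul le_rfl (Nat.one_le_pow _ _ hn)
  refine (Runs.op hσ (by simp only [Op.value]; omega) ?_).mono ?_ fun _ _ h => h
  · exact ⟨by simp [Op.value], fun j hj => Function.update_of_ne hj.ne _ _⟩
  · rw [one_mul]; exact Nat.one_le_pow _ _ hn

lemma binary {c₁ c₂ : Cmd} {K₁ K₂ : ℕ} (hb : 2 ≤ b) (h₁ : ComputesWithin d W k E b F₁ c₁ K₁)
    (h₂ : ComputesWithin d W k E (b + 1) F₂ c₂ K₂) (o : Op)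
    (ho : ∀ n (G : SimpleGraph (Fin n)) (L : G.AdjLists) (τ : ℕ → ℕ), 1 ≤ n → τ b = F₁ n G →
      τ (b + 1) = F₂ n G → o.value L τ = F n G)
    (hF : ∀ n (G : SimpleGraph (Fin n)), F n G ≤ W * n ^ k) :
    ComputesWithin d W k E b F (.seq c₁ (.seq c₂ (.op b o))) (K₁ + K₂ + 1) := by
  intro n G L hn hd B hB σ hσ h0 h1
  refine (Runs.seq (h₁ n G L hn hd B hB σ hσ h0 h1) (T₂ := K₂ * n ^ E + 1)
    fun τ hτ hτQ => Runs.seq (h₂ n G L hn hd B hB τ hτ ?_ ?_)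
      fun τ' hτ' hτQ' => Runs.op hτ' ?_ ?_).mono ?_ fun _ _ h => h
  · rw [hτQ.2 0 (by omega), h0]
  · rw [hτQ.2 1 (by omega), h1]
  · rw [ho n G L τ' hn ((hτQ'.2 b (by omega)).trans hτQ.1) hτQ'.1]
    exact (hF n G).trans (by omega)
  · refine ⟨?_, fun j hj => ?_⟩
    · rw [Function.update_self, ho n G L τ' hn ((hτQ'.2 b (by omega)).trans hτQ.1) hτQ'.1]
    · rw [Function.update_of_ne hj.ne, hτQ'.2 j (by omega), hτQ.2 j hj]
  · have := Nat.one_le_pow E n hn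
    ring_nf
    omega

end ComputesWithin

lemma exists_computesWithin_hom {β : Type*} [Finite β] (H : SimpleGraph β) (hk : Nat.card β ≤ k)
    (hE : H.edgeSet.ncard / 5 + 3 ≤ E) (hW : 1 ≤ W) (hb : 2 ≤ b) :
    ∃ c K, ComputesWithin d W k E b (fun _ G => Nat.card (H →g G)) c K := by
  classical
  have := Fintype.ofFinite β
  obtain ⟨c, K, h⟩ := exists_countsExtensions (EdgeElim.exists_plan (G := H) Finset.univ) (2 * d) ∅
    (fun _ => 0) b (by simp) (by simp) hb
  refine ⟨c, K, fun n G L hn hd B hB σ hσ h0 h1 => ?_⟩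
  refine (h n G L hn (L.sum_length_le hd) B ?_ σ hσ h0 h1 (fun _ => ⟨0, hn⟩) (by simp)).mono ?_
    fun τ _ hτ => ?_
  · refine le_trans ?_ hB
    gcongr
    rw [← Nat.card_eq_fintype_card]
    calc n ^ Nat.card β ≤ n ^ k := Nat.pow_le_pow_right hn hk
      _ ≤ W * n ^ k := Nat.le_mul_of_pos_left _ hW
  · gcongr
    -- The volume is `2 * ℓ`, so the depth of the plan is `2 * ℓ / 10 + 3 = ℓ / 5 + 3`.
    rw [volIn_univ]
    omega
  · rwa [card_extensions_univ] at hτ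

lemma exists_computesWithin_homIdentifying {α : Type*} [Finite α] (H : SimpleGraph α)
    (S : Finset (α × α)) (hk : Nat.card α ≤ k) (hE : H.edgeSet.ncard / 5 + 3 ≤ E) (hW : 1 ≤ W)
    (hb : 2 ≤ b) : ∃ c K, ComputesWithin d W k E b (fun _ G => H.homIdentifying G S) c K := by
  set r := Relation.EqvGen.setoid fun a b => (a, b) ∈ S
  by_cases h : ∀ a b, H.Adj a b → ¬ r a b
  · obtain ⟨c, K, hc⟩ := exists_computesWithin_hom (d := d) (W := W) (k := k) (E := E)
      (H.quotientGraph r) ((Nat.card_le_card_of_surjective (Quotient.mk r) Quotient.mk_surjective).trans hk)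
      (le_trans (by gcongr; exact ncard_edgeSet_quotientGraph_le H r) hE) hW hb
    refine ⟨c, K, ?_⟩
    convert hc using 3 with n G
    rw [homIdentifying_eq, Nat.card_congr (homQuotientEquiv G h)]
  -- If adjacent vertices are identified, there is no such homomorphism, since the host has no
  -- loops.
  · push Not at h
    obtain ⟨x, y, hxy, hr⟩ := h
    refine ⟨.op b (.const 0), 1, ?_⟩
    convert ComputesWithin.const (d := d) (k := k) (E := E) (b := b) (Nat.zero_le W) using 3 with n G
    rw [homIdentifying_eq, Nat.card_eq_zero]
    refine .inl ⟨fun φ => ?_⟩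
    have := φ.1.map_adj hxy
    rw [φ.2 x y hr] at this
    exact G.loopless.irrefl _ this

lemma exists_computesWithin_sum {ι : Type*} (s : Finset ι)
    (F : ι → ∀ n, SimpleGraph (Fin n) → ℕ) (hF : ∀ i n G, F i n G ≤ n ^ k) (hs : s.card ≤ W)
    (h : ∀ i ∈ s, ∀ b, 2 ≤ b → ∃ c K, ComputesWithin d W k E b (F i) c K) (hb : 2 ≤ b) :
    ∃ c K, ComputesWithin d W k E b (fun n G => ∑ i ∈ s, F i n G) c K := by
  classical
  induction s using Finset.induction_on generalizing b with
  | empty => exact ⟨_, _, by simpa using ComputesWithin.const (Nat.zero_le W)⟩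
  | insert i s hi ih =>
    obtain ⟨c₁, K₁, h₁⟩ := h i (Finset.mem_insert_self i s) b hb
    obtain ⟨c₂, K₂, h₂⟩ := ih ((Finset.card_le_card (Finset.subset_insert i s)).trans hs)
      (fun j hj => h j (Finset.mem_insert_of_mem hj)) (b := b + 1) (by omega)
    refine ⟨_, _, ComputesWithin.binary hb h₁ h₂ (.add b (b + 1)) ?_ ?_⟩
    · intro n G L τ _ e₁ e₂
      rw [Op.value, e₁, e₂, Finset.sum_insert hi]
    · intro n G
      calc ∑ j ∈ insert i s, F j n G ≤ (insert i s).card • n ^ k :=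
            Finset.sum_le_card_nsmul _ _ _ fun j _ => hF j n G
        _ ≤ W * n ^ k := by rw [smul_eq_mul]; gcongr

/-- The even and the odd part of inclusion–exclusion are summed separately. Their difference is
nonnegative, so truncated subtraction is exact, and so is the division by the number of
automorphisms. `W` is large enough for every partial sum and for that constant. -/
lemma exists_computesWithin_copyCount {α : Type*} [Fintype α] (H : SimpleGraph α)
    (hE : H.edgeSet.ncard / 5 + 3 ≤ E) (hb : 2 ≤ b) :
    ∃ W c K, ComputesWithin d W (Fintype.card α) E b (fun _ G => G.copyCount H) c K := by
  classical
  have hfin : Finite (H ≃g H) :=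
    Finite.of_injective (fun e : H ≃g H => (e : α → α)) DFunLike.coe_injective
  have hpos : 0 < Nat.card (H ≃g H) := Nat.card_pos_iff.2 ⟨⟨Iso.refl⟩, hfin⟩
  set P := (Finset.univ : Finset α).offDiag.powerset
  set W := P.card + Nat.card (H ≃g H)
  have hle : ∀ (S : Finset (α × α)) (n : ℕ) (G : SimpleGraph (Fin n)),
      H.homIdentifying G S ≤ n ^ Fintype.card α :=
    fun S n G => (homIdentifying_le S).trans (by simp)
  have hsum : ∀ (p : Finset (α × α) → Prop) [DecidablePred p] (b : ℕ), 2 ≤ b → ∃ c K,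
      ComputesWithin d W (Fintype.card α) E b
        (fun _ G => ∑ S ∈ P.filter p, H.homIdentifying G S) c K :=
    fun p _ b hb => exists_computesWithin_sum (P.filter p) (fun S _ G => H.homIdentifying G S) hle
      ((Finset.card_filter_le _ _).trans (by omega))
      (fun S _ b hb => exists_computesWithin_homIdentifying H S (by simp) hE (by omega) hb) hb
  obtain ⟨c₁, K₁, h₁⟩ := hsum (¬ Odd ·.card) b hb
  obtain ⟨c₂, K₂, h₂⟩ := hsum (Odd ·.card) (b + 1) (by omega)
  have hcopy : ∀ n (G : SimpleGraph (Fin n)), Nat.card (Copy H G) ≤ W * n ^ Fintype.card α := by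
    intro n G
    have := card_copy_add_sum (H := H) (G := G)
    calc Nat.card (Copy H G) ≤ _ := (Nat.le_add_right _ _).trans this.le
      _ ≤ (P.filter (¬ Odd ·.card)).card • n ^ Fintype.card α :=
        Finset.sum_le_card_nsmul _ _ _ fun S _ => hle S n G
      _ ≤ W * n ^ Fintype.card α := by
        rw [smul_eq_mul]
        gcongr
        exact (Finset.card_filter_le _ _).trans (by omega)
  have hinj := ComputesWithin.binary (F := fun _ G => Nat.card (Copy H G)) hb h₁ h₂
    (.sub b (b + 1)) (fun n G L τ _ e₁ e₂ => by
      rw [Op.value, e₁, e₂, ← card_copy_add_sum, Nat.add_sub_cancel]) hcopy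
  refine ⟨W, _, _, ComputesWithin.binary hb hinj
    (ComputesWithin.const (x := Nat.card (H ≃g H)) (by omega)) (.div b (b + 1)) ?_ ?_⟩
  · intro n G L τ _ e₁ e₂
    rw [Op.value, e₁, e₂, card_copy, Nat.mul_div_cancel _ hpos]
  · exact fun n G => le_trans (by rw [card_copy]; exact Nat.le_mul_of_pos_right _ hpos) (hcopy n G)

/-- The bound is stated for all `f` above a threshold, so that the thresholds of different patterns
and programs can be merged by a maximum. -/
lemma ComputesWithin.exists_program {c : Cmd} {K : ℕ} (h : ComputesWithin d W k E 2 F c K) :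
    ∃ N, ∀ f, N ≤ f → ∃ P : Program, P.numRegs ≤ f ∧
      ∀ (n : ℕ) (G : SimpleGraph (Fin n)) (L : G.AdjLists), 1 ≤ n → G.IsDegenerate d →
        P.Computes L (F n G) (f * n ^ E) ((n + 2) ^ f) := by
  -- Register `1` must hold `1` for the loops; register `0` is `0` from the start.
  set c' : Cmd := .seq (.op 1 (.const 1)) c with hc'
  set S := max c'.bound 2 with hS
  refine ⟨S + 1 + (W + k + 2) + (K + 1), fun f hf => ⟨⟨S + 1, c'.code S 0, toReg S 2⟩,
    show S + 1 ≤ f by omega, fun n G L hn hd => ?_⟩⟩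
  set B := (n + 2) ^ f with hBdef
  have hB : W * n ^ k + n + 2 ≤ B := by
    have e1 : W * n ^ k ≤ (n + 2) ^ (W + k + 1) := by
      calc W * n ^ k ≤ (n + 2) ^ W * (n + 2) ^ k := by
            gcongr
            · exact (Nat.lt_two_pow_self.le).trans (Nat.pow_le_pow_left (by omega) _)
            · omega
        _ = (n + 2) ^ (W + k) := (pow_add _ _ _).symm
        _ ≤ _ := Nat.pow_le_pow_right (by omega) (by omega)
    have e2 : n + 2 ≤ (n + 2) ^ (W + k + 1) := Nat.le_self_pow (by omega) _
    have e3 : 2 * (n + 2) ^ (W + k + 1) ≤ (n + 2) ^ (W + k + 2) := by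
      rw [pow_succ _ (W + k + 1), mul_comm]
      gcongr
      omega
    have e4 : (n + 2) ^ (W + k + 2) ≤ B := Nat.pow_le_pow_right (by omega) (by omega)
    omega
  have hrun : Runs L B c' (fun _ => 0) (1 + K * n ^ E) fun τ => τ 2 = F n G := by
    refine Runs.seq (Q₁ := fun τ => τ = Function.update (fun _ => 0) 1 1)
      (Runs.op (fun _ => Nat.zero_le _) (by simp only [Op.value]; omega) rfl) ?_
    rintro τ hτ rfl
    exact (h n G L hn hd B hB _ hτ (by simp) (by simp)).mono le_rfl fun τ _ hτ => hτ.1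
  obtain ⟨σ', t, ht, hQ, -, hreach⟩ := hrun
  obtain ⟨h1, h2⟩ := hreach S 0 (c'.code S 0) [] [] (toReg S 2) (le_max_left _ _) (by simp) rfl
  refine ⟨t, ht.trans ?_, ?_, ?_, h2⟩
  · calc 1 + K * n ^ E ≤ n ^ E + K * n ^ E := by gcongr; exact Nat.one_le_pow _ _ hn
      _ = (K + 1) * n ^ E := by ring
      _ ≤ f * n ^ E := by gcongr; omega
  · rw [Program.run]
    erw [h1]
    simp [Config.of, Cmd.length_code]
  · rw [Program.run]
    erw [h1]
    rw [Config.of_reg (le_max_right _ _), hQ]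

end RAM

/-! ### The two statements together. -/

theorem theorem1p5 :
    -- every finite DAG with `ℓ` edges has DAG treedepth at most `⌊ℓ/5⌋ + 3`
    (∀ (V : Type*) [Finite V] (D : Digraph V), D.IsAcyclic →
      D.dagTreedepth ≤ ((D.numEdges / 5 + 3 : ℕ) : ℕ∞)) ∧
    -- counting homomorphisms from `H` and subgraphs isomorphic to `H`; for fixed `k` and `d`, the
    -- number of steps is `O(n ^ (⌊ℓ/5⌋ + 3))`, the number of registers is bounded by a constant, and
    -- each register holds a word of `O(log n)` bits
    (∃ f : ℕ → ℕ → ℕ, ∀ (k d : ℕ) (H : SimpleGraph (Fin k)),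
      ∃ Phom Psub : RAM.Program, Phom.numRegs ≤ f k d ∧ Psub.numRegs ≤ f k d ∧
        ∀ (n : ℕ) (G : SimpleGraph (Fin n)) (L : G.AdjLists), 1 ≤ n → G.IsDegenerate d →
          Phom.Computes L (Nat.card (H →g G))
            (f k d * n ^ (H.edgeSet.ncard / 5 + 3)) ((n + 2) ^ f k d) ∧
          Psub.Computes L (G.copyCount H)
            (f k d * n ^ (H.edgeSet.ncard / 5 + 3)) ((n + 2) ^ f k d)) := by
  refine ⟨fun V _ D hD => Digraph.dagTreedepth_le hD, ?_⟩
  have key : ∀ (k d : ℕ) (H : SimpleGraph (Fin k)), ∃ N, ∀ f, N ≤ f →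
      ∃ Phom Psub : RAM.Program, Phom.numRegs ≤ f ∧ Psub.numRegs ≤ f ∧
        ∀ (n : ℕ) (G : SimpleGraph (Fin n)) (L : G.AdjLists), 1 ≤ n → G.IsDegenerate d →
          Phom.Computes L (Nat.card (H →g G))
            (f * n ^ (H.edgeSet.ncard / 5 + 3)) ((n + 2) ^ f) ∧
          Psub.Computes L (G.copyCount H)
            (f * n ^ (H.edgeSet.ncard / 5 + 3)) ((n + 2) ^ f) := by
    intro k d H
    obtain ⟨c₁, K₁, h₁⟩ := RAM.exists_computesWithin_hom (d := d) (W := 1) (k := k) H (by simp)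
      le_rfl le_rfl le_rfl
    obtain ⟨W, c₂, K₂, h₂⟩ := RAM.exists_computesWithin_copyCount (d := d) H le_rfl le_rfl
    obtain ⟨N₁, hN₁⟩ := h₁.exists_program
    obtain ⟨N₂, hN₂⟩ := h₂.exists_program
    refine ⟨max N₁ N₂, fun f hf => ?_⟩
    obtain ⟨P₁, hP₁, hC₁⟩ := hN₁ f ((le_max_left _ _).trans hf)
    obtain ⟨P₂, hP₂, hC₂⟩ := hN₂ f ((le_max_right _ _).trans hf)
    exact ⟨P₁, P₂, hP₁, hP₂, fun n G L hn hd => ⟨hC₁ n G L hn hd, hC₂ n G L hn hd⟩⟩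
  choose N hN using key
  classical
  -- There are finitely many graphs on `Fin k`, so one constant serves all of them.
  exact ⟨fun k d => Finset.univ.sup (N k d),
    fun k d H => hN k d H _ (Finset.le_sup (Finset.mem_univ H))⟩
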